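/- Let $\sigma_k$ denote the $k$-th elementary symmetric function of $n$ real variables ($\sigma_0=1$, and $\sigma_k=0$ for $k<0$ or $k>n$). For a $C^2$ function $u$ on an open subset of $\mathbb R^n$ let $\lambda_1,\dots,\lambda_n$ be the eigenvalues of the Hessian $D^2u(x)$ and put $\eta_i=\sum_{j\ne i}\lambda_j$, so that $\eta=(\eta_1,\dots,\eta_n)$ are the eigenvalues of $(\Delta u)I-D^2u$. The function $u$ is called $(n-1)$-admissible in $\Omega$ if $\sigma_m(\eta)>0$ for $m=1,\dots,n-1$ at every point of $\Omega$. Theorem. Let $n,l$ be integers with $0\le l<n-1$, and let $d,\Lambda,K\in\mathbb R$ and $m>0$. There are constants $\beta>0$ and $C>0$, depending only on $n,l,d,m,\Lambda,K$, with the following property. Let $\alpha\ge 0$, let $\Omega\subset\mathbb R^n$ be a bounded domain of diameter at most $d$, and let $f\in C^2(\overline\Omega\times\mathbb R\times\mathbb R^n)$ be positive, with $f\ge m$ and with $f$ and its derivatives of order at most two bounded in norm by $\Lambda$ on $\Omega\times\{|z|\le K\}\times\{|p|\le K\}$. Let $u\in C^4(\Omega)\cap C^2(\overline\Omega)$ be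 an $(n-1)$-admissible solution of $$\frac{\sigma_n(\eta)+\alpha\,\sigma_{n-1}(\eta)}{\sigma_l(\eta)+\alpha\,\sigma_{l-1}(\eta)}=f(x,u,Du)\ \text{ in }\Omega,\qquad u=0\ \text{ on }\partial\Omega,$$ with $|u|\le K$ and $|Du|\le K$ in $\Omega$. Then $$(-u)^\beta\,|D^2u|\le C\quad\text{in }\Omega .$$ -/

import Mathlib

namespace SumHessian

/-- `σ_k(lam)`, the `k`-th elementary symmetric function of `lam = (lam_1, …, lam_n)`, for every
integer `k`: it is `1` for `k = 0`, and the sum is empty, hence `0`, for `k < 0` and `k > n`. -/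
noncomputable def sigma {n : ℕ} (k : ℤ) (lam : Fin n → ℝ) : ℝ :=
  ∑ t : Finset (Fin n) with (t.card : ℤ) = k, ∏ i ∈ t, lam i

/-- The sum Hessian function `S_k = σ_k + α σ_{k-1}`. -/
noncomputable def sumSigma {n : ℕ} (α : ℝ) (k : ℤ) (lam : Fin n → ℝ) : ℝ :=
  sigma k lam + α * sigma (k - 1) lam

/-- `η_i = ∑_{j ≠ i} lam_j`. -/
def eta {n : ℕ} (lam : Fin n → ℝ) (i : Fin n) : ℝ :=
  ∑ j ∈ Finset.univ.erase i, lam j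

/-- The cone `Γ'_k` of all `lam` with `σ_m(η) > 0` for `m = 1, …, k`. -/
def coneGamma' (n k : ℕ) : Set (Fin n → ℝ) :=
  {lam | ∀ m : ℕ, 1 ≤ m → m ≤ k → 0 < sigma (m : ℤ) (eta lam)}

/-- The Hessian matrix `D²u(x)`. -/
noncomputable def hess {n : ℕ} (u : EuclideanSpace ℝ (Fin n) → ℝ)
    (x : EuclideanSpace ℝ (Fin n)) : Matrix (Fin n) (Fin n) ℝ :=
  fun i j => iteratedFDeriv ℝ 2 u x ![EuclideanSpace.single i 1, EuclideanSpace.single j 1]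

open Classical in
/-- The eigenvalues of `D²u(x)`, with multiplicity. The Hessian matrix of a function that is `C²`
near `x` is symmetric; the value `0` is a dummy for the points where it is not symmetric. -/
noncomputable def hessEigenvalues {n : ℕ} (u : EuclideanSpace ℝ (Fin n) → ℝ)
    (x : EuclideanSpace ℝ (Fin n)) : Fin n → ℝ :=
  if h : (hess u x).IsHermitian then h.eigenvalues else 0

/-- `u` is `k`-admissible in `Ω`. -/
def IsAdmissible {n : ℕ} (k : ℕ) (Ω : Set (EuclideanSpace ℝ (Fin n)))
    (u : EuclideanSpace ℝ (Fin n) → ℝ) : Prop :=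
  ∀ x ∈ Ω, hessEigenvalues u x ∈ coneGamma' n k

/-- `g ∈ C^r(closure U)` for an open set `U`: `g` is `C^r` in `U`, it is continuous on the closure,
and its derivatives of order at most `r` extend continuously to the closure of `U`. -/
def IsCkClosure {E : Type*} [NormedAddCommGroup E] [NormedSpace ℝ E] (r : ℕ) (U : Set E)
    (g : E → ℝ) : Prop :=
  ContDiffOn ℝ r g U ∧ ContinuousOn g (closure U) ∧
    ∀ j ≤ r, ∃ G : E → ContinuousMultilinearMap ℝ (fun _ : Fin j => E) ℝ,
      ContinuousOn G (closure U) ∧ Set.EqOn G (iteratedFDeriv ℝ j g) U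

/-- `u` solves `S_k(η) / S_l(η) = f(x, u, Du)` in `Ω`, `u = 0` on `∂Ω`, where `η` is formed from the
eigenvalues of `D²u`. -/
def SolvesDirichlet {n : ℕ} (k l : ℕ) (α : ℝ) (Ω : Set (EuclideanSpace ℝ (Fin n)))
    (f : EuclideanSpace ℝ (Fin n) × ℝ × EuclideanSpace ℝ (Fin n) → ℝ)
    (u : EuclideanSpace ℝ (Fin n) → ℝ) : Prop :=
  (∀ x ∈ Ω, sumSigma α (k : ℤ) (eta (hessEigenvalues u x)) /
      sumSigma α (l : ℤ) (eta (hessEigenvalues u x)) = f (x, u x, gradient u x)) ∧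
    ∀ x ∈ frontier Ω, u x = 0

end SumHessian

set_option linter.unusedSectionVars false
set_option maxSynthPendingDepth 3

namespace SumHessian

/-! ### Elementary symmetric functions over a finite index set. -/

section Esym

variable {ι : Type*} [DecidableEq ι]

/-! Adjoin `α` to the vector `η` as an `(n+1)`-st entry. Then `S_k(η) = σ_k(η, α)`
(`sumSigma_eq_esym`), so the equation reads `log (σ_n / σ_l) = log f` in `n + 1` entries, and no
constant sees `α` because only `α ≥ 0` is ever used. Admissibility and `f > 0` put these entries in
the Gårding cone of order `n`. There `log (σ_n / σ_l)` is concave, being a telescoping sum of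
logarithms of consecutive quotients, which are homogeneous of degree one and superadditive
(`esym_div_esym_superadditive`).

Concavity replaces the differentiation of eigenvalues. Let `G` be the supergradient at the
eigenvalues of `D²u(x₀)`. The diagonal of `D²u(x)` in an orthonormal frame is a doubly stochastic
image of its eigenvalues (`exists_doublyStochastic`), so by Birkhoff's theorem and symmetry `log
f(x, u, Du) - ∑ G_i D²u(x)(v_i, v_i)`, as a function of the point `x` and the frame `v`, is largest
at `x₀` with the eigenframe (`exists_isLinearization`). Moving along a line while the frame rotates
by `exp (tA)`, the first derivative gives the linearized equation and the second a concavity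
inequality with one free parameter `θ_i` per plane of rotation (`second_deriv_le_of_dominated`).
These parameters stand in for the usual good third-order terms.

The rest is Pogorelov's argument. Since `u < 0` inside, `(-u)^β u_ξξ exp ((a/2)|Du|² + (A/2)|x -
y|²)` has an interior maximum, and there `ξ` may be taken to be the top eigenvector, with eigenvalue
`L`. The maximum conditions are collected in `IsMaxRelation`; they bound `(-u) L` in two cases.
Because `η_i` omits `lam_i`, every `G_i` other than the top one is comparable with `∑ G`. If some
other eigenvalue is comparable with `L`, then `a ∑ G_i lam_i²` is of order `L² ∑ G` and dominates
(`IsMaxRelation.le_of_large`). Otherwise `η` has one possibly small entry and all others of order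
`L`; as `l ≤ n - 2`, this forces `∑ G ≥ c' L` (`exists_mul_le_supergradient`), and `A ∑ G` absorbs
the error of order `L` from the right-hand side, while the rotation terms with `θ_i = q_i`, where `q
= D u₁₁ / u₁₁`, absorb `∑ G_i q_i²` up to multiples of the smallest coefficient
(`IsMaxRelation.le_of_small`). -/

/-- The `k`-th elementary symmetric function of the entries `κ i`, `i ∈ s`. -/
noncomputable def esym (k : ℕ) (s : Finset ι) (κ : ι → ℝ) : ℝ :=
  ∑ t ∈ s.powersetCard k, ∏ i ∈ t, κ i

@[simp] lemma esym_zero (s : Finset ι) (κ : ι → ℝ) : esym 0 s κ = 1 := by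
  simp [esym]

lemma esym_one (s : Finset ι) (κ : ι → ℝ) : esym 1 s κ = ∑ i ∈ s, κ i := by
  simp [esym, Finset.powersetCard_one]

lemma esym_eq_zero {k : ℕ} {s : Finset ι} (h : s.card < k) (κ : ι → ℝ) : esym k s κ = 0 := by
  simp [esym, Finset.powersetCard_eq_empty.2 h]

lemma esym_insert {a : ι} {s : Finset ι} (ha : a ∉ s) (k : ℕ) (κ : ι → ℝ) :
    esym (k + 1) (insert a s) κ = esym (k + 1) s κ + κ a * esym k s κ := by
  unfold esym
  rw [Finset.powersetCard_succ_insert ha, Finset.sum_union, Finset.mul_sum]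
  · congr 1
    rw [Finset.sum_image]
    · refine Finset.sum_congr rfl fun t ht => ?_
      rw [Finset.prod_insert fun h => ha ((Finset.mem_powersetCard.1 ht).1 h)]
    · intro t ht t' ht' h
      have h1 := fun h => ha ((Finset.mem_powersetCard.1 ht).1 h)
      have h2 := fun h => ha ((Finset.mem_powersetCard.1 ht').1 h)
      rw [← Finset.erase_insert h1, ← Finset.erase_insert h2, h]
  · rw [Finset.disjoint_left]
    intro t ht h
    obtain ⟨t', -, rfl⟩ := Finset.mem_image.1 h
    exact ha ((Finset.mem_powersetCard.1 ht).1 (Finset.mem_insert_self _ _))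

lemma esym_erase {a : ι} {s : Finset ι} (ha : a ∈ s) (k : ℕ) (κ : ι → ℝ) :
    esym (k + 1) s κ = esym (k + 1) (s.erase a) κ + κ a * esym k (s.erase a) κ := by
  conv_lhs => rw [← Finset.insert_erase ha]
  exact esym_insert (Finset.notMem_erase a s) k κ

lemma esym_smul (c : ℝ) (k : ℕ) (s : Finset ι) (κ : ι → ℝ) :
    esym k s (c • κ) = c ^ k * esym k s κ := by
  unfold esym
  rw [Finset.mul_sum]
  refine Finset.sum_congr rfl fun t ht => ?_
  simp [Finset.prod_mul_distrib, (Finset.mem_powersetCard.1 ht).2]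

lemma esym_congr {k : ℕ} {s : Finset ι} {κ μ : ι → ℝ} (h : ∀ i ∈ s, κ i = μ i) :
    esym k s κ = esym k s μ :=
  Finset.sum_congr rfl fun _ ht =>
    Finset.prod_congr rfl fun i hi => h i ((Finset.mem_powersetCard.1 ht).1 hi)

lemma esym_map {ι' : Type*} (e : ι' ↪ ι) (k : ℕ) (s : Finset ι') (κ : ι → ℝ) :
    esym k (s.map e) κ = esym k s (κ ∘ e) := by
  unfold esym
  rw [Finset.powersetCard_map, Finset.sum_map]
  exact Finset.sum_congr rfl fun t _ => by simp

/-- Euler's relation for the elementary symmetric functions. -/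
lemma sum_mul_esym_erase (s : Finset ι) (k : ℕ) (κ : ι → ℝ) :
    ∑ i ∈ s, κ i * esym k (s.erase i) κ = (k + 1) * esym (k + 1) s κ := by
  induction s using Finset.induction_on generalizing k with
  | empty => rw [esym_eq_zero (by simp), Finset.sum_empty, mul_zero]
  | insert a s ha ih =>
    have key : ∀ i ∈ s, (insert a s).erase i = insert a (s.erase i) := fun i hi =>
      Finset.erase_insert_of_ne fun h => ha (h ▸ hi)
    rw [Finset.sum_insert ha, Finset.erase_insert ha, esym_insert ha]
    cases k with
    | zero =>
      have := ih 0
      simp only [esym_zero] at this ⊢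
      push_cast at this ⊢
      linarith
    | succ k =>
      have h1 : ∑ i ∈ s, κ i * esym (k + 1) ((insert a s).erase i) κ
          = ∑ i ∈ s, κ i * esym (k + 1) (s.erase i) κ
            + κ a * ∑ i ∈ s, κ i * esym k (s.erase i) κ := by
        rw [Finset.mul_sum, ← Finset.sum_add_distrib]
        refine Finset.sum_congr rfl fun i hi => ?_
        rw [key i hi, esym_insert fun h => ha (Finset.mem_of_mem_erase h)]
        ring
      rw [h1, ih, ih]
      push_cast
      ring

end Esym

/-! ### Newton's inequality, the Gårding cone and superadditivity of quotients. -/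

section Newton

open Polynomial

/-- By Rolle, the derivative has at least as many roots as `p`, less one. -/
lemma splits_derivative {p : ℝ[X]} (hp : p.Splits) : (derivative p).Splits := by
  rw [splits_iff_card_roots] at hp ⊢
  have h1 := card_roots_le_derivative p
  have h2 := card_roots' (derivative p)
  have h3 := natDegree_derivative_le p
  omega

lemma splits_iterate_derivative {p : ℝ[X]} (hp : p.Splits) (m : ℕ) :
    (derivative^[m] p).Splits := by
  induction m with
  | zero => exact hp
  | succ m ih =>
    rw [Function.iterate_succ_apply']
    exact splits_derivative ih

/-- The defect `p₁² - 2 p₀ p₂` of a product `(X - a) q` equals `q₀² + a² (q₁² - 2 q₀ q₂)`, so it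
stays nonnegative as linear factors are added. -/
lemma two_mul_coeff_le_sq_coeff {p : ℝ[X]} (hp : p.Splits) :
    2 * (p.coeff 0 * p.coeff 2) ≤ p.coeff 1 ^ 2 := by
  rw [hp.eq_prod_roots]
  generalize p.roots = R
  simp only [coeff_C_mul]
  suffices h : 2 * (((R.map fun a => X - C a).prod).coeff 0 * ((R.map fun a => X - C a).prod).coeff 2)
      ≤ ((R.map fun a => X - C a).prod).coeff 1 ^ 2 by
    nlinarith [mul_le_mul_of_nonneg_left h (sq_nonneg p.leadingCoeff)]
  induction R using Multiset.induction_on with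
  | empty => simp [coeff_one]
  | cons a R ih =>
    rw [Multiset.map_cons, Multiset.prod_cons]
    generalize (R.map fun a => X - C a).prod = q at ih
    have h0 : ((X - C a) * q).coeff 0 = -a * q.coeff 0 := by simp [sub_mul]
    have h1 : ((X - C a) * q).coeff 1 = q.coeff 0 - a * q.coeff 1 := by
      simp [sub_mul, coeff_X_mul (n := 0)]
    have h2 : ((X - C a) * q).coeff 2 = q.coeff 1 - a * q.coeff 2 := by
      simp [sub_mul, coeff_X_mul (n := 1)]
    rw [h0, h1, h2]
    nlinarith [mul_le_mul_of_nonneg_left ih (sq_nonneg a), sq_nonneg (q.coeff 0)]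

variable {ι : Type*} [DecidableEq ι]

/-- Newton's inequality in its weak form, for arbitrary real entries. -/
lemma esym_mul_esym_le_sq (k : ℕ) (s : Finset ι) (κ : ι → ℝ) :
    esym (k + 2) s κ * esym k s κ ≤ esym (k + 1) s κ ^ 2 := by
  rcases lt_or_ge s.card (k + 2) with h | h
  · rw [esym_eq_zero h, zero_mul]
    positivity
  obtain ⟨m, hm⟩ := Nat.exists_eq_add_of_le h
  set p : ℝ[X] := ∏ i ∈ s, (X + C (κ i)) with hp
  have hs : p.Splits := Splits.prod fun i _ => Splits.X_add_C _
  have hc : ∀ j ≤ k + 2, p.coeff (j + m) = esym (k + 2 - j) s κ := fun j hj => by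
    rw [hp, Finset.prod_X_add_C_coeff s κ (by omega), esym]
    congr 2
    omega
  -- The `m`-th derivative of `∏ (X + κ i)` brings `σ_{k+2}`, `σ_{k+1}`, `σ_k` to degrees 0, 1, 2.
  -- Once the factorials are cleared this is `(m + 2) σ_{k+2} σ_k ≤ (m + 1) σ_{k+1}²`.
  have key := two_mul_coeff_le_sq_coeff (splits_iterate_derivative hs m)
  simp only [coeff_iterate_derivative] at key
  rw [hc 0 (by omega), hc 1 (by omega), hc 2 (by omega)] at key
  have d0 : ((0 + m).descFactorial m : ℝ) = m.factorial := by
    simp [Nat.descFactorial_self]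
  have d1 : ((1 + m).descFactorial m : ℝ) = m.factorial * (m + 1) := by
    rw [Nat.descFactorial_eq_factorial_mul_choose, add_comm 1 m, Nat.choose_succ_self_right]
    push_cast; ring
  have d2 : (2 * (2 + m).descFactorial m : ℝ) = m.factorial * ((m + 2) * (m + 1)) := by
    have h2 := Nat.descFactorial_mul_descFactorial (k := m) (m := m + 2) (n := 2 + m) (by omega)
    rw [show m + 2 - m = 2 by omega, show 2 + m - m = 2 by omega, show m + 2 = 2 + m by omega,
      Nat.descFactorial_self, Nat.descFactorial_self] at h2
    have h3 : (Nat.factorial (2 + m) : ℝ) = (m + 2) * ((m + 1) * m.factorial) := by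
      rw [add_comm 2 m, Nat.factorial_succ, Nat.factorial_succ]; push_cast; ring
    have h4 : (2 * (2 + m).descFactorial m : ℝ) = (Nat.factorial (2 + m) : ℝ) := by
      rw [← h2]; simp
    rw [h4, h3]; ring
  simp only [nsmul_eq_mul, d0, d1] at key
  have hf : (0 : ℝ) < m.factorial := by positivity
  have e1 : k + 2 - 0 = k + 2 := rfl
  have e2 : k + 2 - 1 = k + 1 := rfl
  have e3 : k + 2 - 2 = k := rfl
  rw [e1, e2, e3] at key
  set x := esym (k + 2) s κ
  set y := esym (k + 1) s κ
  set z := esym k s κ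
  have key' : (m.factorial : ℝ) ^ 2 * (m + 1) * ((m + 2) * (x * z))
      ≤ (m.factorial : ℝ) ^ 2 * (m + 1) * ((m + 1) * y ^ 2) := by
    calc _ = (m.factorial : ℝ) * x * (m.factorial * ((m + 2) * (m + 1))) * z := by ring
      _ = 2 * ((m.factorial : ℝ) * x * ((2 + m).descFactorial m * z)) := by rw [← d2]; ring
      _ ≤ _ := key
      _ = _ := by ring
  have key2 := le_of_mul_le_mul_left key' (by positivity)
  rcases le_or_gt (x * z) 0 with h0 | h0
  · exact h0.trans (sq_nonneg y)
  · have hm0 : (0 : ℝ) ≤ m := Nat.cast_nonneg m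
    by_contra hcon
    push Not at hcon
    nlinarith

/-- The Gårding cone of the entries indexed by `s`. -/
def gardingCone (k : ℕ) (s : Finset ι) : Set (ι → ℝ) :=
  {κ | ∀ j ≤ k, 0 < esym j s κ}

lemma gardingCone_mono {k k' : ℕ} (h : k ≤ k') {s : Finset ι} {κ : ι → ℝ}
    (hκ : κ ∈ gardingCone k' s) : κ ∈ gardingCone k s :=
  fun j hj => hκ j (hj.trans h)

lemma gardingCone_smul {k : ℕ} {s : Finset ι} {κ : ι → ℝ} (hκ : κ ∈ gardingCone k s) {c : ℝ}
    (hc : 0 < c) : c • κ ∈ gardingCone k s := fun j hj => by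
  rw [esym_smul]
  exact mul_pos (pow_pos hc _) (hκ j hj)

/-- Write `x, y, z` for the functions of order `k+2, k+1, k` without the entry `κ i`. If `y ≤ 0 <
z`, then `y + κ i z > 0` and `x + κ i y > 0` force `κ i > 0` and `x z > -κ i y z ≥ y²`, against
Newton's inequality. -/
lemma gardingCone_erase {k : ℕ} {s : Finset ι} {κ : ι → ℝ} (hκ : κ ∈ gardingCone (k + 1) s)
    {i : ι} (hi : i ∈ s) : κ ∈ gardingCone k (s.erase i) := by
  induction k with
  | zero =>
    intro j hj
    obtain rfl : j = 0 := by omega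
    simp
  | succ k ih =>
    have ihk := ih (gardingCone_mono (by omega) hκ)
    intro j hj
    rcases Nat.lt_or_ge j (k + 1) with h | h
    · exact ihk j (by omega)
    obtain rfl : j = k + 1 := by omega
    have h1 := hκ (k + 1) (by omega)
    have h2 := hκ (k + 2) (by omega)
    rw [esym_erase hi] at h1 h2
    have h3 := ihk k le_rfl
    have hN := esym_mul_esym_le_sq k (s.erase i) κ
    set x := esym (k + 2) (s.erase i) κ
    set y := esym (k + 1) (s.erase i) κ
    set z := esym k (s.erase i) κ
    by_contra hy
    push Not at hy
    have hκi : 0 ≤ κ i := by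
      by_contra hneg
      push Not at hneg
      nlinarith
    have hx : 0 < x := by nlinarith
    nlinarith [mul_pos hx h3, mul_pos h2 h3]

/-- The expression of `σ_{k+2}/σ_{k+1}` through the quotients with one entry left out. -/
lemma mul_esym_div_esym {k : ℕ} {s : Finset ι} {κ : ι → ℝ} (hκ : κ ∈ gardingCone (k + 1) s) :
    (k + 2 : ℝ) * (esym (k + 2) s κ / esym (k + 1) s κ) =
      ∑ i ∈ s, (κ i - κ i ^ 2 /
        (κ i + esym (k + 1) (s.erase i) κ / esym k (s.erase i) κ)) := by
  have h := sum_mul_esym_erase s (k + 1) κ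
  have hp := hκ (k + 1) le_rfl
  have h' : (k + 2 : ℝ) * (esym (k + 2) s κ / esym (k + 1) s κ)
      = ∑ i ∈ s, κ i * esym (k + 1) (s.erase i) κ / esym (k + 1) s κ := by
    rw [← Finset.sum_div, h]
    push_cast
    ring
  rw [h']
  refine Finset.sum_congr rfl fun i hi => ?_
  have hz := gardingCone_erase hκ hi k le_rfl
  rw [esym_erase hi] at hp ⊢
  have e : κ i + esym (k + 1) (s.erase i) κ / esym k (s.erase i) κ
      = (esym (k + 1) (s.erase i) κ + κ i * esym k (s.erase i) κ) / esym k (s.erase i) κ := by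
    field_simp
    ring
  rw [e]
  field_simp
  ring

/-- The function `a² / x` is convex and homogeneous of degree one, hence subadditive, and it
decreases in `x`. -/
lemma add_sq_div_le {a b x y z : ℝ} (hx : 0 < x) (hy : 0 < y) (hz : x + y ≤ z) :
    (a + b) ^ 2 / z ≤ a ^ 2 / x + b ^ 2 / y := by
  calc (a + b) ^ 2 / z ≤ (a + b) ^ 2 / (x + y) := by gcongr
    _ ≤ a ^ 2 / x + b ^ 2 / y := by
      rw [div_add_div _ _ hx.ne' hy.ne', div_le_div_iff₀ (by positivity) (by positivity)]
      nlinarith [mul_pos hx hy, sq_nonneg (a * y - b * x)]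

/-- The Gårding cone is closed under addition, and the quotients of consecutive elementary
symmetric functions are superadditive on it. -/
theorem esym_div_esym_superadditive (k : ℕ) (s : Finset ι) (κ μ : ι → ℝ)
    (hκ : κ ∈ gardingCone (k + 1) s) (hμ : μ ∈ gardingCone (k + 1) s) :
    κ + μ ∈ gardingCone (k + 1) s ∧
      esym (k + 1) s κ / esym k s κ + esym (k + 1) s μ / esym k s μ
        ≤ esym (k + 1) s (κ + μ) / esym k s (κ + μ) := by
  induction k generalizing s with
  | zero =>
    have e : esym 1 s (κ + μ) = esym 1 s κ + esym 1 s μ := by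
      simp [esym_one, Finset.sum_add_distrib]
    refine ⟨fun j hj => ?_, by simp [e]⟩
    obtain rfl | rfl : j = 0 ∨ j = 1 := by omega
    · simp
    · rw [e]
      exact add_pos (hκ 1 le_rfl) (hμ 1 le_rfl)
  | succ k ih =>
    have hκ' := gardingCone_mono (Nat.le_succ (k + 1)) hκ
    have hμ' := gardingCone_mono (Nat.le_succ (k + 1)) hμ
    have h1 := (ih s hκ' hμ').1
    have hq : esym (k + 2) s κ / esym (k + 1) s κ + esym (k + 2) s μ / esym (k + 1) s μ
        ≤ esym (k + 2) s (κ + μ) / esym (k + 1) s (κ + μ) := by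
      have hk : (0 : ℝ) < k + 2 := by positivity
      refine le_of_mul_le_mul_left ?_ hk
      rw [mul_add, mul_esym_div_esym hκ', mul_esym_div_esym hμ', mul_esym_div_esym h1,
        ← Finset.sum_add_distrib]
      refine Finset.sum_le_sum fun i hi => ?_
      have pos : ∀ ν ∈ gardingCone (k + 1) s,
          0 < ν i + esym (k + 1) (s.erase i) ν / esym k (s.erase i) ν := fun ν hν => by
        have hz := gardingCone_erase hν hi k le_rfl
        have hp := hν (k + 1) le_rfl
        rw [esym_erase hi] at hp
        rw [show ν i + esym (k + 1) (s.erase i) ν / esym k (s.erase i) ν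
          = (esym (k + 1) (s.erase i) ν + ν i * esym k (s.erase i) ν) / esym k (s.erase i) ν by
            field_simp; ring]
        positivity
      -- In `mul_esym_div_esym` the quotient of lower order enters only through a denominator. Its
      -- superadditivity, known by induction, makes the subtracted square terms subadditive.
      have hs := (ih (s.erase i) (gardingCone_erase hκ hi) (gardingCone_erase hμ hi)).2
      have := add_sq_div_le (a := κ i) (b := μ i) (pos κ hκ') (pos μ hμ')
        (z := (κ + μ) i + esym (k + 1) (s.erase i) (κ + μ) / esym k (s.erase i) (κ + μ))
        (by simp only [Pi.add_apply]; linarith)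
      simp only [Pi.add_apply] at this ⊢
      linarith
    refine ⟨fun j hj => ?_, hq⟩
    rcases Nat.lt_or_ge j (k + 2) with h | h
    · exact h1 j (by omega)
    obtain rfl : j = k + 2 := by omega
    have p1 := div_pos (hκ (k + 2) le_rfl) (hκ (k + 1) (by omega))
    have p2 := div_pos (hμ (k + 2) le_rfl) (hμ (k + 1) (by omega))
    have p3 := h1 (k + 1) le_rfl
    have : 0 < esym (k + 2) s (κ + μ) / esym (k + 1) s (κ + μ) := by linarith
    exact (div_pos_iff_of_pos_right p3).1 this

end Newton

/-! ### Concavity of the logarithm of a quotient, and its supergradients. -/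

section Quotient

variable {ι : Type*} [Fintype ι] [DecidableEq ι]

/-- `log (σ_k / σ_l)`. -/
noncomputable def logQuot (k l : ℕ) (κ : ι → ℝ) : ℝ :=
  Real.log (esym k Finset.univ κ) - Real.log (esym l Finset.univ κ)

lemma convex_gardingCone (k : ℕ) (s : Finset ι) : Convex ℝ (gardingCone k s) := by
  refine convex_iff_forall_pos.2 fun κ hκ μ hμ a b ha hb _ => ?_
  have h1 := gardingCone_smul hκ ha
  have h2 := gardingCone_smul hμ hb
  cases k with
  | zero =>
    intro j hj
    obtain rfl : j = 0 := by omega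
    simp
  | succ k => exact (esym_div_esym_superadditive k s _ _ h1 h2).1

/-- A superadditive function that is homogeneous of degree one is concave, and the logarithm is
increasing and concave. -/
lemma concaveOn_log_esym_div_esym (k : ℕ) (s : Finset ι) :
    ConcaveOn ℝ (gardingCone (k + 1) s)
      fun κ => Real.log (esym (k + 1) s κ) - Real.log (esym k s κ) := by
  refine concaveOn_iff_forall_pos.2 ⟨convex_gardingCone _ s, fun κ hκ μ hμ a b ha hb hab => ?_⟩
  have h1 := gardingCone_smul hκ ha
  have h2 := gardingCone_smul hμ hb
  obtain ⟨h3, h4⟩ := esym_div_esym_superadditive k s _ _ h1 h2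
  have e : ∀ {ν : ι → ℝ}, ν ∈ gardingCone (k + 1) s →
      Real.log (esym (k + 1) s ν) - Real.log (esym k s ν)
        = Real.log (esym (k + 1) s ν / esym k s ν) := fun {ν} hν =>
    (Real.log_div (hν (k + 1) le_rfl).ne' (hν k (by omega)).ne').symm
  have pos : ∀ {ν : ι → ℝ}, ν ∈ gardingCone (k + 1) s →
      0 < esym (k + 1) s ν / esym k s ν := fun {ν} hν =>
    div_pos (hν (k + 1) le_rfl) (hν k (by omega))
  have hs : ∀ (c : ℝ) {ν : ι → ℝ}, 0 < c → esym (k + 1) s (c • ν) / esym k s (c • ν)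
      = c * (esym (k + 1) s ν / esym k s ν) := fun c ν hc => by
    rw [esym_smul, esym_smul, pow_succ, mul_assoc, mul_div_mul_left _ _ (pow_pos hc k).ne',
      mul_div_assoc]
  rw [e hκ, e hμ, e h3]
  rw [hs a ha, hs b hb] at h4
  refine le_trans ?_ (Real.log_le_log ?_ h4)
  · exact strictConcaveOn_log_Ioi.concaveOn.2 (pos hκ) (pos hμ) ha.le hb.le hab
  · have := pos hκ
    have := pos hμ
    positivity

lemma concaveOn_logQuot {k l : ℕ} (h : l ≤ k) :
    ConcaveOn ℝ (gardingCone k (Finset.univ : Finset ι)) (logQuot k l) := by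
  induction k, h using Nat.le_induction with
  | base =>
    have e : (logQuot l l : (ι → ℝ) → ℝ) = fun _ => 0 := by ext κ; simp [logQuot]
    rw [e]
    exact concaveOn_const 0 (convex_gardingCone _ _)
  | succ k h ih =>
    have h1 := ih.subset (fun κ hκ => gardingCone_mono (Nat.le_succ k) hκ)
      (convex_gardingCone (k + 1) _)
    have e : (logQuot (k + 1) l : (ι → ℝ) → ℝ) =
        (fun κ => Real.log (esym (k + 1) Finset.univ κ) - Real.log (esym k Finset.univ κ))
          + logQuot k l := by
      funext κ
      simp only [logQuot, Pi.add_apply]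
      ring
    rw [e]
    exact (concaveOn_log_esym_div_esym k (Finset.univ : Finset ι)).add h1

lemma logQuot_smul {k l : ℕ} {κ : ι → ℝ} (hκ : κ ∈ gardingCone k (Finset.univ : Finset ι))
    (h : l ≤ k) {c : ℝ} (hc : 0 < c) :
    logQuot k l (c • κ) = logQuot k l κ + ((k : ℝ) - l) * Real.log c := by
  unfold logQuot
  rw [esym_smul, esym_smul, Real.log_mul (by positivity) (hκ k le_rfl).ne',
    Real.log_mul (by positivity) (hκ l h).ne', Real.log_pow, Real.log_pow]
  ring

lemma logQuot_le_logQuot_add {k l : ℕ} (h : l ≤ k) {κ μ : ι → ℝ}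
    (hκ : κ ∈ gardingCone k (Finset.univ : Finset ι))
    (hμ : μ ∈ gardingCone k (Finset.univ : Finset ι)) :
    logQuot k l κ ≤ logQuot k l (κ + μ) := by
  induction k, h using Nat.le_induction with
  | base => simp [logQuot]
  | succ k h ih =>
    have h1 := ih (gardingCone_mono (Nat.le_succ k) hκ) (gardingCone_mono (Nat.le_succ k) hμ)
    obtain ⟨h3, h4⟩ := esym_div_esym_superadditive k _ _ _ hκ hμ
    have p1 := div_pos (hκ (k + 1) le_rfl) (hκ k (by omega))
    have p2 := div_pos (hμ (k + 1) le_rfl) (hμ k (by omega))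
    have h5 := Real.log_le_log p1 (by linarith : _ ≤ esym (k + 1) Finset.univ (κ + μ) /
      esym k Finset.univ (κ + μ))
    rw [Real.log_div (hκ (k + 1) le_rfl).ne' (hκ k (by omega)).ne',
      Real.log_div (h3 (k + 1) le_rfl).ne' (h3 k (by omega)).ne'] at h5
    unfold logQuot at h1 ⊢
    linarith

lemma logQuot_comp_equiv (k l : ℕ) (κ : ι → ℝ) (σ : Equiv.Perm ι) :
    logQuot k l (κ ∘ σ) = logQuot k l κ := by
  have e : ∀ j, esym j Finset.univ (κ ∘ σ) = esym j Finset.univ κ := fun j => by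
    have := esym_map σ.toEmbedding j Finset.univ κ
    rw [Finset.map_univ_equiv] at this
    exact this.symm
  simp [logQuot, e]

lemma gardingCone_comp_equiv {k : ℕ} {κ : ι → ℝ}
    (hκ : κ ∈ gardingCone k (Finset.univ : Finset ι)) (σ : Equiv.Perm ι) :
    κ ∘ σ ∈ gardingCone k (Finset.univ : Finset ι) := fun j hj => by
  have := esym_map σ.toEmbedding j Finset.univ κ
  rw [Finset.map_univ_equiv] at this
  exact this ▸ hκ j hj

lemma esym_pos {k : ℕ} {s : Finset ι} (hk : k ≤ s.card) {κ : ι → ℝ} (h : ∀ i ∈ s, 0 < κ i) :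
    0 < esym k s κ :=
  Finset.sum_pos (fun _ ht =>
    Finset.prod_pos fun i hi => h i ((Finset.mem_powersetCard.1 ht).1 hi))
    (Finset.powersetCard_nonempty.2 hk)

lemma differentiableAt_logQuot {k l : ℕ} (h : l ≤ k) {κ : ι → ℝ}
    (hκ : κ ∈ gardingCone k (Finset.univ : Finset ι)) :
    DifferentiableAt ℝ (logQuot k l) κ := by
  have hd : ∀ j, DifferentiableAt ℝ (fun ν : ι → ℝ => esym j Finset.univ ν) κ := fun j => by
    unfold esym
    fun_prop
  exact ((hd k).log (hκ k le_rfl).ne').sub ((hd l).log (hκ l h).ne')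

lemma le_add_fderiv_of_concaveOn {E : Type*} [NormedAddCommGroup E] [NormedSpace ℝ E]
    {S : Set E} {f : E → ℝ} (hf : ConcaveOn ℝ S f) {x y : E} (hx : x ∈ S) (hy : y ∈ S)
    {f' : E →L[ℝ] ℝ} (hd : HasFDerivAt f f' x) : f y ≤ f x + f' (y - x) := by
  have h1 : HasDerivAt (fun t : ℝ => f (x + t • (y - x))) (f' (y - x)) 0 := by
    have h2 : HasDerivAt (fun t : ℝ => x + t • (y - x)) (y - x) 0 := by
      simpa using ((hasDerivAt_id (0 : ℝ)).smul_const (y - x)).const_add x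
    have h3 : HasFDerivAt f f' (x + (0 : ℝ) • (y - x)) := by simpa using hd
    exact h3.comp_hasDerivAt 0 h2
  have h4 := h1.tendsto_slope_zero_right
  refine sub_le_iff_le_add'.1 (ge_of_tendsto h4 ?_)
  filter_upwards [Ioo_mem_nhdsGT (zero_lt_one' ℝ)] with t ht
  have h5 := hf.2 hx hy (by linarith [ht.2] : (0 : ℝ) ≤ 1 - t) ht.1.le (by ring)
  have e : (1 - t) • x + t • y = x + t • (y - x) := by module
  rw [e] at h5
  simp only [smul_eq_mul, zero_add, zero_smul, add_zero] at h5 ⊢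
  rw [← div_eq_inv_mul, le_div_iff₀ ht.1]
  linarith

/-- `g` is a supergradient of `log (σ_k / σ_l)` at `κ` that is nonnegative, ordered oppositely to
`κ` and has a bounded product with `κ`. -/
structure IsSupergradient (k l : ℕ) (κ g : ι → ℝ) : Prop where
  le : ∀ μ ∈ gardingCone k (Finset.univ : Finset ι),
    logQuot k l μ ≤ logQuot k l κ + ∑ i, g i * (μ i - κ i)
  nonneg : ∀ i, 0 ≤ g i
  antitone : ∀ i j, κ i ≤ κ j → g j ≤ g i
  sum_nonneg : 0 ≤ ∑ i, g i * κ i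
  sum_le : ∑ i, g i * κ i ≤ 2 * k

theorem exists_isSupergradient {k l : ℕ} (h : l ≤ k) (hk : k ≤ Fintype.card ι) {κ : ι → ℝ}
    (hκ : κ ∈ gardingCone k (Finset.univ : Finset ι)) : ∃ g, IsSupergradient k l κ g := by
  have hd := (differentiableAt_logQuot h hκ).hasFDerivAt
  set D := fderiv ℝ (logQuot k l) κ with hD
  have hsum : ∀ v : ι → ℝ, D v = ∑ i, D (Pi.single i 1) * v i := fun v => by
    conv_lhs => rw [pi_eq_sum_univ' v]
    simp [map_sum, mul_comm]
  have hle : ∀ μ ∈ gardingCone k (Finset.univ : Finset ι),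
      logQuot k l μ ≤ logQuot k l κ + D (μ - κ) := fun μ hμ => by
    have hc : ConcaveOn ℝ (gardingCone k (Finset.univ : Finset ι)) (logQuot k l) :=
      concaveOn_logQuot h
    exact le_add_fderiv_of_concaveOn (E := ι → ℝ) hc hκ hμ hd
  have hkl : (0 : ℝ) ≤ (k : ℝ) - l := by
    have : (l : ℝ) ≤ k := by exact_mod_cast h
    linarith
  -- Equal entries need a separate argument: the test by exchanging entries, used below for the
  -- ordering, says nothing then. Here uniqueness of the derivative under the symmetry is used.
  have hswap : ∀ i j, κ i = κ j → D (Pi.single i 1) = D (Pi.single j 1) := fun i j hij => by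
    let T : (ι → ℝ) →L[ℝ] (ι → ℝ) :=
      LinearMap.toContinuousLinearMap (LinearMap.funLeft ℝ ℝ (Equiv.swap i j))
    have hT : ∀ v : ι → ℝ, T v = v ∘ Equiv.swap i j := fun v => rfl
    have hTκ : T κ = κ := by
      rw [hT]
      ext a
      simp only [Function.comp_apply, Equiv.swap_apply_def]
      split_ifs with h1 h2
      · rw [h1, hij]
      · rw [h2, hij]
      · rfl
    have h1 : HasFDerivAt (logQuot k l ∘ T) (D.comp T) κ := by
      have h2 : HasFDerivAt (logQuot k l) D (T κ) := by rw [hTκ]; exact hd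
      exact h2.comp κ T.hasFDerivAt
    have h3 : logQuot k l ∘ T = logQuot k l := by
      ext v
      rw [Function.comp_apply, hT, logQuot_comp_equiv]
    rw [h3] at h1
    have h4 := congrArg (fun F : (ι → ℝ) →L[ℝ] ℝ => F (Pi.single i 1)) (hd.unique h1)
    simp only [ContinuousLinearMap.comp_apply, hT] at h4
    rw [h4]
    congr 1
    ext a
    have : Equiv.swap i j a = i ↔ a = j := by
      rw [Equiv.swap_apply_eq_iff, Equiv.swap_apply_left]
    simp only [Function.comp_apply, Pi.single_apply, this]
  obtain ⟨g, hg⟩ : ∃ g : ι → ℝ, ∀ i, g i = D (Pi.single i 1) := ⟨_, fun _ => rfl⟩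
  have hsum' : ∀ v : ι → ℝ, ∑ i, g i * v i = D v := fun v => by
    rw [hsum v]
    exact Finset.sum_congr rfl fun i _ => by rw [hg]
  refine ⟨g, ?_, ?_, ?_, ?_, ?_⟩
  · intro μ hμ
    have := hle μ hμ
    rw [← hsum'] at this
    simpa using this
  · intro i
    rw [hg]
    refine le_of_forall_pos_le_add fun ε hε => ?_
    set M := |∑ a, D (Pi.single a 1)| + 1
    have hM : 0 < M := by positivity
    -- A coordinate vector alone may lie on the boundary of the cone, so it is moved inside by a
    -- small multiple of the constant vector; `M` keeps the resulting error below `ε`.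
    have hμ : (Pi.single i 1 + fun _ => ε / M) ∈ gardingCone k (Finset.univ : Finset ι) :=
      fun j hj => esym_pos (by rw [Finset.card_univ]; omega) fun a _ => by
        have : (0 : ℝ) ≤ (Pi.single i 1 : ι → ℝ) a := by
          rw [Pi.single_apply]; split_ifs <;> norm_num
        have : 0 < ε / M := by positivity
        simp only [Pi.add_apply]
        linarith
    have h1 := logQuot_le_logQuot_add h hκ hμ
    have hmem : κ + (Pi.single i 1 + fun _ => ε / M) ∈ gardingCone k (Finset.univ : Finset ι) := by
      cases k with
      | zero =>
        intro j hj
        obtain rfl : j = 0 := by omega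
        simp
      | succ k => exact (esym_div_esym_superadditive k _ _ _ hκ hμ).1
    have h2 := hle _ hmem
    rw [add_sub_cancel_left, map_add, hsum (fun _ => ε / M), ← Finset.sum_mul] at h2
    have h3 : (∑ a, D (Pi.single a 1)) * (ε / M) ≤ ε := by
      rw [mul_div_assoc', div_le_iff₀ hM]
      have := le_abs_self (∑ a, D (Pi.single a 1))
      nlinarith
    linarith
  · intro i j hij
    rw [hg, hg]
    rcases hij.eq_or_lt with heq | hlt
    · exact (hswap i j heq).ge
    have h1 := hle _ (gardingCone_comp_equiv hκ (Equiv.swap i j))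
    rw [logQuot_comp_equiv] at h1
    have e : κ ∘ Equiv.swap i j - κ = (κ j - κ i) • (Pi.single i 1 - Pi.single j 1) := by
      have hne : i ≠ j := fun h => hlt.ne (by rw [h])
      ext a
      simp only [Pi.sub_apply, Function.comp_apply, Pi.smul_apply, smul_eq_mul]
      by_cases hai : a = i
      · subst hai
        rw [Equiv.swap_apply_left, Pi.single_eq_same, Pi.single_eq_of_ne hne]
        ring
      by_cases haj : a = j
      · subst haj
        rw [Equiv.swap_apply_right, Pi.single_eq_same, Pi.single_eq_of_ne hai]
        ring
      rw [Equiv.swap_apply_of_ne_of_ne hai haj, Pi.single_eq_of_ne hai, Pi.single_eq_of_ne haj]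
      ring
    rw [e, map_smul, map_sub, smul_eq_mul] at h1
    nlinarith
  -- Testing concavity at `2κ` here, and at `κ/2` in the next bullet, bounds the derivative in the
  -- direction `κ` from both sides; `log 2 ≤ 1` yields the bound `2k`.
  · rw [hsum' κ]
    have h1 := hle _ (gardingCone_smul hκ (zero_lt_two' ℝ))
    rw [logQuot_smul hκ h two_pos, show (2 : ℝ) • κ - κ = κ by module] at h1
    have := mul_nonneg hkl (Real.log_nonneg one_le_two)
    linarith
  · rw [hsum' κ]
    have h1 := hle _ (gardingCone_smul hκ (one_half_pos (α := ℝ)))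
    rw [logQuot_smul hκ h one_half_pos,
      show (1 / 2 : ℝ) • κ - κ = (-(1 / 2) : ℝ) • κ by module, map_smul, smul_eq_mul] at h1
    have h2 : Real.log (1 / 2) = -Real.log 2 := by rw [one_div, Real.log_inv]
    rw [h2] at h1
    have h3 : Real.log 2 ≤ 1 := by linarith [Real.log_two_lt_d9]
    have h4 : (0 : ℝ) ≤ l := Nat.cast_nonneg l
    nlinarith

end Quotient

/-! ### Lower bounds for the entries of a supergradient. -/

section Trace

variable {ι : Type*} [Fintype ι] [DecidableEq ι]

/-- If all entries but one nonnegative one are comparable with `L`, then so is the quotient of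
consecutive elementary symmetric functions, from below. -/
lemma mul_esym_le_esym_succ {a : ι} {s : Finset ι} (ha : a ∉ s) {N : ℕ} (hN : s.card ≤ N) {L : ℝ}
    (hL : 0 < L) {κ : ι → ℝ} (h : ∀ i ∈ s, L / 2 ≤ κ i ∧ κ i ≤ 2 * L) (h0 : 0 ≤ κ a) {j : ℕ}
    (hj : j + 1 ≤ s.card) :
    L / (2 * 8 ^ N) * esym j (insert a s) κ ≤ esym (j + 1) (insert a s) κ := by
  have base : ∀ j, j + 1 ≤ s.card → L / (2 * 8 ^ N) * esym j s κ ≤ esym (j + 1) s κ := by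
    intro j hj
    have h1 : esym j s κ ≤ 2 ^ N * (2 * L) ^ j := by
      calc esym j s κ ≤ ∑ t ∈ s.powersetCard j, (2 * L) ^ j := by
            refine Finset.sum_le_sum fun t ht => ?_
            rw [← (Finset.mem_powersetCard.1 ht).2]
            rw [← Finset.prod_const]
            refine Finset.prod_le_prod (fun i hi => ?_) fun i hi => ?_
            · have := (h i ((Finset.mem_powersetCard.1 ht).1 hi)).1
              linarith
            · exact (h i ((Finset.mem_powersetCard.1 ht).1 hi)).2
        _ = (s.card.choose j : ℝ) * (2 * L) ^ j := by simp
        _ ≤ 2 ^ N * (2 * L) ^ j := by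
            gcongr
            exact_mod_cast (Nat.choose_le_two_pow s.card j).trans
              (Nat.pow_le_pow_right two_pos hN)
    have h2 : (L / 2) ^ (j + 1) ≤ esym (j + 1) s κ := by
      obtain ⟨t, ht⟩ := Finset.powersetCard_nonempty.2 hj
      have hm := Finset.mem_powersetCard.1 ht
      calc (L / 2) ^ (j + 1) = ∏ i ∈ t, L / 2 := by rw [Finset.prod_const, hm.2]
        _ ≤ ∏ i ∈ t, κ i :=
          Finset.prod_le_prod (fun _ _ => by positivity) fun i hi => (h i (hm.1 hi)).1
        _ ≤ esym (j + 1) s κ := by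
          refine Finset.single_le_sum (f := fun t => ∏ i ∈ t, κ i) (fun t' ht' => ?_) ht
          refine Finset.prod_nonneg fun i hi => ?_
          have := (h i ((Finset.mem_powersetCard.1 ht').1 hi)).1
          linarith
    have h3 : (4 : ℝ) ^ j ≤ 4 ^ N := pow_le_pow_right₀ (by norm_num) (by omega)
    calc L / (2 * 8 ^ N) * esym j s κ ≤ L / (2 * 8 ^ N) * (2 ^ N * (2 * L) ^ j) := by gcongr
      _ = (L / 2) ^ (j + 1) * (4 ^ j / 4 ^ N) := by
        have e8 : (8 : ℝ) ^ N = 2 ^ N * 4 ^ N := by rw [← mul_pow]; norm_num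
        have e4 : (4 : ℝ) ^ j = 2 ^ j * 2 ^ j := by rw [← mul_pow]; norm_num
        rw [e8, e4, mul_pow, div_pow]
        field_simp
        ring
      _ ≤ (L / 2) ^ (j + 1) * 1 := by
        gcongr
        exact (div_le_one (by positivity)).2 h3
      _ ≤ esym (j + 1) s κ := by rw [mul_one]; exact h2
  -- An additional nonnegative entry `κ a` preserves the inequality: it adds `κ a` times the same
  -- inequality one order lower.
  cases j with
  | zero =>
    have := base 0 hj
    rw [esym_insert ha]
    simp only [esym_zero] at this ⊢
    linarith
  | succ j =>
    rw [esym_insert ha, esym_insert ha]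
    have h1 := base (j + 1) hj
    have h2 := mul_le_mul_of_nonneg_left (base j (by omega)) h0
    linarith

lemma le_of_mul_le_succ {x : ℕ → ℝ} {q : ℝ} {M : ℕ} (hq : 1 ≤ q) (h0 : x 0 = 1)
    (h : ∀ j < M, q * x j ≤ x (j + 1)) {j : ℕ} (hj : j ≤ M) :
    0 < x j ∧ ∀ l < j, q * x l ≤ x j := by
  induction j with
  | zero => exact ⟨by rw [h0]; exact one_pos, by simp⟩
  | succ j ih =>
    obtain ⟨h1, h2⟩ := ih (by omega)
    have h3 := h j (by omega)
    refine ⟨by nlinarith, fun l hl => ?_⟩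
    rcases Nat.lt_or_ge l j with hlj | hlj
    · have := h2 l hlj
      nlinarith
    · obtain rfl : l = j := by omega
      exact h3

/-- The entries of a supergradient of `log (σ_k / σ_l)`, one of them left out, have a sum that is
bounded below. -/
theorem exists_le_sum_supergradient (a : ι) {k l : ℕ} (hk : k + 1 = Fintype.card ι) (hl : l < k)
    (B : ℝ) : ∃ c : ℝ, 0 < c ∧ ∀ κ ∈ gardingCone k (Finset.univ : Finset ι), 0 ≤ κ a →
      logQuot k l κ ≤ B → ∀ g, IsSupergradient k l κ g → c ≤ ∑ i ∈ Finset.univ.erase a, g i := by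
  set P : ℝ := 2 * 8 ^ k
  have hP : 0 < P := by positivity
  -- With `k` entries equal to `T`, consecutive elementary symmetric functions have ratio at least
  -- `T / P = exp (|B| + 1)`. Such a test vector therefore lifts the logarithm of the quotient to at
  -- least `B + 1`, whatever the nonnegative entry at `a` is.
  set T := P * Real.exp (|B| + 1)
  have hT : 0 < T := by positivity
  have hcard : (Finset.univ.erase a).card = k := by
    rw [Finset.card_erase_of_mem (Finset.mem_univ a), Finset.card_univ]
    omega
  have test : ∀ b : ℝ, 0 ≤ b → (Function.update (fun _ => T) a b) ∈
      gardingCone k (Finset.univ : Finset ι) ∧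
      B + 1 ≤ logQuot k l (Function.update (fun _ => T) a b) := by
    intro b hb
    set μ := Function.update (fun _ : ι => T) a b
    have hstep : ∀ j < k, T / P * esym j Finset.univ μ ≤ esym (j + 1) Finset.univ μ := by
      intro j hj
      have := mul_esym_le_esym_succ (Finset.notMem_erase a Finset.univ) hcard.le hT (κ := μ)
        (fun i hi => by
          rw [show μ i = T from Function.update_of_ne (Finset.ne_of_mem_erase hi) _ _]
          constructor <;> linarith) (by simp [μ, hb]) (j := j) (by omega)
      rwa [Finset.insert_erase (Finset.mem_univ a)] at this
    have hTP : T / P = Real.exp (|B| + 1) := by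
      simp only [T]
      field_simp
    have hq : 1 ≤ T / P := by
      rw [hTP]
      exact Real.one_le_exp (by positivity)
    have hx := fun {j : ℕ} (hj : j ≤ k) =>
      le_of_mul_le_succ (x := fun j => esym j Finset.univ μ) hq (by simp) hstep hj
    refine ⟨fun j hj => (hx hj).1, ?_⟩
    have h1 := (hx le_rfl).2 l hl
    have h2 := (hx hl.le).1
    have h3 := Real.log_le_log (by positivity) h1
    rw [Real.log_mul (by positivity) h2.ne', hTP, Real.log_exp] at h3
    unfold logQuot
    have := le_abs_self B
    linarith
  refine ⟨1 / (2 * T), by positivity, fun κ hκ hκa hB g hg => ?_⟩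
  have hsplit : ∀ f : ι → ℝ, ∑ i, f i = f a + ∑ i ∈ Finset.univ.erase a, f i := fun f =>
    (Finset.add_sum_erase _ f (Finset.mem_univ a)).symm
  have hnn : 0 ≤ ∑ i ∈ Finset.univ.erase a, g i := Finset.sum_nonneg fun i _ => hg.nonneg i
  rw [div_le_iff₀ (by positivity)]
  -- If some other entry is at most `κ a`, then `g a` is bounded by the remaining sum and the
  -- constant vector `T` is tested. If not, all other entries are nonnegative, and a test vector
  -- that agrees with `κ` at `a` avoids `g a` altogether.
  by_cases hc : ∃ i, i ≠ a ∧ κ i ≤ κ a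
  · obtain ⟨i, hia, hi⟩ := hc
    obtain ⟨h1, h2⟩ := test T hT.le
    have h3 := hg.le _ h1
    simp only [Function.update_eq_self_iff.2 rfl, mul_sub, Finset.sum_sub_distrib,
      ← Finset.sum_mul] at h2 h3
    have h4 := hg.sum_nonneg
    have h5 : g a ≤ ∑ i ∈ Finset.univ.erase a, g i := (hg.antitone _ _ hi).trans
      (Finset.single_le_sum (fun i _ => hg.nonneg i) (Finset.mem_erase.2 ⟨hia, Finset.mem_univ _⟩))
    rw [hsplit g] at h3
    nlinarith
  · push Not at hc
    obtain ⟨h1, h2⟩ := test (κ a) hκa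
    have h3 := hg.le _ h1
    rw [hsplit] at h3
    have h4 : ∑ i ∈ Finset.univ.erase a, g i * (Function.update (fun _ => T) a (κ a) i - κ i)
        ≤ ∑ i ∈ Finset.univ.erase a, g i * T := by
      refine Finset.sum_le_sum fun i hi => ?_
      have hia := Finset.ne_of_mem_erase hi
      rw [Function.update_of_ne hia]
      have := hc i hia
      exact mul_le_mul_of_nonneg_left (by linarith) (hg.nonneg i)
    rw [← Finset.sum_mul] at h4
    simp only [Function.update_self, sub_self, mul_zero, zero_add] at h3
    nlinarith

/-- If all entries are comparable with `L`, except for one nonnegative entry and another entry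
bounded by `L`, then the supergradient of `log (σ_k / σ_l)` in the direction of the latter is at
least of order `L`, provided that `l + 2 ≤ k`. -/
theorem exists_mul_le_supergradient (a : ι) {k l : ℕ} (hk : k + 1 = Fintype.card ι)
    (hl : l + 2 ≤ k) (B : ℝ) : ∃ c L₀ : ℝ, 0 < c ∧ 1 ≤ L₀ ∧
      ∀ κ ∈ gardingCone k (Finset.univ : Finset ι), 0 ≤ κ a → logQuot k l κ ≤ B →
      ∀ g, IsSupergradient k l κ g → ∀ i₀ ≠ a, ∀ L, L₀ ≤ L → κ i₀ ≤ L →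
      (∀ i, i ≠ a → i ≠ i₀ → L / 2 ≤ κ i ∧ κ i ≤ 2 * L) → c * L ≤ g i₀ := by
  set P : ℝ := 2 * 8 ^ k
  have hP : 1 ≤ P := by
    have : (1 : ℝ) ≤ 8 ^ k := one_le_pow₀ (by norm_num)
    simp only [P]
    linarith
  have hP0 : 0 < P := by linarith
  set M := P * (1 + 2 * P) * Real.exp (|B| + 1)
  have hM : 0 < M := by positivity
  have hexp : 1 ≤ Real.exp (|B| + 1) := Real.one_le_exp (by positivity)
  have hMP : P ≤ M := by
    have : P * 1 * 1 ≤ M := by simp only [M]; gcongr; linarith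
    linarith
  refine ⟨1 / M, M, by positivity, by linarith, fun κ hκ hκa hB g hg i₀ hi₀ L hL hκL hκi => ?_⟩
  have hL1 : 1 ≤ L := by linarith
  have hL0 : 0 < L := by linarith
  set s := (Finset.univ.erase i₀).erase a with hs
  have hins : insert a s = Finset.univ.erase i₀ :=
    Finset.insert_erase (Finset.mem_erase.2 ⟨hi₀.symm, Finset.mem_univ _⟩)
  have hcard : s.card + 1 = k := by
    rw [hs, Finset.card_erase_of_mem (Finset.mem_erase.2 ⟨hi₀.symm, Finset.mem_univ _⟩),
      Finset.card_erase_of_mem (Finset.mem_univ _), Finset.card_univ]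
    omega
  have hq : 1 ≤ L / P := (one_le_div hP0).2 (by linarith)
  set x : ℕ → ℝ := fun j => esym j (Finset.univ.erase i₀) κ with hx
  have hstep : ∀ j < k - 1, L / P * x j ≤ x (j + 1) := by
    intro j hj
    have := mul_esym_le_esym_succ (s := s) (Finset.notMem_erase a _) (N := k)
      (by omega) hL0 (κ := κ) (fun i hi => hκi i (Finset.ne_of_mem_erase hi)
        (Finset.ne_of_mem_erase (Finset.mem_of_mem_erase hi))) hκa (j := j) (by omega)
    rw [hins] at this
    exact this
  have hxj := fun {j : ℕ} (hj : j ≤ k - 1) => le_of_mul_le_succ hq (by simp [hx]) hstep hj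
  -- Raising the single entry `κ i₀` by `t` must gain at least 1 in the logarithm. The numerator
  -- becomes at least `t σ_{k-1}` of the other entries, the denominator stays below `(1 + 2P) σ_l`
  -- of them, and `l < k - 1` supplies the factor `L / P` between the two; `M` is chosen to fit.
  -- Hence `g i₀ ≥ 1 / t`.
  set t := M / L
  have ht : 0 < t := by positivity
  have ht1 : t ≤ 1 := (div_le_one hL0).2 hL
  set μ := Function.update κ i₀ (κ i₀ + t) with hμ
  have hμx : ∀ j, esym j (Finset.univ.erase i₀) μ = x j := fun j =>
    esym_congr fun i hi => Function.update_of_ne (Finset.ne_of_mem_erase hi) _ _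
  have hμs : ∀ j, esym (j + 1) Finset.univ μ = esym (j + 1) Finset.univ κ + t * x j := by
    intro j
    rw [esym_erase (Finset.mem_univ i₀), hμx, hμx, esym_erase (Finset.mem_univ i₀) j κ]
    simp only [hμ, Function.update_self, hx]
    ring
  have hμmem : μ ∈ gardingCone k (Finset.univ : Finset ι) := by
    intro j hj
    cases j with
    | zero => simp
    | succ j =>
      rw [hμs]
      have h1 := hκ (j + 1) hj
      have h2 := (hxj (j := j) (by omega)).1
      positivity
  have hnum : t * x (k - 1) ≤ esym k Finset.univ μ := by
    have h1 := hμs (k - 1)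
    rw [Nat.sub_add_cancel (by omega)] at h1
    have := hκ k le_rfl
    linarith
  have hden : esym l Finset.univ μ ≤ (1 + 2 * P) * x l := by
    have hxl := (hxj (j := l) (by omega)).1
    cases l with
    | zero =>
      simp only [hx, esym_zero]
      linarith
    | succ l =>
      have h1 := hstep l (by omega)
      rw [div_mul_eq_mul_div, div_le_iff₀ hP0] at h1
      have h2 := (hxj (j := l) (by omega)).1
      rw [hμs, esym_erase (Finset.mem_univ i₀)]
      simp only [hx] at *
      nlinarith
  have hmain : B + 1 ≤ logQuot k l μ := by
    have h1 := (hxj (j := k - 1) le_rfl).2 l (by omega)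
    have hxl := (hxj (j := l) (by omega)).1
    have hlpos := hμmem l (by omega)
    have h2 : Real.exp (|B| + 1) * esym l Finset.univ μ ≤ esym k Finset.univ μ := by
      calc _ ≤ Real.exp (|B| + 1) * ((1 + 2 * P) * x l) := by gcongr
        _ = t * (L / P * x l) := by
          simp only [t, M]
          field_simp
        _ ≤ t * x (k - 1) := by gcongr
        _ ≤ _ := hnum
    have h3 := Real.log_le_log (by positivity) h2
    rw [Real.log_mul (by positivity) hlpos.ne', Real.log_exp] at h3
    unfold logQuot
    have := le_abs_self B
    linarith
  have hsum := hg.le μ hμmem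
  have hs' : ∑ i, g i * (μ i - κ i) = g i₀ * t := by
    rw [Finset.sum_eq_single i₀]
    · simp [hμ]
    · intro i _ hi
      simp [hμ, Function.update_of_ne hi]
    · simp
  rw [hs'] at hsum
  have h1 : 1 ≤ g i₀ * t := by linarith
  simp only [t] at h1
  rw [mul_div_assoc', le_div_iff₀ hL0] at h1
  rw [div_mul_eq_mul_div, div_le_iff₀ hM]
  linarith

end Trace

/-! ### The sum Hessian quotient as an ordinary quotient in `n + 1` entries. -/

section Linearization

variable {n : ℕ}

/-- The entries `η(lam)` together with the additional entry `α`. -/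
def augment (α : ℝ) (lam : Fin n → ℝ) (o : Option (Fin n)) : ℝ := o.elim α (eta lam)

lemma sigma_natCast (k : ℕ) (lam : Fin n → ℝ) : sigma (k : ℤ) lam = esym k Finset.univ lam := by
  unfold sigma esym
  refine Finset.sum_congr ?_ fun _ _ => rfl
  ext t
  simp

lemma sigma_neg_one (lam : Fin n → ℝ) : sigma (-1) lam = 0 := by
  unfold sigma
  rw [Finset.filter_eq_empty_iff.2, Finset.sum_empty]
  intro t _ h
  omega

lemma univ_option_eq : (Finset.univ : Finset (Option (Fin n))) =
    insert none (Finset.univ.map Function.Embedding.some) := by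
  ext o
  cases o <;> simp

/-- Splitting subsets by whether they contain the entry `α` gives `σ_k + α σ_{k-1}`. -/
lemma sumSigma_eq_esym (α : ℝ) (k : ℕ) (lam : Fin n → ℝ) :
    sumSigma α (k : ℤ) (eta lam) = esym k Finset.univ (augment α lam) := by
  unfold sumSigma
  cases k with
  | zero =>
    have := sigma_natCast 0 (eta lam)
    simp only [Nat.cast_zero] at this
    simp [this, sigma_neg_one]
  | succ k =>
    have e : ((k + 1 : ℕ) : ℤ) - 1 = (k : ℤ) := by push_cast; ring
    rw [e, sigma_natCast, sigma_natCast, univ_option_eq, esym_insert (by simp), esym_map, esym_map]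
    rfl

/-- Admissibility only reaches order `n - 1`; positivity at order `n` is read off from the sign of
the quotient, whose denominator is positive. -/
lemma augment_mem_gardingCone {l : ℕ} (hl : l < n) {α : ℝ} (hα : 0 ≤ α)
    {lam : Fin n → ℝ} (h : lam ∈ coneGamma' n (n - 1))
    (hpos : 0 < sumSigma α (n : ℤ) (eta lam) / sumSigma α (l : ℤ) (eta lam)) :
    augment α lam ∈ gardingCone n Finset.univ := by
  have h0 : ∀ j ≤ n - 1, 0 < esym j Finset.univ (eta lam) := fun j hj => by
    rcases Nat.eq_zero_or_pos j with rfl | hj'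
    · simp
    · rw [← sigma_natCast]
      exact h j hj' hj
  have h1 : ∀ j ≤ n - 1, 0 < esym j Finset.univ (augment α lam) := fun j hj => by
    rw [← sumSigma_eq_esym]
    cases j with
    | zero => rw [sumSigma_eq_esym, esym_zero]; exact one_pos
    | succ j =>
      unfold sumSigma
      have e : ((j + 1 : ℕ) : ℤ) - 1 = (j : ℤ) := by push_cast; ring
      rw [e, sigma_natCast, sigma_natCast]
      have := h0 _ hj
      have := h0 j (by omega)
      positivity
  intro j hj
  rcases Nat.lt_or_ge j n with hjn | hjn
  · exact h1 j (by omega)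
  obtain rfl : j = n := le_antisymm hj hjn
  rw [sumSigma_eq_esym, sumSigma_eq_esym] at hpos
  exact (div_pos_iff_of_pos_right (h1 l (by omega))).1 hpos

lemma logQuot_augment {l : ℕ} (hl : l < n) {α : ℝ} {lam : Fin n → ℝ}
    (h : augment α lam ∈ gardingCone n Finset.univ) :
    logQuot n l (augment α lam)
      = Real.log (sumSigma α (n : ℤ) (eta lam) / sumSigma α (l : ℤ) (eta lam)) := by
  rw [sumSigma_eq_esym, sumSigma_eq_esym, logQuot,
    Real.log_div (h n le_rfl).ne' (h l hl.le).ne']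

lemma eta_eq (lam : Fin n → ℝ) (i : Fin n) : eta lam i = ∑ j, lam j - lam i :=
  eq_sub_of_add_eq (Finset.sum_erase_add _ _ (Finset.mem_univ i))

lemma augment_comp_perm (α : ℝ) (lam : Fin n → ℝ) (σ : Equiv.Perm (Fin n)) :
    augment α (lam ∘ σ) = augment α lam ∘ Equiv.optionCongr σ := by
  ext o
  cases o with
  | none => rfl
  | some i =>
    simp [augment, eta_eq, Equiv.sum_comp σ lam]

/-- `G` plays the role of the coefficients of the linearized operator at the eigenvalues `lam`,
the largest of which is `lam i₀`; `c`, `c'` and `L₀` are the constants of the ellipticity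
estimates. -/
structure IsLinearization (l : ℕ) (α c c' L₀ : ℝ) (lam : Fin n → ℝ) (i₀ : Fin n)
    (G : Fin n → ℝ) : Prop where
  nonneg : ∀ i, 0 ≤ G i
  min : ∀ i, G i₀ ≤ G i
  sum_le : ∀ i ≠ i₀, ∑ j, G j ≤ n ^ 2 * G i
  le_sum : c ≤ ∑ j, G j
  sum_mul_le : ∑ i, G i * lam i ≤ 2 * n
  mul_le_sum : L₀ ≤ lam i₀ → (∀ i ≠ i₀, |lam i| ≤ lam i₀ / (4 * n)) → c' * lam i₀ ≤ ∑ j, G j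
  le : ∀ μ : Fin n → ℝ, augment α μ ∈ gardingCone n Finset.univ →
    ∀ P ∈ doublyStochastic ℝ (Fin n), logQuot n l (augment α μ) ≤
      logQuot n l (augment α lam) + ∑ i, G i * (P.mulVec μ i - lam i)

theorem exists_isLinearization {l : ℕ} (hl : l + 1 < n) (B : ℝ) : ∃ c c' L₀ : ℝ,
    0 < c ∧ 0 < c' ∧ 1 ≤ L₀ ∧ ∀ α : ℝ, 0 ≤ α → ∀ lam : Fin n → ℝ,
      augment α lam ∈ gardingCone n Finset.univ → logQuot n l (augment α lam) ≤ B →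
      ∀ i₀, (∀ i, lam i ≤ lam i₀) → ∃ G, IsLinearization l α c c' L₀ lam i₀ G := by
  have hcard : n + 1 = Fintype.card (Option (Fin n)) := by simp
  obtain ⟨c, hc, hc1⟩ := exists_le_sum_supergradient (none : Option (Fin n)) hcard
    (by omega : l < n) B
  obtain ⟨c', L₀, hc', hL₀, hc2⟩ := exists_mul_le_supergradient (none : Option (Fin n)) hcard
    (by omega : l + 2 ≤ n) B
  have hn : (2 : ℝ) ≤ n := by exact_mod_cast (by omega : 2 ≤ n)
  refine ⟨c, c', L₀, hc, hc', hL₀, fun α hα lam hlam hB i₀ hi₀ => ?_⟩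
  obtain ⟨g, hg⟩ := exists_isSupergradient (by omega : l ≤ n) (by omega) hlam
  have hα' : 0 ≤ augment α lam none := hα
  set S := ∑ j, g (some j) with hS
  have hSe : ∑ o ∈ Finset.univ.erase none, g o = S := by
    rw [univ_option_eq, Finset.erase_insert (by simp), Finset.sum_map]
    rfl
  have hSc : c ≤ S := hSe ▸ hc1 _ hlam hα' hB g hg
  have hle : ∀ j, g (some j) ≤ S := fun j =>
    Finset.single_le_sum (f := fun j => g (some j)) (fun i _ => hg.nonneg _) (Finset.mem_univ j)
  have hmax : ∀ j, g (some j) ≤ g (some i₀) := fun j => by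
    refine hg.antitone _ _ ?_
    have := hi₀ j
    simp only [augment, Option.elim, eta_eq]
    linarith
  have hsum : ∑ j, (S - g (some j)) = (n - 1) * S := by
    rw [Finset.sum_sub_distrib, Finset.sum_const, Finset.card_univ, Fintype.card_fin, nsmul_eq_mul,
      ← hS]
    ring
  have hpair : ∀ ν : Fin n → ℝ, ∑ i, (S - g (some i)) * ν i = ∑ i, g (some i) * eta ν i := by
    intro ν
    simp only [eta_eq, sub_mul, mul_sub, Finset.sum_sub_distrib, ← Finset.sum_mul, ← Finset.mul_sum]
    rfl
  -- The coefficients in the eigenvalues of `D²u` are `G i = S - g i`, as `η_i` omits `lam i`. The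
  -- largest eigenvalue has the smallest `η`, hence the largest `g`; every other `G i` contains this
  -- `g`, which is at least `S / n`.
  have hpick : ∀ i ≠ i₀, g (some i₀) ≤ S - g (some i) := fun i hi => by
    have := Finset.add_sum_erase Finset.univ (fun j => g (some j)) (Finset.mem_univ i)
    have h2 := Finset.single_le_sum (f := fun j => g (some j)) (fun j _ => hg.nonneg (some j))
      (Finset.mem_erase.2 ⟨hi.symm, Finset.mem_univ i₀⟩)
    linarith
  have hSn : S ≤ n * g (some i₀) := by
    calc S ≤ ∑ _j : Fin n, g (some i₀) := Finset.sum_le_sum fun j _ => hmax j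
      _ = n * g (some i₀) := by simp
  have hS0 : 0 ≤ S := hc.le.trans hSc
  have hperm : ∀ μ : Fin n → ℝ, augment α μ ∈ gardingCone n Finset.univ →
      logQuot n l (augment α μ) ≤
        logQuot n l (augment α lam) + ∑ i, (S - g (some i)) * (μ i - lam i) := by
    intro μ hμ
    have h1 := hg.le _ hμ
    have h2 : ∑ o, g o * (augment α μ o - augment α lam o)
        = ∑ i, (S - g (some i)) * (μ i - lam i) := by
      rw [Fintype.sum_option]
      have h3 := hpair μ
      have h4 := hpair lam
      simp only [mul_sub, Finset.sum_sub_distrib, h3, h4]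
      simp [augment]
    rwa [h2] at h1
  refine ⟨fun i => S - g (some i), fun i => by linarith [hle i], fun i => by linarith [hmax i],
    fun i hi => ?_, ?_, ?_, ?_, ?_⟩
  · rw [hsum]
    have h1 := hpick i hi
    have h2 : (n : ℝ) * g (some i₀) ≤ n * (S - g (some i)) := by gcongr
    nlinarith
  · rw [hsum]
    nlinarith
  · rw [hpair]
    have h1 := hg.sum_le
    rw [Fintype.sum_option] at h1
    have h2 := mul_nonneg (hg.nonneg none) hα'
    simp only [augment, Option.elim] at h1 h2
    linarith
  · intro hL hsmall
    have hL0 : 0 < lam i₀ := by linarith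
    have hsm : ∀ s : Finset (Fin n), i₀ ∉ s → |∑ j ∈ s, lam j| ≤ lam i₀ / 4 := by
      intro s hs
      calc |∑ j ∈ s, lam j| ≤ ∑ j ∈ s, |lam j| := Finset.abs_sum_le_sum_abs _ _
        _ ≤ ∑ j ∈ s, lam i₀ / (4 * n) :=
          Finset.sum_le_sum fun j hj => hsmall j fun h => hs (h ▸ hj)
        _ = s.card * (lam i₀ / (4 * n)) := by simp
        _ ≤ n * (lam i₀ / (4 * n)) := by
          gcongr
          simpa using Finset.card_le_univ s
        _ = lam i₀ / 4 := by field_simp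
    have h1 := hc2 _ hlam hα' hB g hg (some i₀) (by simp) (lam i₀) hL
      (by
        have := (abs_le.1 (hsm (Finset.univ.erase i₀) (by simp))).2
        simp only [augment, Option.elim, eta]
        linarith)
      (by
        intro o ho ho'
        cases o with
        | none => exact absurd rfl ho
        | some i =>
          have hi : i ≠ i₀ := fun h => ho' (by rw [h])
          have h2 := abs_le.1 (hsm ((Finset.univ.erase i).erase i₀) (by simp))
          have h3 := Finset.add_sum_erase (Finset.univ.erase i) lam
            (Finset.mem_erase.2 ⟨hi.symm, Finset.mem_univ i₀⟩)
          simp only [augment, Option.elim, eta]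
          constructor <;> linarith)
    rw [hsum]
    have := hle i₀
    nlinarith
  · intro μ hμ P hP
    -- By Birkhoff, `P` is a convex combination of permutations. The left-hand side is invariant
    -- under permutations, so the inequalities for the individual permutations may be averaged.
    obtain ⟨w, hw0, hw1, hwP⟩ := exists_eq_sum_perm_of_mem_doublyStochastic hP
    have h1 : ∀ σ : Equiv.Perm (Fin n), logQuot n l (augment α μ) ≤
        logQuot n l (augment α lam) + ∑ i, (S - g (some i)) * (μ (σ i) - lam i) := by
      intro σ
      have h2 := hperm (μ ∘ σ) (by
        rw [augment_comp_perm]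
        exact gardingCone_comp_equiv hμ _)
      rw [augment_comp_perm, logQuot_comp_equiv] at h2
      exact h2
    have hPμ : ∀ i, P.mulVec μ i = ∑ σ, w σ * μ (σ i) := by
      intro i
      rw [← hwP, Matrix.sum_mulVec, Finset.sum_apply]
      refine Finset.sum_congr rfl fun σ _ => ?_
      rw [Matrix.smul_mulVec, Pi.smul_apply, smul_eq_mul, Equiv.Perm.permMatrix,
        PEquiv.toMatrix_toPEquiv_mulVec]
      rfl
    have h3 := Finset.sum_le_sum fun σ (_ : σ ∈ Finset.univ) =>
      mul_le_mul_of_nonneg_left (h1 σ) (hw0 σ)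
    rw [← Finset.sum_mul, hw1, one_mul] at h3
    refine h3.trans (le_of_eq ?_)
    simp only [mul_add, Finset.sum_add_distrib, ← Finset.sum_mul, hw1, one_mul]
    congr 1
    simp only [Finset.mul_sum]
    rw [Finset.sum_comm]
    refine Finset.sum_congr rfl fun i _ => ?_
    rw [hPμ, mul_sub, Finset.mul_sum]
    simp only [mul_sub, Finset.sum_sub_distrib, ← Finset.sum_mul, hw1, one_mul]
    congr 1
    exact Finset.sum_congr rfl fun σ _ => by ring

end Linearization

/-! ### The algebra of Pogorelov's estimate at a maximum point. -/

section PogorelovInequality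

variable {n : ℕ}

/-- The relations at a maximum point of
`β log (-u) + log u₁₁ + (a/2) |Du|² + (A/2) |x - y|²`, in an eigenbasis of `D²u` with eigenvalues
`lam`, the largest of which is `lam i₀`: `w = -u`, `p = Du`, `lam i₀ * q = D u₁₁`, `T k i = u_{kii}`
and `D4 i = u_{11ii}`. The numbers `G` are the coefficients of the linearized operator, and `b`, `X`
come from the derivatives of the right-hand side. -/
structure IsMaxRelation (K d C₁ c c' L₀ a A β : ℝ) (i₀ : Fin n) (w : ℝ)
    (lam p y q X b D4 G : Fin n → ℝ) (T : Fin n → Fin n → ℝ) : Prop where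
  w_pos : 0 < w
  w_le : w ≤ K
  p_le : ∀ i, |p i| ≤ K
  y_le : ∀ i, |y i| ≤ d
  X_le : ∀ i, |X i| ≤ C₁
  b_le : ∀ i, |b i| ≤ C₁
  lam_pos : 0 < lam i₀
  G_nonneg : ∀ i, 0 ≤ G i
  G_min : ∀ i, G i₀ ≤ G i
  sum_le : ∀ i ≠ i₀, ∑ j, G j ≤ n ^ 2 * G i
  le_sum : c ≤ ∑ j, G j
  sum_mul_le : ∑ i, G i * lam i ≤ 2 * n
  mul_le_sum : L₀ ≤ lam i₀ → (∀ i ≠ i₀, |lam i| ≤ lam i₀ / (4 * n)) → c' * lam i₀ ≤ ∑ j, G j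
  first_order : ∀ i, q i = β * p i / w - a * lam i * p i - A * y i
  second_order : ∀ i, -(β * (lam i / w + p i ^ 2 / w ^ 2)) + D4 i / lam i₀ - q i ^ 2
    + a * (lam i ^ 2 + ∑ k, p k * T k i) + A ≤ 0
  linearized : ∀ k, ∑ i, G i * T k i = X k + b k * lam k
  concavity : ∀ θ : Fin n → ℝ, -(C₁ * (1 + lam i₀) ^ 2) + lam i₀ * ∑ k, b k * q k ≤
    ∑ i, G i * D4 i
      - ∑ i, (G i - G i₀) * (4 * θ i * (lam i₀ * q i) - 2 * θ i ^ 2 * (lam i₀ - lam i))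

variable {K d C₁ c c' L₀ a A β w : ℝ} {i₀ : Fin n} {lam p y q X b D4 G : Fin n → ℝ}
  {T : Fin n → Fin n → ℝ}

lemma abs_sum_mul_le {x z : Fin n → ℝ} {B B' : ℝ} (hx : ∀ i, |x i| ≤ B) (hz : ∀ i, |z i| ≤ B') :
    |∑ i, x i * z i| ≤ n * (B * B') := by
  calc |∑ i, x i * z i| ≤ ∑ i, |x i * z i| := Finset.abs_sum_le_sum_abs _ _
    _ ≤ ∑ _i : Fin n, B * B' := Finset.sum_le_sum fun i _ => by
      rw [abs_mul]
      exact mul_le_mul (hx i) (hz i) (abs_nonneg _) ((abs_nonneg _).trans (hx i))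
    _ = n * (B * B') := by simp

/-- The second-order conditions are summed with weights `G i`, the linearized equation removes `T`,
and the concavity inequality removes `D4`. Substituting the first-order condition for `q` cancels
the dangerous terms `a b_k lam_k p_k`. -/
lemma IsMaxRelation.sum_inequality (h : IsMaxRelation K d C₁ c c' L₀ a A β i₀ w lam p y q X b D4 G T)
    (ha : 0 ≤ a) (hA : 0 ≤ A) (hβ : 0 ≤ β) (hL : 1 ≤ lam i₀) (θ : Fin n → ℝ) :
    a * ∑ i, G i * lam i ^ 2 + A * ∑ i, G i
      + (∑ i, (G i - G i₀) * (4 * θ i * (lam i₀ * q i) - 2 * θ i ^ 2 * (lam i₀ - lam i))) / lam i₀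
      ≤ ∑ i, G i * q i ^ 2 + β / w ^ 2 * ∑ i, G i * p i ^ 2 + β * (2 * n + n * (C₁ * K)) / w
        + 4 * C₁ * lam i₀ + (A * (n * (C₁ * d)) + a * (n * (K * C₁))) := by
  have hw := h.w_pos
  have hL0 := h.lam_pos
  have hC : 0 ≤ C₁ := (abs_nonneg _).trans (h.X_le i₀)
  set L := lam i₀
  set R := ∑ i, (G i - G i₀) * (4 * θ i * (L * q i) - 2 * θ i ^ 2 * (L - lam i))
  have h1 : ∑ i, G i * (-(β * (lam i / w + p i ^ 2 / w ^ 2)) + D4 i / L - q i ^ 2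
      + a * (lam i ^ 2 + ∑ k, p k * T k i) + A) ≤ 0 :=
    Finset.sum_nonpos fun i _ => mul_nonpos_of_nonneg_of_nonpos (h.G_nonneg i) (h.second_order i)
  have h2 : ∑ i, G i * (-(β * (lam i / w + p i ^ 2 / w ^ 2)) + D4 i / L - q i ^ 2
      + a * (lam i ^ 2 + ∑ k, p k * T k i) + A)
      = -(β / w * ∑ i, G i * lam i) - β / w ^ 2 * ∑ i, G i * p i ^ 2 + (∑ i, G i * D4 i) / L
        - ∑ i, G i * q i ^ 2 + a * ∑ i, G i * lam i ^ 2 + a * ∑ k, p k * ∑ i, G i * T k i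
        + A * ∑ i, G i := by
    have e : ∑ k, p k * ∑ i, G i * T k i = ∑ i, G i * ∑ k, p k * T k i := by
      simp only [Finset.mul_sum]
      rw [Finset.sum_comm]
      exact Finset.sum_congr rfl fun i _ => Finset.sum_congr rfl fun k _ => by ring
    rw [e]
    simp only [Finset.sum_div, Finset.mul_sum (s := Finset.univ) (a := A),
      Finset.mul_sum (s := Finset.univ) (a := a), Finset.mul_sum (s := Finset.univ) (a := β / w),
      Finset.mul_sum (s := Finset.univ) (a := β / w ^ 2), ← Finset.sum_neg_distrib,
      ← Finset.sum_sub_distrib, ← Finset.sum_add_distrib]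
    exact Finset.sum_congr rfl fun i _ => by ring
  have h3 : β / w * ∑ i, G i * lam i ≤ β * (2 * n) / w := by
    rw [mul_comm β (2 * n : ℝ), mul_div_assoc, mul_comm (2 * n : ℝ)]
    exact mul_le_mul_of_nonneg_left h.sum_mul_le (by positivity)
  have h4 : ∑ k, p k * ∑ i, G i * T k i = ∑ k, p k * X k + ∑ k, b k * (lam k * p k) := by
    rw [← Finset.sum_add_distrib]
    exact Finset.sum_congr rfl fun k _ => by rw [h.linearized]; ring
  have h5 : ∑ k, b k * q k = β / w * ∑ k, b k * p k - a * ∑ k, b k * (lam k * p k)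
      - A * ∑ k, b k * y k := by
    simp only [Finset.mul_sum, ← Finset.sum_sub_distrib]
    exact Finset.sum_congr rfl fun k _ => by rw [h.first_order]; ring
  have h6 : -(4 * C₁ * L) + ∑ k, b k * q k + R / L ≤ (∑ i, G i * D4 i) / L := by
    rw [le_div_iff₀ hL0]
    have e : (-(4 * C₁ * L) + ∑ k, b k * q k + R / L) * L
        = -(4 * C₁ * L ^ 2) + L * ∑ k, b k * q k + R := by field_simp
    rw [e]
    have h7 := h.concavity θ
    have h8 : C₁ * (1 + L) ^ 2 ≤ 4 * C₁ * L ^ 2 := by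
      have h9 : (1 + L) ^ 2 ≤ 4 * L ^ 2 := by nlinarith
      have := mul_le_mul_of_nonneg_left h9 hC
      linarith
    linarith
  have h7 := (abs_le.1 (abs_sum_mul_le h.b_le h.p_le)).1
  have h8 := (abs_le.1 (abs_sum_mul_le h.b_le h.y_le)).2
  have h9 := (abs_le.1 (abs_sum_mul_le h.p_le h.X_le)).1
  have h7' : -(β * (n * (C₁ * K)) / w) ≤ β / w * ∑ k, b k * p k := by
    have := mul_le_mul_of_nonneg_left h7 (by positivity : 0 ≤ β / w)
    calc -(β * (n * (C₁ * K)) / w) = β / w * -(n * (C₁ * K)) := by ring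
      _ ≤ _ := this
  have h8' := mul_le_mul_of_nonneg_left h8 hA
  have h9' := mul_le_mul_of_nonneg_left h9 ha
  rw [h2, h4] at h1
  have e2 : β * (2 * n + n * (C₁ * K)) / w = β * (2 * n) / w + β * (n * (C₁ * K)) / w := by ring
  rw [e2]
  rw [h5] at h6
  linarith

lemma sq_le_three_mul {x u v z : ℝ} (h : x = u - v - z) :
    x ^ 2 ≤ 3 * (u ^ 2 + v ^ 2 + z ^ 2) := by
  subst h
  nlinarith [sq_nonneg (u + v), sq_nonneg (u + z), sq_nonneg (v - z)]

lemma IsMaxRelation.q_sq_le (h : IsMaxRelation K d C₁ c c' L₀ a A β i₀ w lam p y q X b D4 G T)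
    (i : Fin n) : q i ^ 2 ≤ 3 * (β ^ 2 * K ^ 2 / w ^ 2 + a ^ 2 * K ^ 2 * lam i ^ 2
      + A ^ 2 * d ^ 2) := by
  have h1 := sq_le_three_mul (h.first_order i)
  have hp := sq_le_sq' (abs_le.1 (h.p_le i)).1 (abs_le.1 (h.p_le i)).2
  have hy := sq_le_sq' (abs_le.1 (h.y_le i)).1 (abs_le.1 (h.y_le i)).2
  refine h1.trans ?_
  have e1 : (β * p i / w) ^ 2 ≤ β ^ 2 * K ^ 2 / w ^ 2 := by
    rw [div_pow, mul_pow]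
    gcongr
  have e2 : (a * lam i * p i) ^ 2 ≤ a ^ 2 * K ^ 2 * lam i ^ 2 := by
    calc (a * lam i * p i) ^ 2 = (a * lam i) ^ 2 * p i ^ 2 := by ring
      _ ≤ (a * lam i) ^ 2 * K ^ 2 := by gcongr
      _ = _ := by ring
  have e3 : (A * y i) ^ 2 ≤ A ^ 2 * d ^ 2 := by
    rw [mul_pow]
    gcongr
  linarith

/-- Since `β p² / w²` is `(β p / w)²` divided by `β`, expressing `β p / w` through the first-order
condition leaves small factors once `β` is large. -/
lemma IsMaxRelation.p_sq_le (h : IsMaxRelation K d C₁ c c' L₀ a A β i₀ w lam p y q X b D4 G T)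
    (ha : 0 ≤ a) (haK : 18 * (a * K ^ 2) ≤ 1) (hA : 0 ≤ A) (hβ : 6 ≤ β)
    (hβA : 6 * A * d ^ 2 ≤ β) (i : Fin n) :
    β / w ^ 2 * p i ^ 2 ≤ q i ^ 2 / 2 + a / 4 * lam i ^ 2 + A / 2 := by
  have hw := h.w_pos
  have hβ0 : 0 < β := by linarith
  have hp := sq_le_sq' (abs_le.1 (h.p_le i)).1 (abs_le.1 (h.p_le i)).2
  have hy := sq_le_sq' (abs_le.1 (h.y_le i)).1 (abs_le.1 (h.y_le i)).2
  have h1 : (β * p i / w) ^ 2 ≤ 3 * (q i ^ 2 + (a * lam i * p i) ^ 2 + (A * y i) ^ 2) := by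
    have := sq_le_three_mul (x := β * p i / w) (u := q i) (v := -(a * lam i * p i))
      (z := -(A * y i)) (by rw [h.first_order i]; ring)
    simpa using this
  have e : (β * p i / w) ^ 2 = β * (β / w ^ 2 * p i ^ 2) := by field_simp
  rw [e] at h1
  refine le_of_mul_le_mul_left (h1.trans ?_) hβ0
  have e2 : (a * lam i * p i) ^ 2 ≤ a / 18 * lam i ^ 2 := by
    calc (a * lam i * p i) ^ 2 = a ^ 2 * lam i ^ 2 * p i ^ 2 := by ring
      _ ≤ a ^ 2 * lam i ^ 2 * K ^ 2 := by gcongr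
      _ = a * lam i ^ 2 * (a * K ^ 2) := by ring
      _ ≤ a * lam i ^ 2 * (1 / 18) := by gcongr; linarith
      _ = _ := by ring
  have e3 : 3 * (A * y i) ^ 2 ≤ β * (A / 2) := by
    calc 3 * (A * y i) ^ 2 = A / 2 * (6 * A * y i ^ 2) := by ring
      _ ≤ A / 2 * (6 * A * d ^ 2) := by gcongr
      _ ≤ A / 2 * β := by gcongr
      _ = _ := by ring
  have e4 : 3 * q i ^ 2 ≤ β * (q i ^ 2 / 2) := by nlinarith [sq_nonneg (q i)]
  have e5 : 3 * (a / 18 * lam i ^ 2) ≤ β * (a / 4 * lam i ^ 2) := by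
    have : 0 ≤ a * lam i ^ 2 := by positivity
    nlinarith
  linarith

lemma le_of_mul_sq_le {e D E t : ℝ} (he : 0 < e) (hD : 0 ≤ D) (hE : 0 ≤ E)
    (h : e * t ^ 2 ≤ D + E * t) : t ≤ (D + E) / e + 1 := by
  by_contra hcon
  push Not at hcon
  have h0 : 0 ≤ (D + E) / e := by positivity
  have h1 : (D + E) / e < t := by linarith
  rw [div_lt_iff₀ he] at h1
  have h2 : 1 < t := by linarith
  nlinarith

/-- The case where another eigenvalue is comparable with the largest one. -/
lemma IsMaxRelation.le_of_large (h : IsMaxRelation K d C₁ c c' L₀ a A β i₀ w lam p y q X b D4 G T)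
    (hc : 0 < c) (ha : 0 < a) (haK : 18 * (a * K ^ 2) ≤ 1) (hA : 0 ≤ A) (hβ : 0 ≤ β)
    (hL : 1 ≤ lam i₀) {i : Fin n} (hi : i ≠ i₀) (hlam : lam i₀ / (4 * n) < |lam i|) :
    w * lam i₀ ≤ ((3 * β ^ 2 * K ^ 2 + β * K ^ 2 + 3 * A ^ 2 * d ^ 2 * K ^ 2
      + (β * (2 * n + n * (C₁ * K)) * K + (A * (n * (C₁ * d)) + a * (n * (K * C₁))) * K ^ 2) / c)
      + 4 * C₁ * K / c) / (a / (32 * n ^ 4)) + 1 := by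
  have hw := h.w_pos
  have hwK := h.w_le
  have hL0 := h.lam_pos
  have hC : 0 ≤ C₁ := (abs_nonneg _).trans (h.X_le i₀)
  have hK : 0 ≤ K := (abs_nonneg _).trans (h.p_le i₀)
  have hd : 0 ≤ d := (abs_nonneg _).trans (h.y_le i₀)
  have hn : (0 : ℝ) < n := by exact_mod_cast i₀.pos
  -- No rotation is needed here: `a ∑ G_i lam_i²` is strong enough on its own.
  have hM := h.sum_inequality ha.le hA hβ hL 0
  have hz : ∑ i, (G i - G i₀) * (4 * (0 : Fin n → ℝ) i * (lam i₀ * q i)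
      - 2 * (0 : Fin n → ℝ) i ^ 2 * (lam i₀ - lam i)) = 0 :=
    Finset.sum_eq_zero fun i _ => by simp
  rw [hz, zero_div, add_zero] at hM
  set F := ∑ i, G i
  set L := lam i₀
  set B₁ := β * (2 * n + n * (C₁ * K))
  set B₂ := A * (n * (C₁ * d)) + a * (n * (K * C₁))
  have hB₁ : 0 ≤ B₁ := by positivity
  have hB₂ : 0 ≤ B₂ := by positivity
  have hF := h.le_sum
  have hF0 : 0 < F := hc.trans_le hF
  have h1 : ∑ i, G i * q i ^ 2 ≤ (3 * β ^ 2 * K ^ 2 / w ^ 2 + 3 * A ^ 2 * d ^ 2) * F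
      + a / 2 * ∑ i, G i * lam i ^ 2 := by
    rw [Finset.mul_sum, Finset.mul_sum, ← Finset.sum_add_distrib]
    refine Finset.sum_le_sum fun i _ => ?_
    have h2 := mul_le_mul_of_nonneg_left (h.q_sq_le i) (h.G_nonneg i)
    refine h2.trans ?_
    have h3 : a * (a * K ^ 2) * (G i * lam i ^ 2) ≤ a * (1 / 18) * (G i * lam i ^ 2) := by
      have := mul_nonneg (h.G_nonneg i) (sq_nonneg (lam i))
      gcongr
      linarith
    have h4 : 0 ≤ a * (G i * lam i ^ 2) :=
      mul_nonneg ha.le (mul_nonneg (h.G_nonneg i) (sq_nonneg (lam i)))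
    have e : G i * (3 * (β ^ 2 * K ^ 2 / w ^ 2 + a ^ 2 * K ^ 2 * lam i ^ 2 + A ^ 2 * d ^ 2))
      = (3 * β ^ 2 * K ^ 2 / w ^ 2 + 3 * A ^ 2 * d ^ 2) * G i
        + 3 * (a * (a * K ^ 2) * (G i * lam i ^ 2)) := by ring
    rw [e]
    linarith
  have h2 : ∑ i, G i * p i ^ 2 ≤ K ^ 2 * F := by
    rw [Finset.mul_sum]
    refine Finset.sum_le_sum fun i _ => ?_
    have hp := sq_le_sq' (abs_le.1 (h.p_le i)).1 (abs_le.1 (h.p_le i)).2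
    rw [mul_comm]
    exact mul_le_mul_of_nonneg_right hp (h.G_nonneg i)
  have h3 : F * L ^ 2 / (16 * n ^ 4) ≤ ∑ i, G i * lam i ^ 2 := by
    have h4 := Finset.single_le_sum (f := fun i => G i * lam i ^ 2)
      (fun j _ => mul_nonneg (h.G_nonneg j) (sq_nonneg _)) (Finset.mem_univ i)
    refine le_trans ?_ h4
    have h5 : (L / (4 * n)) ^ 2 ≤ lam i ^ 2 := by
      rw [← sq_abs (lam i)]
      gcongr
    calc F * L ^ 2 / (16 * n ^ 4) = F / n ^ 2 * (L / (4 * n)) ^ 2 := by field_simp; norm_num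
      _ ≤ G i * lam i ^ 2 := by
        refine mul_le_mul ?_ h5 (by positivity) (h.G_nonneg i)
        rw [div_le_iff₀ (by positivity), mul_comm]
        exact h.sum_le i hi
  have h4 : a / 2 * (F * L ^ 2 / (16 * n ^ 4)) ≤
      (3 * β ^ 2 * K ^ 2 / w ^ 2 + 3 * A ^ 2 * d ^ 2) * F + β / w ^ 2 * (K ^ 2 * F)
        + F / c * (B₁ / w + 4 * C₁ * L + B₂) := by
    have h5 := mul_le_mul_of_nonneg_left h2 (by positivity : 0 ≤ β / w ^ 2)
    have h6 := mul_le_mul_of_nonneg_left h3 (by positivity : 0 ≤ a / 2)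
    have h7 : 0 ≤ A * F := by positivity
    have h8 : 1 ≤ F / c := (one_le_div hc).2 hF
    have h9 : 0 ≤ B₁ / w + 4 * C₁ * L + B₂ := by positivity
    have h10 := mul_le_mul_of_nonneg_right h8 h9
    linarith
  refine le_of_mul_sq_le (by positivity) (by positivity) (by positivity) ?_
  have h5 := mul_le_mul_of_nonneg_left h4 (by positivity : 0 ≤ w ^ 2 / F)
  have e1 : w ^ 2 / F * (a / 2 * (F * L ^ 2 / (16 * n ^ 4))) = a / (32 * n ^ 4) * (w * L) ^ 2 := by
    field_simp
    norm_num
  have e2 : w ^ 2 / F * ((3 * β ^ 2 * K ^ 2 / w ^ 2 + 3 * A ^ 2 * d ^ 2) * F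
      + β / w ^ 2 * (K ^ 2 * F) + F / c * (B₁ / w + 4 * C₁ * L + B₂))
      = 3 * β ^ 2 * K ^ 2 + β * K ^ 2 + 3 * A ^ 2 * d ^ 2 * w ^ 2
        + (B₁ * w + B₂ * w ^ 2) / c + 4 * C₁ * w / c * (w * L) := by
    field_simp
    ring
  rw [e1, e2] at h5
  refine h5.trans ?_
  gcongr

/-- The case where all other eigenvalues are small in comparison with the largest one. -/
lemma IsMaxRelation.le_of_small (h : IsMaxRelation K d C₁ c c' L₀ a A β i₀ w lam p y q X b D4 G T)
    (ha : 0 < a) (haK : 18 * (a * K ^ 2) ≤ 1) (hA : 0 ≤ A)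
    (hAc : 2 * (4 * C₁ + 1) ≤ A * c') (hβ : 6 ≤ β) (hβA : 6 * A * d ^ 2 ≤ β) (hL : 1 ≤ lam i₀)
    (hL₀ : L₀ ≤ lam i₀) (hlam : ∀ i ≠ i₀, |lam i| ≤ lam i₀ / (4 * n)) :
    w * lam i₀ ≤ (9 / 2 * n * (β ^ 2 * K ^ 2 + A ^ 2 * d ^ 2 * K ^ 2) / (a / 2) + 1)
      + (β * (2 * n + n * (C₁ * K)) + (A * (n * (C₁ * d)) + a * (n * (K * C₁))) * K) := by
  have hw := h.w_pos
  have hwK := h.w_le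
  have hL0 := h.lam_pos
  have hC : 0 ≤ C₁ := (abs_nonneg _).trans (h.X_le i₀)
  have hK : 0 ≤ K := (abs_nonneg _).trans (h.p_le i₀)
  have hd : 0 ≤ d := (abs_nonneg _).trans (h.y_le i₀)
  have hβ0 : 0 < β := by linarith
  have hn : (1 : ℝ) ≤ n := by exact_mod_cast i₀.pos
  -- With `θ = q` each rotation term, divided by `L`, is `(G i - G i₀) q² (2 + 2 lam i / L)`, and
  -- `lam i ≥ -L/4` for `i ≠ i₀` makes the last factor at least `3/2`. This matches the total
  -- coefficient of `G i q²` after `p_sq_le` has contributed its extra half.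
  have hM := h.sum_inequality ha.le hA hβ0.le hL q
  have hF := h.mul_le_sum hL₀ hlam
  have hR : ∑ i, 3 / 2 * (G i - G i₀) * q i ^ 2 ≤
      (∑ i, (G i - G i₀) * (4 * q i * (lam i₀ * q i) - 2 * q i ^ 2 * (lam i₀ - lam i)))
        / lam i₀ := by
    rw [Finset.sum_div]
    refine Finset.sum_le_sum fun i _ => ?_
    rw [le_div_iff₀ hL0]
    by_cases hi : i = i₀
    · subst hi
      simp
    have h1 : -(lam i₀ / 4) ≤ lam i := by
      have h2 := (abs_le.1 (hlam i hi)).1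
      have : lam i₀ / (4 * n) ≤ lam i₀ / 4 := by
        gcongr
        linarith
      linarith
    have h2 : 0 ≤ (G i - G i₀) * q i ^ 2 := mul_nonneg (sub_nonneg.2 (h.G_min i)) (sq_nonneg _)
    nlinarith
  set F := ∑ i, G i
  set L := lam i₀
  set Q := ∑ i, G i * lam i ^ 2 with hQ
  set B₁ := β * (2 * n + n * (C₁ * K))
  set B₂ := A * (n * (C₁ * d)) + a * (n * (K * C₁))
  set D := β ^ 2 * K ^ 2 / w ^ 2 + A ^ 2 * d ^ 2
  have hB₁ : 0 ≤ B₁ := by positivity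
  have hB₂ : 0 ≤ B₂ := by positivity
  have hGL : G i₀ * L ^ 2 ≤ Q := Finset.single_le_sum (f := fun i => G i * lam i ^ 2)
    (fun j _ => mul_nonneg (h.G_nonneg j) (sq_nonneg _)) (Finset.mem_univ i₀)
  have h1 : ∑ i, G i * q i ^ 2 + β / w ^ 2 * ∑ i, G i * p i ^ 2
      - ∑ i, 3 / 2 * (G i - G i₀) * q i ^ 2 ≤ a / 2 * Q + A / 2 * F + 9 / 2 * n * D * G i₀ := by
    have hnD : 9 / 2 * n * D * G i₀ = ∑ _i : Fin n, 9 / 2 * D * G i₀ := by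
      rw [Finset.sum_const, Finset.card_univ, Fintype.card_fin, nsmul_eq_mul]
      ring
    rw [hnD, hQ, Finset.mul_sum, Finset.mul_sum, Finset.mul_sum, ← Finset.sum_add_distrib,
      ← Finset.sum_sub_distrib, ← Finset.sum_add_distrib, ← Finset.sum_add_distrib]
    refine Finset.sum_le_sum fun i _ => ?_
    have e1 := mul_le_mul_of_nonneg_left (h.p_sq_le ha.le haK hA hβ hβA i) (h.G_nonneg i)
    have e2 := mul_le_mul_of_nonneg_left (h.q_sq_le i) (h.G_nonneg i₀)
    have e3 : G i₀ * (a * (a * K ^ 2) * lam i ^ 2) ≤ G i * (a * (1 / 18) * lam i ^ 2) := by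
      refine mul_le_mul (h.G_min i) ?_ (by positivity) (h.G_nonneg i)
      gcongr
      linarith
    have e4 : G i₀ * (3 * (β ^ 2 * K ^ 2 / w ^ 2 + a ^ 2 * K ^ 2 * lam i ^ 2 + A ^ 2 * d ^ 2))
        = 3 * (D * G i₀) + 3 * (G i₀ * (a * (a * K ^ 2) * lam i ^ 2)) := by
      simp only [D]
      ring
    rw [e4] at e2
    linarith
  have h2 : a / 2 * (G i₀ * L ^ 2) + A / 2 * F ≤ 9 / 2 * n * D * G i₀ + B₁ / w + 4 * C₁ * L
      + B₂ := by
    have := mul_le_mul_of_nonneg_left hGL (by positivity : 0 ≤ a / 2)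
    linarith
  have hD0 : 0 ≤ 9 / 2 * n * (β ^ 2 * K ^ 2 + A ^ 2 * d ^ 2 * K ^ 2) / (a / 2) := by positivity
  have hB0 : 0 ≤ B₁ + B₂ * K := by positivity
  -- What remains of the `q²` terms is a multiple of `G i₀`. Either it is absorbed by `G i₀ L²`, and
  -- `A ∑ G` then bounds `L`, or `L²` is at most a multiple of `D`, which bounds `w L` at once.
  by_cases hcase : 9 / 2 * n * D ≤ a / 2 * L ^ 2
  · have h3 := mul_le_mul_of_nonneg_right hcase (h.G_nonneg i₀)
    have h4 : A / 2 * F ≤ B₁ / w + 4 * C₁ * L + B₂ := by linarith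
    have h5 := mul_le_mul_of_nonneg_left hF (by positivity : 0 ≤ A / 2)
    have h6 := mul_le_mul_of_nonneg_right hAc hL0.le
    have h7 : L ≤ B₁ / w + B₂ := by linarith
    have h8 := mul_le_mul_of_nonneg_left h7 hw.le
    have e : w * (B₁ / w + B₂) = B₁ + B₂ * w := by field_simp
    rw [e] at h8
    have h9 := mul_le_mul_of_nonneg_left hwK hB₂
    linarith
  · push Not at hcase
    have h3 := mul_le_mul_of_nonneg_left hcase.le (by positivity : 0 ≤ w ^ 2)
    have e : w ^ 2 * (9 / 2 * n * D) = 9 / 2 * n * (β ^ 2 * K ^ 2 + A ^ 2 * d ^ 2 * w ^ 2) := by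
      simp only [D]
      field_simp
    have h4 : a / 2 * (w * L) ^ 2 ≤
        9 / 2 * n * (β ^ 2 * K ^ 2 + A ^ 2 * d ^ 2 * K ^ 2) + 0 * (w * L) := by
      calc a / 2 * (w * L) ^ 2 = w ^ 2 * (a / 2 * L ^ 2) := by ring
        _ ≤ 9 / 2 * n * (β ^ 2 * K ^ 2 + A ^ 2 * d ^ 2 * w ^ 2) := by rw [← e]; exact h3
        _ ≤ 9 / 2 * n * (β ^ 2 * K ^ 2 + A ^ 2 * d ^ 2 * K ^ 2) := by gcongr
        _ = _ := by ring
    have h5 := le_of_mul_sq_le (by positivity) (by positivity) le_rfl h4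
    rw [add_zero] at h5
    linarith

theorem exists_bound_of_isMaxRelation (n : ℕ) {K d C₁ c c' L₀ : ℝ} (hK : 0 ≤ K)
    (hC₁ : 0 ≤ C₁) (hc : 0 < c) (hc' : 0 < c') (hL₀ : 1 ≤ L₀) :
    ∃ a A β C : ℝ, 0 < a ∧ 0 < A ∧ 1 ≤ β ∧ 0 < C ∧
      ∀ (i₀ : Fin n) (w : ℝ) (lam p y q X b D4 G : Fin n → ℝ) (T : Fin n → Fin n → ℝ),
        IsMaxRelation K d C₁ c c' L₀ a A β i₀ w lam p y q X b D4 G T → w * lam i₀ ≤ C := by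
  -- The constants are chosen in this order: `a` small against `K²`, then `A` so that `A c'` beats
  -- the error `4 C₁ L` with a full `L` to spare, and `β` last, large against `A d²`.
  set a : ℝ := 1 / (18 * (K ^ 2 + 1))
  set A : ℝ := 2 * (4 * C₁ + 1) / c'
  set β : ℝ := 6 + 6 * A * d ^ 2
  have ha : 0 < a := by positivity
  have hA : 0 < A := by positivity
  have hβ : 6 ≤ β := by
    have : 0 ≤ 6 * A * d ^ 2 := by positivity
    simp only [β]
    linarith
  have haK : 18 * (a * K ^ 2) ≤ 1 := by
    have e : 18 * (a * K ^ 2) = K ^ 2 / (K ^ 2 + 1) := by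
      simp only [a]
      field_simp
    rw [e, div_le_one (by positivity)]
    linarith
  have hAc : 2 * (4 * C₁ + 1) ≤ A * c' := by
    simp only [A]
    rw [div_mul_cancel₀ _ hc'.ne']
  obtain ⟨U₁, hU₁⟩ : ∃ U, U = ((3 * β ^ 2 * K ^ 2 + β * K ^ 2 + 3 * A ^ 2 * d ^ 2 * K ^ 2
      + (β * (2 * n + n * (C₁ * K)) * K + (A * (n * (C₁ * d)) + a * (n * (K * C₁))) * K ^ 2) / c)
      + 4 * C₁ * K / c) / (a / (32 * n ^ 4)) + 1 := ⟨_, rfl⟩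
  obtain ⟨U₂, hU₂⟩ : ∃ U, U = (9 / 2 * n * (β ^ 2 * K ^ 2 + A ^ 2 * d ^ 2 * K ^ 2) / (a / 2) + 1)
      + (β * (2 * n + n * (C₁ * K)) + (A * (n * (C₁ * d)) + a * (n * (K * C₁))) * K) := ⟨_, rfl⟩
  refine ⟨a, A, β, |U₁| + |U₂| + K * L₀ + 1, ha, hA, by linarith, by positivity, ?_⟩
  intro i₀ w lam p y q X b D4 G T h
  have hU₁' := le_abs_self U₁
  have hU₂' := le_abs_self U₂
  have hU₁0 := abs_nonneg U₁
  have hU₂0 := abs_nonneg U₂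
  have hKL : 0 ≤ K * L₀ := by positivity
  by_cases hL : L₀ ≤ lam i₀
  · by_cases hs : ∀ i ≠ i₀, |lam i| ≤ lam i₀ / (4 * n)
    · have := h.le_of_small ha haK hA.le hAc hβ (by simp only [β]; linarith) (by linarith) hL hs
      linarith
    · push Not at hs
      obtain ⟨i, hi, hi'⟩ := hs
      have := h.le_of_large hc ha haK hA.le (by linarith) (by linarith) hi hi'
      linarith
  · push Not at hL
    have h1 := mul_le_mul h.w_le hL.le h.lam_pos.le hK
    linarith

end PogorelovInequality

open Filter Topology

/-! ### Calculus along lines. -/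

section Lines

/-- If the second derivative were positive, the point would also be a local minimum, so the function
would be locally constant. -/
lemma deriv_eq_zero_and_le_zero_of_isLocalMax {P P' : ℝ → ℝ} {P'' : ℝ}
    (h : ∀ᶠ t in 𝓝 0, HasDerivAt P (P' t) t) (h' : HasDerivAt P' P'' 0) (hm : IsLocalMax P 0) :
    P' 0 = 0 ∧ P'' ≤ 0 := by
  have h0 : P' 0 = 0 := hm.hasDerivAt_eq_zero h.self_of_nhds
  refine ⟨h0, ?_⟩
  by_contra hcon
  push Not at hcon
  have e1 : deriv P =ᶠ[𝓝 0] P' := h.mono fun t ht => ht.deriv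
  have e2 : deriv (deriv P) 0 = P'' := by rw [e1.deriv_eq, h'.deriv]
  have hmin : IsLocalMin P 0 := isLocalMin_of_deriv_deriv_pos (by rw [e2]; exact hcon)
    (by rw [e1.self_of_nhds, h0]) h.self_of_nhds.continuousAt
  have e3 : P =ᶠ[𝓝 0] fun _ => P 0 := by
    filter_upwards [hm, hmin] with t h1 h2 using le_antisymm h1 h2
  have e4 : deriv P =ᶠ[𝓝 0] fun _ => 0 := by
    filter_upwards [e3.eventually_nhds] with t ht
    have := Filter.EventuallyEq.deriv_eq ht
    rw [this, deriv_const]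
  rw [e4.deriv_eq, deriv_const] at e2
  exact hcon.ne e2

variable {E F : Type*} [NormedAddCommGroup E] [NormedSpace ℝ E] [NormedAddCommGroup F]
  [NormedSpace ℝ F]

lemma hasDerivAt_line (x v : E) (t : ℝ) : HasDerivAt (fun s : ℝ => x + s • v) v t := by
  simpa using ((hasDerivAt_id t).smul_const v).const_add x

lemma hasDerivAt_comp_line {g : E → F} {x v : E} {t : ℝ}
    (h : DifferentiableAt ℝ g (x + t • v)) :
    HasDerivAt (fun s : ℝ => g (x + s • v)) (fderiv ℝ g (x + t • v) v) t :=
  h.hasFDerivAt.comp_hasDerivAt t (hasDerivAt_line x v t)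

lemma hasDerivAt_comp_line_zero {g : E → F} {x : E} (v : E) (h : DifferentiableAt ℝ g x) :
    HasDerivAt (fun s : ℝ => g (x + s • v)) (fderiv ℝ g x v) 0 := by
  have h' : DifferentiableAt ℝ g (x + (0 : ℝ) • v) := by simpa using h
  simpa using hasDerivAt_comp_line h'

lemma eventually_line_mem {Ω : Set E} (hΩ : IsOpen Ω) {x : E} (hx : x ∈ Ω) (v : E) :
    ∀ᶠ t : ℝ in 𝓝 0, x + t • v ∈ Ω := by
  have h : ContinuousAt (fun s : ℝ => x + s • v) 0 := (hasDerivAt_line x v 0).continuousAt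
  exact h.eventually_mem (by simpa using hΩ.mem_nhds hx)

end Lines

/-! ### Iterated derivatives and their symmetries. -/

section Derivatives

variable {E : Type*} [NormedAddCommGroup E] [NormedSpace ℝ E] {Ω : Set E} {u : E → ℝ}

/-- The second derivative, as a bilinear map. -/
noncomputable def D2 (u : E → ℝ) : E → E →L[ℝ] E →L[ℝ] ℝ := fderiv ℝ (fderiv ℝ u)

/-- The third derivative, as a trilinear map. -/
noncomputable def D3 (u : E → ℝ) : E → E →L[ℝ] E →L[ℝ] E →L[ℝ] ℝ := fderiv ℝ (D2 u)

/-- The fourth derivative, as a quadrilinear map. -/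
noncomputable def D4 (u : E → ℝ) : E → E →L[ℝ] E →L[ℝ] E →L[ℝ] E →L[ℝ] ℝ := fderiv ℝ (D3 u)

lemma contDiffAt_four (hΩ : IsOpen Ω) (hu : ContDiffOn ℝ 4 u Ω) {x : E} (hx : x ∈ Ω)
    : ContDiffAt ℝ 4 u x := hu.contDiffAt (hΩ.mem_nhds hx)

lemma contDiffAt_fderiv (hΩ : IsOpen Ω) (hu : ContDiffOn ℝ 4 u Ω) {x : E} (hx : x ∈ Ω)
    : ContDiffAt ℝ 3 (fderiv ℝ u) x :=
  (contDiffAt_four hΩ hu hx).fderiv_right (by norm_num)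

lemma contDiffAt_D2 (hΩ : IsOpen Ω) (hu : ContDiffOn ℝ 4 u Ω) {x : E} (hx : x ∈ Ω)
    : ContDiffAt ℝ 2 (D2 u) x :=
  (contDiffAt_fderiv hΩ hu hx).fderiv_right (by norm_num)

lemma contDiffAt_D3 (hΩ : IsOpen Ω) (hu : ContDiffOn ℝ 4 u Ω) {x : E} (hx : x ∈ Ω)
    : ContDiffAt ℝ 1 (D3 u) x :=
  (contDiffAt_D2 hΩ hu hx).fderiv_right (by norm_num)

lemma differentiableAt_self (hΩ : IsOpen Ω) (hu : ContDiffOn ℝ 4 u Ω) {x : E} (hx : x ∈ Ω)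
    : DifferentiableAt ℝ u x :=
  (contDiffAt_four hΩ hu hx).differentiableAt (by norm_num)

lemma differentiableAt_fderiv (hΩ : IsOpen Ω) (hu : ContDiffOn ℝ 4 u Ω) {x : E} (hx : x ∈ Ω)
    : DifferentiableAt ℝ (fderiv ℝ u) x :=
  (contDiffAt_fderiv hΩ hu hx).differentiableAt (by norm_num)

lemma differentiableAt_D2 (hΩ : IsOpen Ω) (hu : ContDiffOn ℝ 4 u Ω) {x : E} (hx : x ∈ Ω)
    : DifferentiableAt ℝ (D2 u) x :=
  (contDiffAt_D2 hΩ hu hx).differentiableAt (by norm_num)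

lemma differentiableAt_D3 (hΩ : IsOpen Ω) (hu : ContDiffOn ℝ 4 u Ω) {x : E} (hx : x ∈ Ω)
    : DifferentiableAt ℝ (D3 u) x :=
  (contDiffAt_D3 hΩ hu hx).differentiableAt (by norm_num)

lemma D2_symm (hΩ : IsOpen Ω) (hu : ContDiffOn ℝ 4 u Ω) {x : E} (hx : x ∈ Ω)
    (v w : E) : D2 u x v w = D2 u x w v :=
  ((contDiffAt_four hΩ hu hx).isSymmSndFDerivAt (by simp; norm_num)).eq v w

lemma D3_symm_left (hΩ : IsOpen Ω) (hu : ContDiffOn ℝ 4 u Ω) {x : E} (hx : x ∈ Ω)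
    (a v : E) : D3 u x a v = D3 u x v a :=
  ((contDiffAt_fderiv hΩ hu hx).isSymmSndFDerivAt (by simp; norm_num)).eq a v

lemma D4_symm_left (hΩ : IsOpen Ω) (hu : ContDiffOn ℝ 4 u Ω) {x : E} (hx : x ∈ Ω)
    (a v : E) : D4 u x a v = D4 u x v a :=
  ((contDiffAt_D2 hΩ hu hx).isSymmSndFDerivAt (by simp)).eq a v

lemma D3_symm_right (hΩ : IsOpen Ω) (hu : ContDiffOn ℝ 4 u Ω) {x : E} (hx : x ∈ Ω)
    (a v w : E) : D3 u x a v w = D3 u x a w v := by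
  have h := hasDerivAt_comp_line_zero (F := E →L[ℝ] E →L[ℝ] ℝ) a (differentiableAt_D2 hΩ hu hx)
  have h1 := (h.clm_apply (hasDerivAt_const 0 v)).clm_apply (hasDerivAt_const 0 w)
  have h2 := (h.clm_apply (hasDerivAt_const 0 w)).clm_apply (hasDerivAt_const 0 v)
  have h3 : (fun t : ℝ => D2 u (x + t • a) v w) =ᶠ[𝓝 0] fun t => D2 u (x + t • a) w v := by
    filter_upwards [eventually_line_mem hΩ hx a] with t ht using D2_symm hΩ hu ht v w
  have h4 := h1.unique (h2.congr_of_eventuallyEq h3)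
  simpa [D3] using h4

lemma D4_symm_right (hΩ : IsOpen Ω) (hu : ContDiffOn ℝ 4 u Ω) {x : E} (hx : x ∈ Ω)
    (a b v w : E) : D4 u x a b v w = D4 u x a b w v := by
  have h := hasDerivAt_comp_line_zero (F := E →L[ℝ] E →L[ℝ] E →L[ℝ] ℝ) a
    (differentiableAt_D3 hΩ hu hx)
  have h0 := h.clm_apply (hasDerivAt_const 0 b)
  have h1 := (h0.clm_apply (hasDerivAt_const 0 v)).clm_apply (hasDerivAt_const 0 w)
  have h2 := (h0.clm_apply (hasDerivAt_const 0 w)).clm_apply (hasDerivAt_const 0 v)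
  have h3 : (fun t : ℝ => D3 u (x + t • a) b v w) =ᶠ[𝓝 0] fun t => D3 u (x + t • a) b w v := by
    filter_upwards [eventually_line_mem hΩ hx a] with t ht using D3_symm_right hΩ hu ht b v w
  have h4 := h1.unique (h2.congr_of_eventuallyEq h3)
  simpa [D4] using h4

lemma D4_symm_mid (hΩ : IsOpen Ω) (hu : ContDiffOn ℝ 4 u Ω) {x : E} (hx : x ∈ Ω)
    (a b v : E) : D4 u x a b v = D4 u x a v b := by
  have h := hasDerivAt_comp_line_zero (F := E →L[ℝ] E →L[ℝ] E →L[ℝ] ℝ) a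
    (differentiableAt_D3 hΩ hu hx)
  have h1 := (h.clm_apply (hasDerivAt_const 0 b)).clm_apply (hasDerivAt_const 0 v)
  have h2 := (h.clm_apply (hasDerivAt_const 0 v)).clm_apply (hasDerivAt_const 0 b)
  have h3 : (fun t : ℝ => D3 u (x + t • a) b v) =ᶠ[𝓝 0] fun t => D3 u (x + t • a) v b := by
    filter_upwards [eventually_line_mem hΩ hx a] with t ht using D3_symm_left hΩ hu ht b v
  have h4 := h1.unique (h2.congr_of_eventuallyEq h3)
  simpa [D4] using h4

lemma D4_pair_symm (hΩ : IsOpen Ω) (hu : ContDiffOn ℝ 4 u Ω) {x : E} (hx : x ∈ Ω)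
    (a b : E) : D4 u x a a b b = D4 u x b b a a := by
  rw [D4_symm_mid hΩ hu hx a a b, D4_symm_right hΩ hu hx a b a b, D4_symm_left hΩ hu hx a b,
    D4_symm_mid hΩ hu hx b a b]

end Derivatives

/-! ### Rotating frames. -/

section Frames

open NormedSpace

variable {E : Type*} [NormedAddCommGroup E] [InnerProductSpace ℝ E] [CompleteSpace E]

/-- For skew `A` the derivative of the inner product along the flow vanishes; thus rotated frames
stay orthonormal. -/
lemma inner_exp_smul {A : E →L[ℝ] E} (hA : ∀ x y, inner ℝ (A x) y = -inner ℝ x (A y)) (t : ℝ)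
    (x y : E) : inner ℝ (exp (t • A) x) (exp (t • A) y) = inner ℝ x y := by
  have hd : ∀ s : ℝ, HasDerivAt
      (fun s : ℝ => inner ℝ (exp (s • A) x) (exp (s • A) y)) 0 s := fun s => by
    have h : ∀ z : E, HasDerivAt (fun s : ℝ => exp (s • A) z) (A (exp (s • A) z)) s := fun z => by
      simpa using (hasDerivAt_exp_smul_const' A s).clm_apply (hasDerivAt_const s z)
    have h1 := (h x).inner ℝ (h y)
    have e : inner ℝ (exp (s • A) x) (A (exp (s • A) y))
        + inner ℝ (A (exp (s • A) x)) (exp (s • A) y) = 0 := by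
      rw [hA]
      ring
    rwa [e] at h1
  have h := is_const_of_deriv_eq_zero (fun s => (hd s).differentiableAt) (fun s => (hd s).deriv) t 0
  simpa using h

lemma hasDerivAt_exp_smul_apply (A : E →L[ℝ] E) (t : ℝ) (x : E) :
    HasDerivAt (fun s : ℝ => exp (s • A) x) (exp (t • A) (A x)) t := by
  simpa using (hasDerivAt_exp_smul_const A t).clm_apply (hasDerivAt_const t x)

lemma hasDerivAt_bilin_exp {B : ℝ → E →L[ℝ] E →L[ℝ] ℝ} {B' : E →L[ℝ] E →L[ℝ] ℝ} {t : ℝ}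
    (hB : HasDerivAt B B' t) (A : E →L[ℝ] E) (x y : E) :
    HasDerivAt (fun s : ℝ => B s (exp (s • A) x) (exp (s • A) y))
      (B' (exp (t • A) x) (exp (t • A) y) + B t (exp (t • A) (A x)) (exp (t • A) y)
        + B t (exp (t • A) x) (exp (t • A) (A y))) t := by
  simpa using (hB.clm_apply (hasDerivAt_exp_smul_apply A t x)).clm_apply
    (hasDerivAt_exp_smul_apply A t y)

end Frames

/-! ### Derivatives of functions dominated by diagonal entries of the Hessian. -/

section Dominated

variable {n : ℕ} {Ω : Set (EuclideanSpace ℝ (Fin n))} {u : EuclideanSpace ℝ (Fin n) → ℝ}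

/-- The first and second derivatives along a line of a function that is dominated by a linear
function of the diagonal entries of `D²u` in any orthonormal frame, when the frame is rotated by the
one-parameter group of `A`. -/
lemma deriv_of_dominated (hΩ : IsOpen Ω) (hu : ContDiffOn ℝ 4 u Ω)
    {x₀ : EuclideanSpace ℝ (Fin n)} (hx : x₀ ∈ Ω)
    {e : Fin n → EuclideanSpace ℝ (Fin n)} (he : Orthonormal ℝ e) {lam G : Fin n → ℝ}
    (hlam : ∀ i, D2 u x₀ (e i) (e i) = lam i) {φ : EuclideanSpace ℝ (Fin n) → ℝ}
    (hdom : ∀ x ∈ Ω, ∀ v : Fin n → EuclideanSpace ℝ (Fin n), Orthonormal ℝ v →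
      φ x ≤ φ x₀ + ∑ i, G i * (D2 u x (v i) (v i) - lam i))
    {A : EuclideanSpace ℝ (Fin n) →L[ℝ] EuclideanSpace ℝ (Fin n)}
    (hA : ∀ x y, inner ℝ (A x) y = -inner ℝ x (A y)) {ξ : EuclideanSpace ℝ (Fin n)}
    {φ' : ℝ → ℝ} {φ'' : ℝ}
    (hφ : ∀ᶠ t in 𝓝 0, HasDerivAt (fun t : ℝ => φ (x₀ + t • ξ)) (φ' t) t)
    (hφ' : HasDerivAt φ' φ'' 0) :
    φ' 0 = ∑ i, G i * (D3 u x₀ ξ (e i) (e i) + 2 * D2 u x₀ (A (e i)) (e i)) ∧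
      φ'' ≤ ∑ i, G i * (D4 u x₀ ξ ξ (e i) (e i) + 4 * D3 u x₀ ξ (A (e i)) (e i)
        + 2 * D2 u x₀ (A (e i)) (A (e i)) + 2 * D2 u x₀ (A (A (e i))) (e i)) := by
  let V : ℝ → EuclideanSpace ℝ (Fin n) →L[ℝ] EuclideanSpace ℝ (Fin n) :=
    fun t => NormedSpace.exp (t • A)
  have hV0 : ∀ x, V 0 x = x := fun x => by simp [V]
  have hB2 : ∀ᶠ t : ℝ in 𝓝 0,
      HasDerivAt (fun s : ℝ => D2 u (x₀ + s • ξ)) (D3 u (x₀ + t • ξ) ξ) t := by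
    filter_upwards [eventually_line_mem hΩ hx ξ] with t ht
    exact hasDerivAt_comp_line (F := EuclideanSpace ℝ (Fin n) →L[ℝ] EuclideanSpace ℝ (Fin n) →L[ℝ] ℝ)
      (differentiableAt_D2 hΩ hu ht)
  have hB3 : HasDerivAt (fun s : ℝ => D3 u (x₀ + s • ξ) ξ) (D4 u x₀ ξ ξ) 0 := by
    have h := (hasDerivAt_comp_line_zero (F := EuclideanSpace ℝ (Fin n) →L[ℝ]
      EuclideanSpace ℝ (Fin n) →L[ℝ] EuclideanSpace ℝ (Fin n) →L[ℝ] ℝ) ξ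
      (differentiableAt_D3 hΩ hu hx)).clm_apply (hasDerivAt_const 0 ξ)
    simpa [D4] using h
  have h1 : ∀ᶠ t : ℝ in 𝓝 0, HasDerivAt
      (fun s : ℝ => φ (x₀ + s • ξ) - ∑ i, G i * D2 u (x₀ + s • ξ) (V s (e i)) (V s (e i)))
      (φ' t - ∑ i, G i * (D3 u (x₀ + t • ξ) ξ (V t (e i)) (V t (e i))
        + D2 u (x₀ + t • ξ) (V t (A (e i))) (V t (e i))
        + D2 u (x₀ + t • ξ) (V t (e i)) (V t (A (e i))))) t := by
    filter_upwards [hφ, hB2] with t ht1 ht2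
    exact ht1.sub (HasDerivAt.fun_sum fun i _ =>
      (hasDerivAt_bilin_exp ht2 A (e i) (e i)).const_mul (G i))
  have h2 := hφ'.sub (HasDerivAt.fun_sum fun i (_ : i ∈ Finset.univ) =>
    (((hasDerivAt_bilin_exp hB3 A (e i) (e i)).add
      (hasDerivAt_bilin_exp hB2.self_of_nhds A (A (e i)) (e i))).add
      (hasDerivAt_bilin_exp hB2.self_of_nhds A (e i) (A (e i)))).const_mul (G i))
  -- Domination holds in every orthonormal frame, with equality at `x₀` in the frame `e`, so the
  -- difference along the moving frame is largest at `0`.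
  have hmax : IsLocalMax (fun s : ℝ =>
      φ (x₀ + s • ξ) - ∑ i, G i * D2 u (x₀ + s • ξ) (V s (e i)) (V s (e i))) 0 := by
    filter_upwards [eventually_line_mem hΩ hx ξ] with t ht
    have hv : Orthonormal ℝ fun i => V t (e i) := by
      rw [orthonormal_iff_ite] at he ⊢
      intro i j
      rw [← he i j]
      exact inner_exp_smul hA t (e i) (e j)
    have h3 := hdom _ ht _ hv
    simp only [zero_smul, add_zero, hV0, hlam]
    simp only [mul_sub, Finset.sum_sub_distrib] at h3
    linarith
  obtain ⟨h4, h5⟩ := deriv_eq_zero_and_le_zero_of_isLocalMax h1 h2 hmax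
  simp only [zero_smul, add_zero, hV0, NormedSpace.exp_zero, one_apply_eq_self]
    at h4 h5
  constructor
  · rw [sub_eq_zero.1 h4]
    refine Finset.sum_congr rfl fun i _ => ?_
    rw [D2_symm hΩ hu hx (e i) (A (e i))]
    ring
  · refine (sub_nonpos.1 h5).trans (le_of_eq (Finset.sum_congr rfl fun i _ => ?_))
    rw [D2_symm hΩ hu hx (e i) (A (A (e i))), D3_symm_right hΩ hu hx ξ (e i) (A (e i))]
    ring

/-- The second derivative of a dominated function in the direction of the eigenvector `e i₀`, after
rotation of the frame in the planes of `e i₀` and `e i`. -/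
lemma second_deriv_le_of_dominated (hΩ : IsOpen Ω) (hu : ContDiffOn ℝ 4 u Ω)
    {x₀ : EuclideanSpace ℝ (Fin n)} (hx : x₀ ∈ Ω)
    {e : Fin n → EuclideanSpace ℝ (Fin n)} (he : Orthonormal ℝ e) {lam G : Fin n → ℝ}
    (hlam : ∀ i j, D2 u x₀ (e i) (e j) = if i = j then lam i else 0)
    {φ : EuclideanSpace ℝ (Fin n) → ℝ}
    (hdom : ∀ x ∈ Ω, ∀ v : Fin n → EuclideanSpace ℝ (Fin n), Orthonormal ℝ v →
      φ x ≤ φ x₀ + ∑ i, G i * (D2 u x (v i) (v i) - lam i))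
    {ξ : EuclideanSpace ℝ (Fin n)} {φ' : ℝ → ℝ} {φ'' : ℝ}
    (hφ : ∀ᶠ t in 𝓝 0, HasDerivAt (fun t : ℝ => φ (x₀ + t • ξ)) (φ' t) t)
    (hφ' : HasDerivAt φ' φ'' 0) (i₀ : Fin n) (θ : Fin n → ℝ) :
    φ'' ≤ ∑ i, G i * D4 u x₀ ξ ξ (e i) (e i)
      - ∑ i, (G i - G i₀) * (4 * θ i * D3 u x₀ ξ (e i) (e i₀)
        - 2 * θ i ^ 2 * (lam i₀ - lam i)) := by
  -- The generator sends `e i₀` to `Θ = ∑ θ'_j e_j` and each other `e i` to `-θ'_i e i₀`. The entry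
  -- at `i₀` is set to zero so that `Θ` is orthogonal to `e i₀`; the final sum does not see it,
  -- because its factor `G i - G i₀` vanishes there.
  set θ' : Fin n → ℝ := Function.update θ i₀ 0 with hθ'
  set Θ : EuclideanSpace ℝ (Fin n) := ∑ j, θ' j • e j with hΘ
  let A : EuclideanSpace ℝ (Fin n) →L[ℝ] EuclideanSpace ℝ (Fin n) :=
    (innerSL ℝ (e i₀)).smulRight Θ - (innerSL ℝ Θ).smulRight (e i₀)
  have hAx : ∀ x, A x = inner ℝ (e i₀) x • Θ - inner ℝ Θ x • e i₀ := fun x => by simp [A]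
  have hA : ∀ x y, inner ℝ (A x) y = -inner ℝ x (A y) := fun x y => by
    rw [hAx, hAx, inner_sub_left, inner_sub_right, inner_smul_left, inner_smul_left,
      inner_smul_right, inner_smul_right, real_inner_comm Θ x, real_inner_comm (e i₀) x]
    simp only [conj_trivial]
    ring
  have hi₀ : θ' i₀ = 0 := by simp [hθ']
  have hθne : ∀ i ≠ i₀, θ' i = θ i := fun i hi => by simp [hθ', hi]
  have hin : ∀ i, inner ℝ Θ (e i) = θ' i := fun i => by
    simp [hΘ, sum_inner, inner_smul_left, orthonormal_iff_ite.1 he]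
  have hin0 : inner ℝ (e i₀) Θ = 0 := by rw [real_inner_comm, hin, hi₀]
  have hΘΘ : inner ℝ Θ Θ = ∑ j, θ' j ^ 2 := by
    conv_lhs => rw [hΘ, inner_sum]
    exact Finset.sum_congr rfl fun j _ => by rw [inner_smul_right, ← hΘ, hin]; ring
  have hD2Θ : ∀ i, D2 u x₀ Θ (e i) = θ' i * lam i := fun i => by
    simp [hΘ, map_sum, hlam]
  have hD2ΘΘ : D2 u x₀ Θ Θ = ∑ j, θ' j ^ 2 * lam j := by
    conv_lhs => rw [hΘ, map_sum, ← hΘ]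
    exact Finset.sum_congr rfl fun j _ => by
      rw [map_smul, hD2Θ, smul_eq_mul]
      ring
  have hD3Θ : ∀ i, D3 u x₀ ξ Θ (e i) = ∑ j, θ' j * D3 u x₀ ξ (e j) (e i) := fun i => by
    simp [hΘ, map_sum]
  have h := (deriv_of_dominated hΩ hu hx he (fun i => by rw [hlam, if_pos rfl]) hdom hA hφ hφ').2
  refine h.trans (le_of_eq ?_)
  set τ : Fin n → ℝ := fun i => 4 * θ' i * D3 u x₀ ξ (e i) (e i₀)
    - 2 * θ' i ^ 2 * (lam i₀ - lam i) with hτ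
  -- Rotation transfers `τ i` from the `i`-th diagonal entry to the `i₀`-th one, which produces the
  -- differences `G i - G i₀`.
  have hterm : ∀ i, D4 u x₀ ξ ξ (e i) (e i) + 4 * D3 u x₀ ξ (A (e i)) (e i)
      + 2 * D2 u x₀ (A (e i)) (A (e i)) + 2 * D2 u x₀ (A (A (e i))) (e i)
      = D4 u x₀ ξ ξ (e i) (e i) - τ i + if i = i₀ then ∑ j, τ j else 0 := by
    intro i
    by_cases hi : i = i₀
    · subst hi
      have e1 : A (e i) = Θ := by
        rw [hAx, hin, hi₀, orthonormal_iff_ite.1 he, if_pos rfl, one_smul, zero_smul, sub_zero]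
      have e2 : A Θ = -(∑ j, θ' j ^ 2) • e i := by
        rw [hAx, hin0, hΘΘ, zero_smul, zero_sub, neg_smul]
      have e3 : ∑ j, τ j = 4 * ∑ j, θ' j * D3 u x₀ ξ (e j) (e i)
          - 2 * ((∑ j, θ' j ^ 2) * lam i - ∑ j, θ' j ^ 2 * lam j) := by
        simp only [hτ, Finset.mul_sum, Finset.sum_mul, ← Finset.sum_sub_distrib]
        exact Finset.sum_congr rfl fun j _ => by ring
      have e4 : τ i = 0 := by simp [hτ, hi₀]
      have e5 : D2 u x₀ (-(∑ j, θ' j ^ 2) • e i) (e i) = -(∑ j, θ' j ^ 2) * lam i := by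
        rw [map_smul, smul_apply, hlam, if_pos rfl, smul_eq_mul]
      rw [e1, e2, hD3Θ, hD2ΘΘ, e5, if_pos rfl, e3, e4]
      ring
    · have e1 : A (e i) = -θ' i • e i₀ := by
        rw [hAx, hin, orthonormal_iff_ite.1 he, if_neg (Ne.symm hi), zero_smul, zero_sub, neg_smul]
      have e2 : A (A (e i)) = -θ' i • Θ := by
        rw [e1, map_smul, hAx, hin, hi₀, orthonormal_iff_ite.1 he, if_pos rfl, one_smul, zero_smul,
          sub_zero]
      rw [e2, e1, if_neg hi]
      simp only [map_smul, smul_apply, hD2Θ, hlam, smul_eq_mul, if_true, hτ]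
      rw [D3_symm_right hΩ hu hx ξ (e i₀) (e i)]
      ring
  have hτθ : ∀ i, (G i - G i₀) * (4 * θ i * D3 u x₀ ξ (e i) (e i₀)
      - 2 * θ i ^ 2 * (lam i₀ - lam i)) = (G i - G i₀) * τ i := fun i => by
    by_cases hi : i = i₀
    · rw [hi, sub_self, zero_mul, zero_mul]
    · simp only [hτ, hθne i hi]
  simp only [hterm, hτθ]
  simp only [mul_add, mul_sub, sub_mul, Finset.sum_add_distrib, Finset.sum_sub_distrib, mul_ite,
    mul_zero, Finset.sum_ite_eq', Finset.mem_univ, if_true, Finset.mul_sum]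
  ring

end Dominated

/-! ### Maximum conditions for the test function. -/

section TestFunction

variable {n : ℕ} {Ω : Set (EuclideanSpace ℝ (Fin n))} {u : EuclideanSpace ℝ (Fin n) → ℝ}

/-- The conditions of first and second order at a local maximum of
`β log (-u) + log u₁₁ + (a/2) |Du|² + (A/2) |x - y|²`. -/
lemma derivs_of_isLocalMax (hΩ : IsOpen Ω) (hu : ContDiffOn ℝ 4 u Ω)
    {x₀ : EuclideanSpace ℝ (Fin n)} (hx : x₀ ∈ Ω) {e : Fin n → EuclideanSpace ℝ (Fin n)}
    {ζ y : EuclideanSpace ℝ (Fin n)} {a A β : ℝ} (hu0 : u x₀ < 0) (hL : 0 < D2 u x₀ ζ ζ)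
    (hmax : IsLocalMax (fun x => β * Real.log (-u x) + Real.log (D2 u x ζ ζ)
      + a / 2 * ∑ k, fderiv ℝ u x (e k) ^ 2 + A / 2 * ‖x - y‖ ^ 2) x₀)
    (ξ : EuclideanSpace ℝ (Fin n)) (hξ : ‖ξ‖ = 1) :
    β * (fderiv ℝ u x₀ ξ / u x₀) + D3 u x₀ ξ ζ ζ / D2 u x₀ ζ ζ
      + a * ∑ k, fderiv ℝ u x₀ (e k) * D2 u x₀ ξ (e k) + A * inner ℝ (x₀ - y) ξ = 0 ∧
    β * (D2 u x₀ ξ ξ / u x₀ - fderiv ℝ u x₀ ξ ^ 2 / u x₀ ^ 2)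
      + (D4 u x₀ ξ ξ ζ ζ / D2 u x₀ ζ ζ - (D3 u x₀ ξ ζ ζ / D2 u x₀ ζ ζ) ^ 2)
      + a * ∑ k, (D2 u x₀ ξ (e k) ^ 2 + fderiv ℝ u x₀ (e k) * D3 u x₀ ξ ξ (e k)) + A ≤ 0 := by
  have c0 : ContinuousAt u x₀ := (differentiableAt_self hΩ hu hx).continuousAt
  have c2 : ContinuousAt (fun x => D2 u x ζ ζ) x₀ := by
    have := (contDiffAt_D2 hΩ hu hx).continuousAt
    fun_prop
  have cl : ContinuousAt (fun s : ℝ => x₀ + s • ξ) 0 := (hasDerivAt_line x₀ ξ 0).continuousAt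
  have e0 : x₀ + (0 : ℝ) • ξ = x₀ := by simp
  have tl : Tendsto (fun s : ℝ => x₀ + s • ξ) (𝓝 0) (𝓝 x₀) := by simpa [ContinuousAt] using cl
  have ev : ∀ᶠ t : ℝ in 𝓝 0, x₀ + t • ξ ∈ Ω ∧ u (x₀ + t • ξ) < 0 ∧
      0 < D2 u (x₀ + t • ξ) ζ ζ :=
    (eventually_line_mem hΩ hx ξ).and ((tl.eventually (c0.eventually (gt_mem_nhds hu0))).and
      (tl.eventually (c2.eventually (lt_mem_nhds hL))))
  have d0 : ∀ t : ℝ, x₀ + t • ξ ∈ Ω → HasDerivAt (fun s : ℝ => u (x₀ + s • ξ))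
      (fderiv ℝ u (x₀ + t • ξ) ξ) t := fun t ht =>
    hasDerivAt_comp_line (F := ℝ) (differentiableAt_self hΩ hu ht)
  have d1 : ∀ (t : ℝ) (η : EuclideanSpace ℝ (Fin n)), x₀ + t • ξ ∈ Ω →
      HasDerivAt (fun s : ℝ => fderiv ℝ u (x₀ + s • ξ) η) (D2 u (x₀ + t • ξ) ξ η) t :=
    fun t η ht => by
      simpa [D2] using (hasDerivAt_comp_line (F := EuclideanSpace ℝ (Fin n) →L[ℝ] ℝ)
        (differentiableAt_fderiv hΩ hu ht)).clm_apply (hasDerivAt_const t η)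
  have d2 : ∀ (t : ℝ) (η η' : EuclideanSpace ℝ (Fin n)), x₀ + t • ξ ∈ Ω →
      HasDerivAt (fun s : ℝ => D2 u (x₀ + s • ξ) η η') (D3 u (x₀ + t • ξ) ξ η η') t :=
    fun t η η' ht => by
      simpa [D3] using ((hasDerivAt_comp_line
        (F := EuclideanSpace ℝ (Fin n) →L[ℝ] EuclideanSpace ℝ (Fin n) →L[ℝ] ℝ)
        (differentiableAt_D2 hΩ hu ht)).clm_apply (hasDerivAt_const t η)).clm_apply
        (hasDerivAt_const t η')
  have d3 : ∀ (t : ℝ) (η η' : EuclideanSpace ℝ (Fin n)), x₀ + t • ξ ∈ Ω →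
      HasDerivAt (fun s : ℝ => D3 u (x₀ + s • ξ) ξ η η') (D4 u (x₀ + t • ξ) ξ ξ η η') t :=
    fun t η η' ht => by
      simpa [D4] using (((hasDerivAt_comp_line (F := EuclideanSpace ℝ (Fin n) →L[ℝ]
        EuclideanSpace ℝ (Fin n) →L[ℝ] EuclideanSpace ℝ (Fin n) →L[ℝ] ℝ)
        (differentiableAt_D3 hΩ hu ht)).clm_apply (hasDerivAt_const t ξ)).clm_apply
        (hasDerivAt_const t η)).clm_apply (hasDerivAt_const t η')
  have dy : ∀ t : ℝ, HasDerivAt (fun s : ℝ => x₀ + s • ξ - y) ξ t := fun t =>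
    (hasDerivAt_line x₀ ξ t).sub_const y
  have h1 : ∀ᶠ t : ℝ in 𝓝 0, HasDerivAt (fun s : ℝ => β * Real.log (-u (x₀ + s • ξ))
      + Real.log (D2 u (x₀ + s • ξ) ζ ζ) + a / 2 * ∑ k, fderiv ℝ u (x₀ + s • ξ) (e k) ^ 2
      + A / 2 * ‖x₀ + s • ξ - y‖ ^ 2)
      (β * (fderiv ℝ u (x₀ + t • ξ) ξ / u (x₀ + t • ξ))
        + D3 u (x₀ + t • ξ) ξ ζ ζ / D2 u (x₀ + t • ξ) ζ ζ
        + a * ∑ k, fderiv ℝ u (x₀ + t • ξ) (e k) * D2 u (x₀ + t • ξ) ξ (e k)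
        + A * inner ℝ (x₀ + t • ξ - y) ξ) t := by
    filter_upwards [ev] with t ht
    obtain ⟨ht1, ht2, ht3⟩ := ht
    have k1 := ((d0 t ht1).fun_neg.log (by linarith : -u (x₀ + t • ξ) ≠ 0)).const_mul β
    have k2 := (d2 t ζ ζ ht1).log ht3.ne'
    have k3 := (HasDerivAt.fun_sum fun k (_ : k ∈ Finset.univ) =>
      (d1 t (e k) ht1).fun_pow 2).const_mul (a / 2)
    have k4 := ((dy t).norm_sq).const_mul (A / 2)
    convert! ((k1.add k2).add k3).add k4 using 1
    rw [neg_div_neg_eq]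
    congr 1
    · congr 1
      simp only [Finset.mul_sum]
      exact Finset.sum_congr rfl fun k _ => by norm_num; ring
    · ring
  have ht0 := ev.self_of_nhds
  simp only [e0] at ht0
  have hx' : x₀ + (0 : ℝ) • ξ ∈ Ω := by rwa [e0]
  have h2 : HasDerivAt (fun t : ℝ => β * (fderiv ℝ u (x₀ + t • ξ) ξ / u (x₀ + t • ξ))
        + D3 u (x₀ + t • ξ) ξ ζ ζ / D2 u (x₀ + t • ξ) ζ ζ
        + a * ∑ k, fderiv ℝ u (x₀ + t • ξ) (e k) * D2 u (x₀ + t • ξ) ξ (e k)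
        + A * inner ℝ (x₀ + t • ξ - y) ξ)
      (β * (D2 u x₀ ξ ξ / u x₀ - fderiv ℝ u x₀ ξ ^ 2 / u x₀ ^ 2)
      + (D4 u x₀ ξ ξ ζ ζ / D2 u x₀ ζ ζ - (D3 u x₀ ξ ζ ζ / D2 u x₀ ζ ζ) ^ 2)
      + a * ∑ k, (D2 u x₀ ξ (e k) ^ 2 + fderiv ℝ u x₀ (e k) * D3 u x₀ ξ ξ (e k)) + A) 0 := by
    have k1 := ((d1 0 ξ hx').fun_div (d0 0 hx') (by rw [e0]; exact hu0.ne)).const_mul β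
    have k2 := (d3 0 ζ ζ hx').fun_div (d2 0 ζ ζ hx') (by rw [e0]; exact hL.ne')
    have k3 := (HasDerivAt.fun_sum fun k (_ : k ∈ Finset.univ) =>
      (d1 0 (e k) hx').fun_mul (d2 0 ξ (e k) hx')).const_mul a
    have k4 := ((dy 0).inner ℝ (hasDerivAt_const 0 ξ)).const_mul A
    convert! ((k1.add k2).add k3).add k4 using 1
    simp only [e0, inner_zero_right, zero_add, real_inner_self_eq_norm_sq, hξ]
    congr 2
    · congr 1
      · have := hu0.ne
        field_simp
      · have := hL.ne'
        field_simp
    · congr 1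
      exact Finset.sum_congr rfl fun k _ => by ring
    · ring
  have hm : IsLocalMax (fun s : ℝ => β * Real.log (-u (x₀ + s • ξ))
      + Real.log (D2 u (x₀ + s • ξ) ζ ζ) + a / 2 * ∑ k, fderiv ℝ u (x₀ + s • ξ) (e k) ^ 2
      + A / 2 * ‖x₀ + s • ξ - y‖ ^ 2) 0 := by
    filter_upwards [tl.eventually hmax] with t ht
    simpa only [e0] using ht
  have h3 := deriv_eq_zero_and_le_zero_of_isLocalMax h1 h2 hm
  simpa only [e0] using h3

end TestFunction

/-! ### Eigenframes of the Hessian and the sign of the solution. -/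

section Eigenbasis

variable {n : ℕ} {Ω : Set (EuclideanSpace ℝ (Fin n))} {u : EuclideanSpace ℝ (Fin n) → ℝ}
  {x : EuclideanSpace ℝ (Fin n)}

lemma exists_eigenbasis (hΩ : IsOpen Ω) (hu : ContDiffOn ℝ 4 u Ω) (hx : x ∈ Ω) :
    ∃ b : OrthonormalBasis (Fin n) ℝ (EuclideanSpace ℝ (Fin n)),
      ∀ v k, D2 u x v (b k) = hessEigenvalues u x k * inner ℝ v (b k) := by
  have hH : ∀ i j, hess u x i j
      = D2 u x (EuclideanSpace.single i 1) (EuclideanSpace.single j 1) := fun i j => by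
    simp [hess, iteratedFDeriv_two_apply, D2]
  have hherm : (hess u x).IsHermitian := by
    ext i j
    simp only [Matrix.conjTranspose_apply, star_trivial]
    rw [hH, hH, D2_symm hΩ hu hx]
  refine ⟨hherm.eigenvectorBasis, fun v k => ?_⟩
  have hev : hessEigenvalues u x = hherm.eigenvalues := dif_pos hherm
  have hsum : ∀ w : EuclideanSpace ℝ (Fin n), w = ∑ i, w i • EuclideanSpace.single i (1 : ℝ) :=
    fun w => by
      ext j
      simp [Finset.sum_apply, Pi.single_apply]
  have hmul := hherm.mulVec_eigenvectorBasis k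
  set f := hherm.eigenvectorBasis k
  have h1 : ∀ i, D2 u x (EuclideanSpace.single i 1) f = hherm.eigenvalues k * f i := fun i => by
    have h2 := congrFun hmul i
    simp only [Matrix.mulVec, dotProduct, Pi.smul_apply, smul_eq_mul] at h2
    rw [← h2]
    conv_lhs => rw [hsum f, map_sum]
    exact Finset.sum_congr rfl fun j _ => by rw [map_smul, hH, smul_eq_mul, mul_comm]
  conv_lhs => rw [hsum v, map_sum]
  rw [sum_apply, hev, PiLp.inner_apply, Finset.mul_sum]
  refine Finset.sum_congr rfl fun i _ => ?_
  rw [map_smul, smul_apply, h1]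
  simp only [smul_eq_mul, RCLike.inner_apply, conj_trivial]
  ring

lemma D2_eq_sum {b : OrthonormalBasis (Fin n) ℝ (EuclideanSpace ℝ (Fin n))} {μ : Fin n → ℝ}
    (hb : ∀ v k, D2 u x v (b k) = μ k * inner ℝ v (b k)) (v w : EuclideanSpace ℝ (Fin n)) :
    D2 u x v w = ∑ k, μ k * (inner ℝ v (b k) * inner ℝ (b k) w) := by
  conv_lhs => rw [← b.sum_repr' w, map_sum]
  refine Finset.sum_congr rfl fun k _ => ?_
  rw [map_smul, hb, smul_eq_mul]
  ring

/-- The matrix has entries `⟨v i, b k⟩²`; its row and column sums are Parseval's identity in the two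
bases. -/
lemma exists_doublyStochastic {b : OrthonormalBasis (Fin n) ℝ (EuclideanSpace ℝ (Fin n))}
    {μ : Fin n → ℝ} (hb : ∀ v k, D2 u x v (b k) = μ k * inner ℝ v (b k))
    {v : Fin n → EuclideanSpace ℝ (Fin n)} (hv : Orthonormal ℝ v) :
    ∃ P ∈ doublyStochastic ℝ (Fin n), ∀ i, D2 u x (v i) (v i) = P.mulVec μ i := by
  rcases isEmpty_or_nonempty (Fin n) with h | h
  · exact ⟨1, one_mem _, fun i => h.elim i⟩
  let b' := (basisOfOrthonormalOfCardEqFinrank hv (by simp)).toOrthonormalBasis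
    (by simpa using hv)
  have hb' : ∀ i, b' i = v i := fun i => by simp [b']
  refine ⟨fun i k => inner ℝ (v i) (b k) ^ 2, mem_doublyStochastic_iff_sum.2
    ⟨fun i j => sq_nonneg _, fun i => ?_, fun k => ?_⟩, fun i => ?_⟩
  · have h1 := b.sum_sq_norm_inner_left (v i)
    simpa [hv.1 i] using h1
  · have h1 := b'.sum_sq_norm_inner_right (b k)
    simpa [hb'] using h1
  · rw [D2_eq_sum hb]
    refine Finset.sum_congr rfl fun k _ => ?_
    rw [real_inner_comm (v i) (b k)]
    ring

lemma sum_eta (lam : Fin n → ℝ) : ∑ i, eta lam i = (n - 1) * ∑ i, lam i := by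
  simp only [eta_eq, Finset.sum_sub_distrib, Finset.sum_const, Finset.card_univ, Fintype.card_fin,
    nsmul_eq_mul]
  ring

lemma sum_pos_of_mem_coneGamma' (hn : 2 ≤ n) {lam : Fin n → ℝ} (h : lam ∈ coneGamma' n (n - 1)) :
    0 < ∑ i, lam i := by
  have h1 := h 1 le_rfl (by omega)
  rw [sigma_natCast, esym_one, sum_eta] at h1
  have hn' : (2 : ℝ) ≤ n := by exact_mod_cast hn
  exact (mul_pos_iff_of_pos_left (by linarith)).1 h1

/-- Since `σ_1(η) = (n - 1) Δu`, admissibility gives `Δu > 0`, which excludes interior local maxima.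
-/
lemma neg_of_isAdmissible (hn : 2 ≤ n) (hΩ : IsOpen Ω) (hb : Bornology.IsBounded Ω)
    (hu : ContDiffOn ℝ 4 u Ω) (huc : ContinuousOn u (closure Ω))
    (hadm : IsAdmissible (n - 1) Ω u) (hbd : ∀ x ∈ frontier Ω, u x = 0) :
    ∀ x ∈ Ω, u x < 0 := by
  have hnomax : ∀ z ∈ Ω, ¬ IsLocalMax u z := by
    intro z hz hmax
    obtain ⟨b, hb⟩ := exists_eigenbasis hΩ hu hz
    have h1 := sum_pos_of_mem_coneGamma' hn (hadm z hz)
    refine h1.not_ge (Finset.sum_nonpos fun k _ => ?_)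
    have h2 : ∀ᶠ t : ℝ in 𝓝 0, HasDerivAt (fun s : ℝ => u (z + s • b k))
        (fderiv ℝ u (z + t • b k) (b k)) t := by
      filter_upwards [eventually_line_mem hΩ hz (b k)] with t ht
      exact hasDerivAt_comp_line (F := ℝ) (differentiableAt_self hΩ hu ht)
    have h3 : HasDerivAt (fun t : ℝ => fderiv ℝ u (z + t • b k) (b k))
        (D2 u z (b k) (b k)) 0 := by
      simpa [D2] using (hasDerivAt_comp_line_zero (F := EuclideanSpace ℝ (Fin n) →L[ℝ] ℝ) (b k)
        (differentiableAt_fderiv hΩ hu hz)).clm_apply (hasDerivAt_const 0 (b k))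
    have h4 : IsLocalMax (fun s : ℝ => u (z + s • b k)) 0 := by
      have tl : Tendsto (fun s : ℝ => z + s • b k) (𝓝 0) (𝓝 z) := by
        simpa [ContinuousAt] using (hasDerivAt_line z (b k) 0).continuousAt
      filter_upwards [tl.eventually hmax] with t ht
      simpa using ht
    have h5 := (deriv_eq_zero_and_le_zero_of_isLocalMax h2 h3 h4).2
    rw [hb] at h5
    simpa using h5
  intro x hx
  by_contra hcon
  push Not at hcon
  obtain ⟨z, hz, hzmax⟩ := hb.isCompact_closure.exists_isMaxOn ⟨x, subset_closure hx⟩ huc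
  have hloc : ∀ y ∈ Ω, u z ≤ u y → IsLocalMax u y := fun y hy hzy => by
    filter_upwards [hΩ.mem_nhds hy] with y' hy'
    exact (hzmax (subset_closure hy')).trans hzy
  by_cases hzΩ : z ∈ Ω
  · exact hnomax z hzΩ (hloc z hzΩ le_rfl)
  · have h0 : u z = 0 := hbd z (by rw [hΩ.frontier_eq]; exact ⟨hz, hzΩ⟩)
    exact hnomax x hx (hloc x hx (by rw [h0]; exact hcon))

/-- A positive trace prevents any eigenvalue from being more negative than `-n` times the largest
one. -/
lemma norm_iteratedFDeriv_two_le {b : OrthonormalBasis (Fin n) ℝ (EuclideanSpace ℝ (Fin n))}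
    {μ : Fin n → ℝ} (hb : ∀ v k, D2 u x v (b k) = μ k * inner ℝ v (b k)) {i₀ : Fin n}
    (hi₀ : ∀ i, μ i ≤ μ i₀) (hsum : 0 < ∑ i, μ i) :
    ‖iteratedFDeriv ℝ 2 u x‖ ≤ n ^ 2 * μ i₀ := by
  have hn : (1 : ℝ) ≤ n := by exact_mod_cast i₀.pos
  have hcard : ∑ _i : Fin n, μ i₀ = n * μ i₀ := by simp
  have hpos : 0 < μ i₀ := by
    have h1 : ∑ i, μ i ≤ n * μ i₀ := hcard ▸ Finset.sum_le_sum fun i _ => hi₀ i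
    by_contra hcon
    push Not at hcon
    nlinarith
  have habs : ∀ k, |μ k| ≤ n * μ i₀ := fun k => by
    refine abs_le.2 ⟨?_, (hi₀ k).trans (by nlinarith)⟩
    have h1 := Finset.add_sum_erase Finset.univ μ (Finset.mem_univ k)
    have h2 : ∑ i ∈ Finset.univ.erase k, μ i ≤ n * μ i₀ := by
      calc ∑ i ∈ Finset.univ.erase k, μ i ≤ ∑ i ∈ Finset.univ.erase k, μ i₀ :=
            Finset.sum_le_sum fun i _ => hi₀ i
        _ ≤ ∑ _i : Fin n, μ i₀ :=
            Finset.sum_le_sum_of_subset_of_nonneg (Finset.erase_subset _ _) fun _ _ _ => hpos.le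
        _ = n * μ i₀ := hcard
    linarith
  refine ContinuousMultilinearMap.opNorm_le_bound (by positivity) fun m => ?_
  rw [iteratedFDeriv_two_apply, Fin.prod_univ_two]
  change ‖D2 u x (m 0) (m 1)‖ ≤ _
  rw [D2_eq_sum hb]
  have hin : ∀ (v : EuclideanSpace ℝ (Fin n)) k, |inner ℝ v (b k)| ≤ ‖v‖ := fun v k => by
    simpa using abs_real_inner_le_norm v (b k)
  calc ‖∑ k, μ k * (inner ℝ (m 0) (b k) * inner ℝ (b k) (m 1))‖
      ≤ ∑ k, |μ k * (inner ℝ (m 0) (b k) * inner ℝ (b k) (m 1))| := norm_sum_le _ _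
    _ ≤ ∑ _k : Fin n, n * μ i₀ * (‖m 0‖ * ‖m 1‖) := by
      refine Finset.sum_le_sum fun k _ => ?_
      rw [abs_mul, abs_mul]
      have h1 := hin (m 0) k
      have h2 := hin (m 1) k
      rw [real_inner_comm] at h2
      have := habs k
      gcongr
    _ = n ^ 2 * μ i₀ * (‖m 0‖ * ‖m 1‖) := by
      simp only [Finset.sum_const, Finset.card_univ, Fintype.card_fin, nsmul_eq_mul]
      ring

lemma gradient_eq_sum (b : OrthonormalBasis (Fin n) ℝ (EuclideanSpace ℝ (Fin n)))
    (x : EuclideanSpace ℝ (Fin n)) : gradient u x = ∑ k, fderiv ℝ u x (b k) • b k := by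
  conv_lhs => rw [← b.sum_repr' (gradient u x)]
  exact Finset.sum_congr rfl fun k _ => by rw [real_inner_comm, inner_gradient_left]

lemma sum_fderiv_sq (b : OrthonormalBasis (Fin n) ℝ (EuclideanSpace ℝ (Fin n)))
    (x : EuclideanSpace ℝ (Fin n)) : ∑ k, fderiv ℝ u x (b k) ^ 2 = ‖gradient u x‖ ^ 2 := by
  have h := b.sum_sq_norm_inner_left (gradient u x)
  simpa [inner_gradient_left] using h

end Eigenbasis

/-! ### Differentiating the right-hand side. -/

section RightHandSide

variable {n : ℕ} {Ω : Set (EuclideanSpace ℝ (Fin n))} {u : EuclideanSpace ℝ (Fin n) → ℝ}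
  {f : EuclideanSpace ℝ (Fin n) × ℝ × EuclideanSpace ℝ (Fin n) → ℝ}

/-- The first and second derivatives of `log f(x, u, Du)` along a line. -/
lemma exists_derivs_log_comp (hΩ : IsOpen Ω) (hu : ContDiffOn ℝ 4 u Ω)
    (hf : ContDiffOn ℝ 2 f (Ω ×ˢ Set.univ)) (hpos : ∀ x ∈ Ω, ∀ z p, 0 < f (x, z, p))
    {x₀ : EuclideanSpace ℝ (Fin n)} (hx : x₀ ∈ Ω)
    (b : OrthonormalBasis (Fin n) ℝ (EuclideanSpace ℝ (Fin n))) (ξ : EuclideanSpace ℝ (Fin n)) :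
    ∃ (φ' : ℝ → ℝ) (φ'' : ℝ), (∀ᶠ t in 𝓝 0, HasDerivAt (fun t : ℝ => Real.log (f
        (x₀ + t • ξ, u (x₀ + t • ξ), gradient u (x₀ + t • ξ)))) (φ' t) t) ∧
      HasDerivAt φ' φ'' 0 ∧
      φ' 0 = fderiv ℝ f (x₀, u x₀, gradient u x₀)
        (ξ, fderiv ℝ u x₀ ξ, ∑ k, D2 u x₀ ξ (b k) • b k) / f (x₀, u x₀, gradient u x₀) ∧
      φ'' = (fderiv ℝ (fderiv ℝ f) (x₀, u x₀, gradient u x₀)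
            (ξ, fderiv ℝ u x₀ ξ, ∑ k, D2 u x₀ ξ (b k) • b k)
            (ξ, fderiv ℝ u x₀ ξ, ∑ k, D2 u x₀ ξ (b k) • b k)
          + fderiv ℝ f (x₀, u x₀, gradient u x₀) (0, D2 u x₀ ξ ξ, ∑ k, D3 u x₀ ξ ξ (b k) • b k))
            / f (x₀, u x₀, gradient u x₀) - φ' 0 ^ 2 := by
  set Y : EuclideanSpace ℝ (Fin n) → EuclideanSpace ℝ (Fin n) × ℝ × EuclideanSpace ℝ (Fin n) :=
    fun x => (x, u x, gradient u x) with hY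
  set Z : ℝ → EuclideanSpace ℝ (Fin n) × ℝ × EuclideanSpace ℝ (Fin n) := fun t =>
    (ξ, fderiv ℝ u (x₀ + t • ξ) ξ, ∑ k, D2 u (x₀ + t • ξ) ξ (b k) • b k) with hZ
  have hO : IsOpen (Ω ×ˢ (Set.univ : Set (ℝ × EuclideanSpace ℝ (Fin n)))) := hΩ.prod isOpen_univ
  have hfc : ∀ x ∈ Ω, ContDiffAt ℝ 2 f (Y x) := fun x hx =>
    hf.contDiffAt (hO.mem_nhds ⟨hx, Set.mem_univ _⟩)
  have hf1 : ∀ x ∈ Ω, DifferentiableAt ℝ f (Y x) := fun x hx =>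
    (hfc x hx).differentiableAt (by norm_num)
  have hf2 : ∀ x ∈ Ω, DifferentiableAt ℝ (fderiv ℝ f) (Y x) := fun x hx =>
    ((hfc x hx).fderiv_right (m := 1) (by norm_num)).differentiableAt (by norm_num)
  have d0 : ∀ t : ℝ, x₀ + t • ξ ∈ Ω → HasDerivAt (fun s : ℝ => u (x₀ + s • ξ))
      (fderiv ℝ u (x₀ + t • ξ) ξ) t := fun t ht =>
    hasDerivAt_comp_line (F := ℝ) (differentiableAt_self hΩ hu ht)
  have d1 : ∀ (t : ℝ) (η : EuclideanSpace ℝ (Fin n)), x₀ + t • ξ ∈ Ω →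
      HasDerivAt (fun s : ℝ => fderiv ℝ u (x₀ + s • ξ) η) (D2 u (x₀ + t • ξ) ξ η) t :=
    fun t η ht => by
      simpa [D2] using (hasDerivAt_comp_line (F := EuclideanSpace ℝ (Fin n) →L[ℝ] ℝ)
        (differentiableAt_fderiv hΩ hu ht)).clm_apply (hasDerivAt_const t η)
  have d2 : ∀ (t : ℝ) (η η' : EuclideanSpace ℝ (Fin n)), x₀ + t • ξ ∈ Ω →
      HasDerivAt (fun s : ℝ => D2 u (x₀ + s • ξ) η η') (D3 u (x₀ + t • ξ) ξ η η') t :=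
    fun t η η' ht => by
      simpa [D3] using ((hasDerivAt_comp_line
        (F := EuclideanSpace ℝ (Fin n) →L[ℝ] EuclideanSpace ℝ (Fin n) →L[ℝ] ℝ)
        (differentiableAt_D2 hΩ hu ht)).clm_apply (hasDerivAt_const t η)).clm_apply
        (hasDerivAt_const t η')
  have dY : ∀ t : ℝ, x₀ + t • ξ ∈ Ω → HasDerivAt (fun s : ℝ => Y (x₀ + s • ξ)) (Z t) t := by
    intro t ht
    have h1 : HasDerivAt (fun s : ℝ => ∑ k, fderiv ℝ u (x₀ + s • ξ) (b k) • b k)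
        (∑ k, D2 u (x₀ + t • ξ) ξ (b k) • b k) t :=
      HasDerivAt.fun_sum fun k _ => (d1 t (b k) ht).smul_const (b k)
    simp only [hY, gradient_eq_sum b]
    exact (hasDerivAt_line x₀ ξ t).prodMk ((d0 t ht).prodMk h1)
  have hx' : x₀ + (0 : ℝ) • ξ ∈ Ω := by simpa using hx
  have dZ : HasDerivAt Z (0, D2 u x₀ ξ ξ, ∑ k, D3 u x₀ ξ ξ (b k) • b k) 0 := by
    have h1 : HasDerivAt (fun s : ℝ => ∑ k, D2 u (x₀ + s • ξ) ξ (b k) • b k)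
        (∑ k, D3 u (x₀ + (0 : ℝ) • ξ) ξ ξ (b k) • b k) 0 :=
      HasDerivAt.fun_sum fun k _ => (d2 0 ξ (b k) hx').smul_const (b k)
    have h2 := (hasDerivAt_const (0 : ℝ) ξ).prodMk ((d1 0 ξ hx').prodMk h1)
    simpa only [zero_smul, add_zero] using h2
  have dF : ∀ t : ℝ, x₀ + t • ξ ∈ Ω → HasDerivAt (fun s : ℝ => f (Y (x₀ + s • ξ)))
      (fderiv ℝ f (Y (x₀ + t • ξ)) (Z t)) t := fun t ht =>
    (hf1 _ ht).hasFDerivAt.comp_hasDerivAt t (dY t ht)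
  have dF' : HasDerivAt (fun t : ℝ => fderiv ℝ f (Y (x₀ + t • ξ)) (Z t))
      (fderiv ℝ (fderiv ℝ f) (Y x₀) (Z 0) (Z 0)
        + fderiv ℝ f (Y x₀) (0, D2 u x₀ ξ ξ, ∑ k, D3 u x₀ ξ ξ (b k) • b k)) 0 := by
    have h1 : HasDerivAt (fun t : ℝ => fderiv ℝ f (Y (x₀ + t • ξ)))
        (fderiv ℝ (fderiv ℝ f) (Y (x₀ + (0 : ℝ) • ξ)) (Z 0)) 0 :=
      (hf2 _ hx').hasFDerivAt.comp_hasDerivAt (0 : ℝ) (dY 0 hx')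
    have h2 := h1.clm_apply dZ
    simpa only [zero_smul, add_zero] using h2
  have hZ0 : Z 0 = (ξ, fderiv ℝ u x₀ ξ, ∑ k, D2 u x₀ ξ (b k) • b k) := by
    simp only [hZ, zero_smul, add_zero]
  have hne : f (Y (x₀ + (0 : ℝ) • ξ)) ≠ 0 := (hpos _ hx' _ _).ne'
  refine ⟨fun t => fderiv ℝ f (Y (x₀ + t • ξ)) (Z t) / f (Y (x₀ + t • ξ)), _, ?_,
    dF'.fun_div (dF 0 hx') hne, ?_, ?_⟩
  · filter_upwards [eventually_line_mem hΩ hx ξ] with t ht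
    exact (dF t ht).log (hpos _ ht _ _).ne'
  · simp only [hZ0, zero_smul, add_zero, hY]
  · have hne' : f (x₀, u x₀, gradient u x₀) ≠ 0 := (hpos _ hx _ _).ne'
    simp only [hZ0, zero_smul, add_zero, hY]
    field_simp

end RightHandSide

/-! ### From the differential equation to the relations at a maximum point. -/

section MaximumPoint

variable {n : ℕ} {Ω : Set (EuclideanSpace ℝ (Fin n))} {u : EuclideanSpace ℝ (Fin n) → ℝ}
  {f : EuclideanSpace ℝ (Fin n) × ℝ × EuclideanSpace ℝ (Fin n) → ℝ}

/-- A lower bound for the second derivative of `log f(x, u, Du)` in the top eigendirection: `x`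
comes from the second derivative of `f`, `y` from its derivative in `u`, `z` is the first
logarithmic derivative, and `t` carries the third derivatives of `u`, which must be kept exactly. -/
lemma neg_add_le_of_abs_le {s K L x y z : ℝ} (hs : 0 ≤ s) (hK : 0 ≤ K) (hL : 0 ≤ L)
    (hx : |x| ≤ s * ((1 + K) * (1 + L)) ^ 2) (hy : |y| ≤ s) (hz : |z| ≤ s * ((1 + K) * (1 + L)))
    (t : ℝ) : -((2 * s + s ^ 2) * (1 + K) ^ 2 * (1 + L) ^ 2) + t ≤ x + (L * y + t) - z ^ 2 := by
  have h1 : z ^ 2 ≤ (s * ((1 + K) * (1 + L))) ^ 2 := by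
    rw [← sq_abs]
    gcongr
  have h2 : -(s * L) ≤ L * y := by
    have := mul_le_mul_of_nonneg_left (abs_le.1 hy).1 hL
    linarith
  have h3 : L ≤ ((1 + K) * (1 + L)) ^ 2 := by
    have h4 : L ≤ (1 + L) ^ 2 := by nlinarith
    have h5 : (1 : ℝ) ≤ (1 + K) ^ 2 := one_le_pow₀ (by linarith)
    rw [mul_pow]
    nlinarith [sq_nonneg (1 + L)]
  have h6 := mul_le_mul_of_nonneg_left h3 hs
  have h7 := (abs_le.1 hx).1
  linarith [mul_pow (1 + K) (1 + L) 2, mul_pow s ((1 + K) * (1 + L)) 2]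

set_option maxHeartbeats 800000 in
theorem isMaxRelation_of_isLocalMax (hΩ : IsOpen Ω) (hu : ContDiffOn ℝ 4 u Ω)
    (hf : ContDiffOn ℝ 2 f (Ω ×ˢ Set.univ)) (hpos : ∀ x ∈ Ω, ∀ z p, 0 < f (x, z, p))
    {x₀ y : EuclideanSpace ℝ (Fin n)} (hx : x₀ ∈ Ω) {K d m Λ : ℝ} (hm : 0 < m)
    (hu0 : u x₀ < 0) (huK : |u x₀| ≤ K) (hgK : ‖gradient u x₀‖ ≤ K) (hy : ‖x₀ - y‖ ≤ d)
    (hfm : m ≤ f (x₀, u x₀, gradient u x₀))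
    (hf1 : ‖fderiv ℝ f (x₀, u x₀, gradient u x₀)‖ ≤ Λ)
    (hf2 : ∀ v, |fderiv ℝ (fderiv ℝ f) (x₀, u x₀, gradient u x₀) v v| ≤ Λ * ‖v‖ ^ 2)
    {b : OrthonormalBasis (Fin n) ℝ (EuclideanSpace ℝ (Fin n))} {lam : Fin n → ℝ}
    (hb : ∀ v k, D2 u x₀ v (b k) = lam k * inner ℝ v (b k)) {i₀ : Fin n} (hL : 0 < lam i₀)
    {l : ℕ} {α c c' L₀ : ℝ} {G : Fin n → ℝ} (hG : IsLinearization l α c c' L₀ lam i₀ G)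
    (hdom : ∀ x ∈ Ω, ∀ v : Fin n → EuclideanSpace ℝ (Fin n), Orthonormal ℝ v →
      Real.log (f (x, u x, gradient u x)) ≤ Real.log (f (x₀, u x₀, gradient u x₀))
        + ∑ i, G i * (D2 u x (v i) (v i) - lam i))
    {a A β : ℝ} (hmax : IsLocalMax (fun x => β * Real.log (-u x)
      + Real.log (D2 u x (b i₀) (b i₀)) + a / 2 * ‖gradient u x‖ ^ 2 + A / 2 * ‖x - y‖ ^ 2) x₀) :
    IsMaxRelation K d ((2 * (Λ / m) + (Λ / m) ^ 2) * (1 + K) ^ 2) c c' L₀ a A β i₀ (-u x₀) lam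
      (fun k => fderiv ℝ u x₀ (b k)) (fun k => inner ℝ (x₀ - y) (b k))
      (fun k => D3 u x₀ (b k) (b i₀) (b i₀) / lam i₀)
      (fun k => fderiv ℝ f (x₀, u x₀, gradient u x₀) (b k, fderiv ℝ u x₀ (b k), 0)
        / f (x₀, u x₀, gradient u x₀))
      (fun k => fderiv ℝ f (x₀, u x₀, gradient u x₀) (0, 0, b k) / f (x₀, u x₀, gradient u x₀))
      (fun i => D4 u x₀ (b i) (b i) (b i₀) (b i₀)) G
      (fun k i => D3 u x₀ (b k) (b i) (b i)) := by
  set Y₀ := (x₀, u x₀, gradient u x₀) with hY₀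
  set Df := fderiv ℝ f Y₀ with hDf
  set s := Λ / m with hs
  have hK : 0 ≤ K := (norm_nonneg _).trans hgK
  have hΛ : 0 ≤ Λ := (norm_nonneg _).trans hf1
  have hs0 : 0 ≤ s := by positivity
  have hf0 : 0 < f Y₀ := hm.trans_le hfm
  have hortho := b.orthonormal
  have hb1 : ∀ k, ‖b k‖ = 1 := hortho.1
  have hlam : ∀ i j, D2 u x₀ (b i) (b j) = if i = j then lam i else 0 := fun i j => by
    rw [hb, orthonormal_iff_ite.1 hortho]
    split_ifs with h
    · rw [h, mul_one]
    · rw [mul_zero]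
  have hlam0 : D2 u x₀ (b i₀) (b i₀) = lam i₀ := by rw [hlam, if_pos rfl]
  have hp : ∀ k, |fderiv ℝ u x₀ (b k)| ≤ K := fun k => by
    rw [← inner_gradient_left]
    refine (abs_real_inner_le_norm _ _).trans ?_
    rwa [hb1, mul_one]
  have hdiv : ∀ v {r : ℝ}, ‖v‖ ≤ r → |Df v / f Y₀| ≤ s * r := fun v r hr => by
    rw [abs_div, abs_of_pos hf0, hs, div_mul_eq_mul_div]
    have h1 : |Df v| ≤ Λ * r := (Df.le_opNorm v).trans
      (mul_le_mul hf1 hr (norm_nonneg _) hΛ)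
    exact div_le_div₀ (mul_nonneg hΛ ((norm_nonneg _).trans hr)) h1 hm hfm
  have hsum : ∀ ξ k, ξ = b k → ∑ j, D2 u x₀ ξ (b j) • b j = lam k • b k := fun ξ k h => by
    subst h
    simp [hlam]
  have hgrad : ∀ x, ‖gradient u x‖ ^ 2 = ∑ k, fderiv ℝ u x (b k) ^ 2 := fun x =>
    (sum_fderiv_sq b x).symm
  simp only [hgrad] at hmax
  have hderivs := fun k => derivs_of_isLocalMax hΩ hu hx (e := b) hu0 (by rwa [hlam0]) hmax
    (b k) (hb1 k)
  simp only [hlam0] at hderivs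
  have hsq : (1 : ℝ) ≤ (1 + K) ^ 2 := one_le_pow₀ (by linarith)
  have hC : s * (1 + K) ≤ (2 * s + s ^ 2) * (1 + K) ^ 2 := by
    calc s * (1 + K) ≤ (2 * s + s ^ 2) * (1 + K) := by
          gcongr
          nlinarith
      _ ≤ (2 * s + s ^ 2) * (1 + K) ^ 2 := by
          gcongr
          nlinarith
  refine
    { w_pos := by linarith
      w_le := (neg_le_abs _).trans huK
      p_le := hp
      y_le := fun k => ?_
      X_le := fun k => (hdiv _ ?_).trans hC
      b_le := fun k => (hdiv _ ?_).trans hC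
      lam_pos := hL
      G_nonneg := hG.nonneg
      G_min := hG.min
      sum_le := hG.sum_le
      le_sum := hG.le_sum
      sum_mul_le := hG.sum_mul_le
      mul_le_sum := hG.mul_le_sum
      first_order := fun k => ?_
      second_order := fun k => ?_
      linearized := fun k => ?_
      concavity := fun θ => ?_ }
  · refine (abs_real_inner_le_norm _ _).trans ?_
    rwa [hb1, mul_one]
  · simp only [Prod.norm_mk, hb1, norm_zero]
    refine max_le (by linarith) (max_le ?_ (by linarith))
    exact (hp k).trans (by linarith)
  · simp only [Prod.norm_mk, hb1, norm_zero]
    exact max_le (by linarith) (max_le (by linarith) (by linarith))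
  · have h1 := (hderivs k).1
    have h2 : ∑ j, fderiv ℝ u x₀ (b j) * D2 u x₀ (b k) (b j) = fderiv ℝ u x₀ (b k) * lam k := by
      simp [hlam]
    rw [h2] at h1
    rw [div_neg, mul_div_assoc]
    linarith
  · have h1 := (hderivs k).2
    have h2 : ∑ j, (D2 u x₀ (b k) (b j) ^ 2 + fderiv ℝ u x₀ (b j) * D3 u x₀ (b k) (b k) (b j))
        = lam k ^ 2 + ∑ j, fderiv ℝ u x₀ (b j) * D3 u x₀ (b j) (b k) (b k) := by
      rw [Finset.sum_add_distrib]
      congr 1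
      · simp [hlam]
      · refine Finset.sum_congr rfl fun j _ => ?_
        rw [D3_symm_right hΩ hu hx (b k) (b k) (b j), D3_symm_left hΩ hu hx (b k) (b j)]
    rw [h2, hlam, if_pos rfl] at h1
    have e : -(β * (lam k / -u x₀ + fderiv ℝ u x₀ (b k) ^ 2 / (-u x₀) ^ 2))
        = β * (lam k / u x₀ - fderiv ℝ u x₀ (b k) ^ 2 / u x₀ ^ 2) := by
      rw [div_neg, neg_sq]
      ring
    rw [e]
    linarith
  -- The linearized equation is the first-order condition with a fixed frame, that is, with
  -- generator `0`.
  · obtain ⟨φ', φ'', h1, h2, h3, -⟩ := exists_derivs_log_comp hΩ hu hf hpos hx b (b k)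
    have h4 := (deriv_of_dominated (φ := fun x => Real.log (f (x, u x, gradient u x))) hΩ hu hx
      hortho (fun i => by rw [hlam, if_pos rfl]) hdom (A := 0) (by simp) h1 h2).1
    rw [h3, hsum _ k rfl, ← hY₀, ← hDf] at h4
    have e : (b k, fderiv ℝ u x₀ (b k), lam k • b k)
        = (b k, fderiv ℝ u x₀ (b k), (0 : EuclideanSpace ℝ (Fin n)))
          + lam k • ((0 : EuclideanSpace ℝ (Fin n)), (0 : ℝ), b k) := by
      simp
    rw [e, map_add, map_smul, smul_eq_mul] at h4
    simp only [zero_apply, map_zero, mul_zero, add_zero] at h4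
    rw [← h4]
    ring
  · obtain ⟨φ', φ'', h1, h2, h3, h4⟩ := exists_derivs_log_comp hΩ hu hf hpos hx b (b i₀)
    have h5 := second_deriv_le_of_dominated (φ := fun x => Real.log (f (x, u x, gradient u x)))
      hΩ hu hx hortho hlam hdom h1 h2 i₀ θ
    have hsymm : ∀ i, D3 u x₀ (b i₀) (b i) (b i₀)
        = lam i₀ * (D3 u x₀ (b i) (b i₀) (b i₀) / lam i₀) := fun i => by
      rw [mul_div_cancel₀ _ hL.ne', D3_symm_left hΩ hu hx (b i₀) (b i)]
    have hsymm' : ∀ i, D3 u x₀ (b i₀) (b i₀) (b i)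
        = lam i₀ * (D3 u x₀ (b i) (b i₀) (b i₀) / lam i₀) := fun i => by
      rw [D3_symm_right hΩ hu hx (b i₀) (b i₀), hsymm]
    simp only [hsymm, D4_pair_symm hΩ hu hx (b i₀)] at h5
    refine le_trans ?_ h5
    rw [h4, h3, ← hY₀, ← hDf, hsum _ i₀ rfl, hlam0]
    set Z : EuclideanSpace ℝ (Fin n) × ℝ × EuclideanSpace ℝ (Fin n) :=
      (b i₀, fderiv ℝ u x₀ (b i₀), lam i₀ • b i₀) with hZ
    have hZn : ‖Z‖ ≤ (1 + K) * (1 + lam i₀) := by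
      have hKL : 0 ≤ K * lam i₀ := by positivity
      simp only [hZ, Prod.norm_mk, hb1, norm_smul, Real.norm_eq_abs, abs_of_pos hL, mul_one]
      refine max_le (by nlinarith) (max_le ((hp i₀).trans (by nlinarith)) (by nlinarith))
    have e : ((0 : EuclideanSpace ℝ (Fin n)), lam i₀, ∑ k, D3 u x₀ (b i₀) (b i₀) (b k) • b k)
        = lam i₀ • ((0 : EuclideanSpace ℝ (Fin n)), (1 : ℝ), (0 : EuclideanSpace ℝ (Fin n)))
          + ∑ k, D3 u x₀ (b i₀) (b i₀) (b k) •
            ((0 : EuclideanSpace ℝ (Fin n)), (0 : ℝ), b k) := by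
      refine Prod.ext ?_ (Prod.ext ?_ ?_) <;> simp [Prod.fst_sum, Prod.snd_sum]
    rw [e, map_add, map_smul, map_sum, smul_eq_mul]
    simp only [map_smul, hsymm', smul_eq_mul]
    have e2 : (∑ k, lam i₀ * (D3 u x₀ (b k) (b i₀) (b i₀) / lam i₀) * Df (0, 0, b k)) / f Y₀
        = lam i₀ * ∑ k, Df (0, 0, b k) / f Y₀ * (D3 u x₀ (b k) (b i₀) (b i₀) / lam i₀) := by
      rw [Finset.sum_div, Finset.mul_sum]
      exact Finset.sum_congr rfl fun k _ => by ring
    rw [add_div, add_div, e2, mul_div_assoc (lam i₀)]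
    have k1 : |fderiv ℝ (fderiv ℝ f) Y₀ Z Z / f Y₀| ≤ s * ((1 + K) * (1 + lam i₀)) ^ 2 := by
      rw [abs_div, abs_of_pos hf0, hs, div_mul_eq_mul_div]
      refine div_le_div₀ (by positivity) ((hf2 Z).trans ?_) hm hfm
      gcongr
    have k2 : |Df (0, 1, 0) / f Y₀| ≤ s * 1 := hdiv _ (by simp [Prod.norm_mk])
    exact neg_add_le_of_abs_le hs0 hK hL.le k1 (by linarith) (hdiv _ hZn) _

end MaximumPoint

/-! ### Existence of an interior maximum of the test function. -/

section InteriorMaximum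

variable {n : ℕ} {Ω : Set (EuclideanSpace ℝ (Fin n))} {u : EuclideanSpace ℝ (Fin n) → ℝ}

/-- The test function `(-u)^β u_{ξξ} exp((a/2) |Du|² + (A/2) |x - y|²)`. -/
noncomputable def testFunction (u : EuclideanSpace ℝ (Fin n) → ℝ) (a A β : ℝ)
    (y x ξ : EuclideanSpace ℝ (Fin n)) : ℝ :=
  (-u x) ^ β * D2 u x ξ ξ * Real.exp (a / 2 * ‖gradient u x‖ ^ 2 + A / 2 * ‖x - y‖ ^ 2)

lemma norm_gradient (x : EuclideanSpace ℝ (Fin n)) : ‖gradient u x‖ = ‖fderiv ℝ u x‖ :=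
  LinearIsometryEquiv.norm_map _ _

lemma exists_testFunction_max (hΩ : IsOpen Ω) (hb : Bornology.IsBounded Ω)
    (huC : IsCkClosure 2 Ω u) (hneg : ∀ x ∈ Ω, u x < 0) (hbd : ∀ x ∈ frontier Ω, u x = 0)
    {a A β : ℝ} (hβ : 0 < β) (y : EuclideanSpace ℝ (Fin n))
    (hpos : ∃ x ∈ Ω, ∃ ξ, ‖ξ‖ = 1 ∧ 0 < D2 u x ξ ξ) :
    ∃ x₀ ∈ Ω, ∃ ξ₀, ‖ξ₀‖ = 1 ∧ 0 < D2 u x₀ ξ₀ ξ₀ ∧ ∀ x ∈ Ω, ∀ ξ, ‖ξ‖ = 1 →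
      testFunction u a A β y x ξ ≤ testFunction u a A β y x₀ ξ₀ := by
  obtain ⟨-, huc, hext⟩ := huC
  obtain ⟨G₁, hG₁c, hG₁⟩ := hext 1 (by norm_num)
  obtain ⟨G₂, hG₂c, hG₂⟩ := hext 2 le_rfl
  set S : Set (EuclideanSpace ℝ (Fin n) × EuclideanSpace ℝ (Fin n)) :=
    closure Ω ×ˢ Metric.sphere 0 1 with hS
  -- The continuous extensions of the derivatives define the test function up to the boundary. There
  -- it vanishes, while it is positive somewhere inside.
  set Ψ : EuclideanSpace ℝ (Fin n) × EuclideanSpace ℝ (Fin n) → ℝ := fun q =>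
    (-u q.1) ^ β * G₂ q.1 ![q.2, q.2] * Real.exp (a / 2 * ‖G₁ q.1‖ ^ 2 + A / 2 * ‖q.1 - y‖ ^ 2)
    with hΨ
  have hΨeq : ∀ x ∈ Ω, ∀ ξ, Ψ (x, ξ) = testFunction u a A β y x ξ := fun x hx ξ => by
    simp only [hΨ, testFunction]
    rw [hG₁ hx, hG₂ hx, norm_iteratedFDeriv_one, norm_gradient, iteratedFDeriv_two_apply]
    rfl
  have hfst : Set.MapsTo Prod.fst S (closure Ω) := fun q hq => hq.1
  have hcont : ContinuousOn Ψ S := by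
    have c1 : ContinuousOn (fun q : EuclideanSpace ℝ (Fin n) × EuclideanSpace ℝ (Fin n) =>
        (-u q.1) ^ β) S :=
      ((huc.comp continuousOn_fst hfst).neg).rpow_const fun q _ => Or.inr hβ.le
    have c2 : ContinuousOn (fun q : EuclideanSpace ℝ (Fin n) × EuclideanSpace ℝ (Fin n) =>
        G₂ q.1 ![q.2, q.2]) S := by
      have h1 : ContinuousOn (fun q : EuclideanSpace ℝ (Fin n) × EuclideanSpace ℝ (Fin n) =>
        G₂ q.1) S := hG₂c.comp continuousOn_fst hfst
      have h2 : Continuous (fun q : EuclideanSpace ℝ (Fin n) × EuclideanSpace ℝ (Fin n) =>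
        (![q.2, q.2] : Fin 2 → EuclideanSpace ℝ (Fin n))) := by fun_prop
      exact h1.eval h2.continuousOn
    have c3 : ContinuousOn (fun q : EuclideanSpace ℝ (Fin n) × EuclideanSpace ℝ (Fin n) =>
        G₁ q.1) S := hG₁c.comp continuousOn_fst hfst
    have c4 : Continuous (fun q : EuclideanSpace ℝ (Fin n) × EuclideanSpace ℝ (Fin n) =>
        A / 2 * ‖q.1 - y‖ ^ 2) := by fun_prop
    exact (c1.mul c2).mul (((c3.norm.pow 2).const_mul (a / 2)).add c4.continuousOn).rexp
  obtain ⟨x₁, hx₁, ξ₁, hξ₁, hpos₁⟩ := hpos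
  have hmem : ∀ x ∈ Ω, ∀ ξ, ‖ξ‖ = 1 → (x, ξ) ∈ S := fun x hx ξ hξ =>
    ⟨subset_closure hx, by simpa using hξ⟩
  obtain ⟨⟨x₀, ξ₀⟩, h0, hmax⟩ := (hb.isCompact_closure.prod (isCompact_sphere 0 1)).exists_isMaxOn
    ⟨_, hmem x₁ hx₁ ξ₁ hξ₁⟩ hcont
  have hΨpos : 0 < Ψ (x₀, ξ₀) := by
    refine lt_of_lt_of_le ?_ (hmax (hmem x₁ hx₁ ξ₁ hξ₁))
    change 0 < Ψ (x₁, ξ₁)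
    rw [hΨeq x₁ hx₁]
    have := Real.rpow_pos_of_pos (neg_pos.2 (hneg x₁ hx₁)) β
    unfold testFunction
    positivity
  have hx₀ : x₀ ∈ Ω := by
    by_contra hcon
    have h1 : u x₀ = 0 := hbd x₀ (by rw [hΩ.frontier_eq]; exact ⟨h0.1, hcon⟩)
    simp [hΨ, h1, Real.zero_rpow hβ.ne'] at hΨpos
  have hξ₀ : ‖ξ₀‖ = 1 := by simpa using h0.2
  refine ⟨x₀, hx₀, ξ₀, hξ₀, ?_, fun x hx ξ hξ => ?_⟩
  · rw [hΨeq x₀ hx₀, testFunction] at hΨpos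
    have := Real.rpow_pos_of_pos (neg_pos.2 (hneg x₀ hx₀)) β
    exact (mul_pos_iff_of_pos_left this).1 ((mul_pos_iff_of_pos_right (Real.exp_pos _)).1 hΨpos)
  · rw [← hΨeq x hx, ← hΨeq x₀ hx₀]
    exact hmax (hmem x hx ξ hξ)

lemma isLocalMax_log_testFunction (hΩ : IsOpen Ω) (hu : ContDiffOn ℝ 4 u Ω)
    (hneg : ∀ x ∈ Ω, u x < 0) {a A β : ℝ} {y x₀ ξ : EuclideanSpace ℝ (Fin n)} (hx : x₀ ∈ Ω)
    (hL : 0 < D2 u x₀ ξ ξ)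
    (hmax : ∀ x ∈ Ω, testFunction u a A β y x ξ ≤ testFunction u a A β y x₀ ξ) :
    IsLocalMax (fun x => β * Real.log (-u x) + Real.log (D2 u x ξ ξ)
      + a / 2 * ‖gradient u x‖ ^ 2 + A / 2 * ‖x - y‖ ^ 2) x₀ := by
  have c2 : ContinuousAt (fun x => D2 u x ξ ξ) x₀ := by
    have := (contDiffAt_D2 hΩ hu hx).continuousAt
    fun_prop
  have hlog : ∀ x ∈ Ω, 0 < D2 u x ξ ξ → β * Real.log (-u x) + Real.log (D2 u x ξ ξ)
      + a / 2 * ‖gradient u x‖ ^ 2 + A / 2 * ‖x - y‖ ^ 2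
      = Real.log (testFunction u a A β y x ξ) ∧ 0 < testFunction u a A β y x ξ := by
    intro x hx hD
    have h1 := neg_pos.2 (hneg x hx)
    have h2 := Real.rpow_pos_of_pos h1 β
    refine ⟨?_, by unfold testFunction; positivity⟩
    rw [testFunction, Real.log_mul (by positivity) (Real.exp_pos _).ne',
      Real.log_mul h2.ne' hD.ne', Real.log_rpow h1, Real.log_exp]
    ring
  filter_upwards [hΩ.mem_nhds hx, c2.eventually (lt_mem_nhds hL)] with x hxΩ hD
  obtain ⟨h1, h2⟩ := hlog x hxΩ hD
  obtain ⟨h3, -⟩ := hlog x₀ hx hL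
  rw [h1, h3]
  exact Real.log_le_log h2 (hmax x hxΩ)

lemma D2_self_le {x : EuclideanSpace ℝ (Fin n)}
    {b : OrthonormalBasis (Fin n) ℝ (EuclideanSpace ℝ (Fin n))} {μ : Fin n → ℝ}
    (hb : ∀ v k, D2 u x v (b k) = μ k * inner ℝ v (b k)) {i₀ : Fin n} (hi₀ : ∀ i, μ i ≤ μ i₀)
    {ξ : EuclideanSpace ℝ (Fin n)} (hξ : ‖ξ‖ = 1) : D2 u x ξ ξ ≤ μ i₀ := by
  rw [D2_eq_sum hb]
  calc ∑ k, μ k * (inner ℝ ξ (b k) * inner ℝ (b k) ξ)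
      ≤ ∑ k, μ i₀ * (inner ℝ ξ (b k) * inner ℝ (b k) ξ) := by
        refine Finset.sum_le_sum fun k _ => ?_
        rw [real_inner_comm ξ (b k)]
        exact mul_le_mul_of_nonneg_right (hi₀ k) (mul_self_nonneg _)
    _ = μ i₀ := by
      rw [← Finset.mul_sum, b.sum_inner_mul_inner, real_inner_self_eq_norm_sq, hξ]
      ring

lemma exists_max_eigenvalue (hn : 2 ≤ n) {lam : Fin n → ℝ} (h : lam ∈ coneGamma' n (n - 1)) :
    ∃ i₀, (∀ i, lam i ≤ lam i₀) ∧ 0 < lam i₀ := by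
  have : Nonempty (Fin n) := ⟨⟨0, by omega⟩⟩
  obtain ⟨i₀, hi₀⟩ := Finite.exists_max lam
  refine ⟨i₀, hi₀, ?_⟩
  by_contra hcon
  push Not at hcon
  exact (sum_pos_of_mem_coneGamma' hn h).not_ge
    (Finset.sum_nonpos fun i _ => (hi₀ i).trans hcon)

lemma abs_fderiv_fderiv_le {E : Type*} [NormedAddCommGroup E] [NormedSpace ℝ E] {f : E → ℝ}
    {z : E} {Λ : ℝ} (h : ‖iteratedFDeriv ℝ 2 f z‖ ≤ Λ) (v : E) :
    |fderiv ℝ (fderiv ℝ f) z v v| ≤ Λ * ‖v‖ ^ 2 := by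
  have h1 := (iteratedFDeriv ℝ 2 f z).le_opNorm ![v, v]
  rw [iteratedFDeriv_two_apply, Fin.prod_univ_two] at h1
  simp only [Matrix.cons_val_zero, Matrix.cons_val_one, Real.norm_eq_abs] at h1
  refine h1.trans ?_
  rw [sq]
  gcongr

end InteriorMaximum

end SumHessian

/-! ### The interior estimate. -/

theorem theorem4 (n l : ℕ) (hl : l + 1 < n) (d m Λ K : ℝ) (hm : 0 < m) :
    ∃ β C : ℝ, 0 < β ∧ 0 < C ∧
      ∀ (α : ℝ) (Ω : Set (EuclideanSpace ℝ (Fin n)))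
        (f : EuclideanSpace ℝ (Fin n) × ℝ × EuclideanSpace ℝ (Fin n) → ℝ)
        (u : EuclideanSpace ℝ (Fin n) → ℝ),
        0 ≤ α →
        IsOpen Ω → IsConnected Ω → Bornology.IsBounded Ω → Metric.diam Ω ≤ d →
        SumHessian.IsCkClosure 2 (Ω ×ˢ Set.univ) f →
        (∀ x ∈ closure Ω, ∀ (z : ℝ) (p : EuclideanSpace ℝ (Fin n)), 0 < f (x, z, p)) →
        (∀ x ∈ Ω, ∀ (z : ℝ) (p : EuclideanSpace ℝ (Fin n)), |z| ≤ K → ‖p‖ ≤ K →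
          m ≤ f (x, z, p) ∧ ∀ j ≤ 2, ‖iteratedFDeriv ℝ j f (x, z, p)‖ ≤ Λ) →
        ContDiffOn ℝ 4 u Ω → SumHessian.IsCkClosure 2 Ω u →
        (∀ x ∈ Ω, |u x| ≤ K ∧ ‖gradient u x‖ ≤ K) →
        SumHessian.IsAdmissible (n - 1) Ω u →
        SumHessian.SolvesDirichlet n l α Ω f u →
        ∀ x ∈ Ω, (-u x) ^ β * ‖iteratedFDeriv ℝ 2 u x‖ ≤ C := by
  open SumHessian in
  have hn : 2 ≤ n := by omega
  -- The constants are fixed before any solution is given, so the signs of `K` and `Λ` are still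
  -- unknown and absolute values are used; a point of `Ω` removes them later.
  obtain ⟨c, c', L₀, hc, hc', hL₀, hlin⟩ := exists_isLinearization hl (Real.log Λ)
  obtain ⟨a, A, β, C, ha, hA, hβ, hC, hbound⟩ := exists_bound_of_isMaxRelation n (K := |K|)
    (d := d) (C₁ := (2 * (|Λ| / m) + (|Λ| / m) ^ 2) * (1 + |K|) ^ 2) (abs_nonneg K)
    (by positivity) hc hc' hL₀
  refine ⟨β, n ^ 2 * (|K| ^ (β - 1) * C * Real.exp (a / 2 * |K| ^ 2 + A / 2 * d ^ 2)) + 1,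
    by linarith, by positivity, ?_⟩
  intro α Ω f u hα hΩ _ hbdd hdiam hf hfpos hfΛ hu huC hK hadm hsol x hx
  obtain ⟨heq, hzero⟩ := hsol
  have hneg := neg_of_isAdmissible hn hΩ hbdd hu huC.2.1 hadm hzero
  have hfpos' : ∀ x ∈ Ω, ∀ z p, 0 < f (x, z, p) := fun x hx => hfpos x (subset_closure hx)
  have hcone : ∀ x ∈ Ω, augment α (hessEigenvalues u x) ∈ gardingCone n Finset.univ := fun x hx =>
    augment_mem_gardingCone (by omega : l < n) hα (hadm x hx) (by rw [heq x hx]; exact hfpos' x hx _ _)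
  have hlog : ∀ x ∈ Ω, logQuot n l (augment α (hessEigenvalues u x))
      = Real.log (f (x, u x, gradient u x)) := fun x hx => by
    rw [logQuot_augment (by omega : l < n) (hcone x hx), heq x hx]
  have hKabs : |K| = K := abs_of_nonneg ((abs_nonneg _).trans (hK x hx).1)
  obtain ⟨i, hi, hipos⟩ := exists_max_eigenvalue hn (hadm x hx)
  obtain ⟨b, hb⟩ := exists_eigenbasis hΩ hu hx
  have hD2i : D2 u x (b i) (b i) = hessEigenvalues u x i := by rw [hb]; simp
  have hbi : ‖b i‖ = 1 := b.orthonormal.1 i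
  -- The centre `y` of the quadratic term is the point `x` at which the estimate is claimed; only
  -- `|x₀ - y| ≤ d` matters.
  obtain ⟨x₀, hx₀, ξ₀, hξ₀, hpos₀, hmax⟩ := exists_testFunction_max (a := a) (A := A) (β := β) hΩ
    hbdd huC hneg hzero (by linarith) x ⟨x, hx, b i, hbi, by rwa [hD2i]⟩
  obtain ⟨b₀, hb₀⟩ := exists_eigenbasis hΩ hu hx₀
  obtain ⟨i₀, hi₀, hi₀pos⟩ := exists_max_eigenvalue hn (hadm x₀ hx₀)
  have hD2i₀ : D2 u x₀ (b₀ i₀) (b₀ i₀) = hessEigenvalues u x₀ i₀ := by rw [hb₀]; simp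
  have hw₀ := neg_pos.2 (hneg x₀ hx₀)
  -- At `x₀` the maximizing direction may be replaced by a top eigenvector, which is then frozen to
  -- obtain a local maximum in `x` alone.
  have htop : testFunction u a A β x x₀ ξ₀ ≤ testFunction u a A β x x₀ (b₀ i₀) := by
    have := Real.rpow_pos_of_pos hw₀ β
    unfold testFunction
    rw [hD2i₀]
    gcongr
    exact D2_self_le hb₀ hi₀ hξ₀
  have hloc := isLocalMax_log_testFunction hΩ hu hneg hx₀ (by rwa [hD2i₀])
    fun x' hx' => (hmax x' hx' (b₀ i₀) (b₀.orthonormal.1 i₀)).trans htop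
  obtain ⟨hfm, hfj⟩ := hfΛ x₀ hx₀ _ _ (hK x₀ hx₀).1 (hK x₀ hx₀).2
  have hfle : f (x₀, u x₀, gradient u x₀) ≤ Λ := by
    have := hfj 0 (by norm_num)
    rw [norm_iteratedFDeriv_zero] at this
    exact (le_abs_self _).trans this
  have hΛabs : |Λ| = Λ := abs_of_nonneg (hm.le.trans (hfm.trans hfle))
  obtain ⟨G, hG⟩ := hlin α hα _ (hcone x₀ hx₀)
    (by rw [hlog x₀ hx₀]; exact Real.log_le_log (hfpos' x₀ hx₀ _ _) hfle) i₀ hi₀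
  have hdom : ∀ x ∈ Ω, ∀ v : Fin n → EuclideanSpace ℝ (Fin n), Orthonormal ℝ v →
      Real.log (f (x, u x, gradient u x)) ≤ Real.log (f (x₀, u x₀, gradient u x₀))
        + ∑ i, G i * (D2 u x (v i) (v i) - hessEigenvalues u x₀ i) := by
    intro x' hx' v hv
    obtain ⟨b', hb'⟩ := exists_eigenbasis hΩ hu hx'
    obtain ⟨P, hP, hPv⟩ := exists_doublyStochastic hb' hv
    have h1 := hG.le _ (hcone x' hx') P hP
    rw [hlog x' hx', hlog x₀ hx₀] at h1
    simpa only [hPv] using h1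
  have hdist : ∀ x' ∈ Ω, ‖x' - x‖ ≤ d := fun x' hx' => by
    rw [← dist_eq_norm]
    exact (Metric.dist_le_diam_of_mem hbdd hx' hx).trans hdiam
  have hrel := isMaxRelation_of_isLocalMax hΩ hu hf.1 hfpos' hx₀ hm (hneg x₀ hx₀) (hK x₀ hx₀).1
    (hK x₀ hx₀).2 (hdist x₀ hx₀) hfm (by rw [← norm_iteratedFDeriv_one]; exact hfj 1 (by norm_num))
    (abs_fderiv_fderiv_le (hfj 2 le_rfl)) hb₀ hi₀pos hG hdom hloc
  rw [hKabs, hΛabs] at hbound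
  have hCb := hbound _ _ _ _ _ _ _ _ _ _ _ hrel
  have hw := neg_pos.2 (hneg x hx)
  have hwβ := Real.rpow_pos_of_pos hw β
  have hchain : (-u x) ^ β * hessEigenvalues u x i
      ≤ |K| ^ (β - 1) * C * Real.exp (a / 2 * |K| ^ 2 + A / 2 * d ^ 2) := by
    calc (-u x) ^ β * hessEigenvalues u x i
        ≤ testFunction u a A β x x (b i) := by
          unfold testFunction
          rw [hD2i]
          exact le_mul_of_one_le_right (by positivity) (Real.one_le_exp (by positivity))
      _ ≤ testFunction u a A β x x₀ (b₀ i₀) := (hmax x hx (b i) hbi).trans htop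
      -- One power of `-u x₀` is split off for the bound on `w * lam i₀`; the others are bounded by
      -- `K`, which needs `β ≥ 1`.
      _ = (-u x₀) ^ (β - 1) * (-u x₀ * hessEigenvalues u x₀ i₀)
          * Real.exp (a / 2 * ‖gradient u x₀‖ ^ 2 + A / 2 * ‖x₀ - x‖ ^ 2) := by
          unfold testFunction
          rw [hD2i₀, ← mul_assoc, ← Real.rpow_add_one hw₀.ne', sub_add_cancel]
      _ ≤ |K| ^ (β - 1) * C * Real.exp (a / 2 * |K| ^ 2 + A / 2 * d ^ 2) := by
          have h1 := hdist x₀ hx₀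
          have h2 := (hK x₀ hx₀).2
          have h3 := (neg_le_abs (u x₀)).trans (hK x₀ hx₀).1
          have h4 := Real.rpow_le_rpow hw₀.le h3 (by linarith : 0 ≤ β - 1)
          have h5 : 0 ≤ -u x₀ * hessEigenvalues u x₀ i₀ := by positivity
          rw [hKabs]
          have h6 : 0 ≤ K := hKabs ▸ abs_nonneg K
          gcongr
  have hnorm := norm_iteratedFDeriv_two_le hb hi (sum_pos_of_mem_coneGamma' hn (hadm x hx))
  calc (-u x) ^ β * ‖iteratedFDeriv ℝ 2 u x‖
      ≤ (-u x) ^ β * (n ^ 2 * hessEigenvalues u x i) := by gcongr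
    _ = n ^ 2 * ((-u x) ^ β * hessEigenvalues u x i) := by ring
    _ ≤ n ^ 2 * (|K| ^ (β - 1) * C * Real.exp (a / 2 * |K| ^ 2 + A / 2 * d ^ 2)) := by gcongr
    _ ≤ _ := by linarith
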